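/- **Setting.** Let $d\in\{2,3\}$, $k\ge 1$, and let $\mathcal T$ be a finite conforming mesh of non-degenerate (affine) $d$-simplices in $\mathbb R^d$; let $\Omega$ be the interior of the union of the cells, and $\Gamma=\partial\Omega$ with outer unit normal $N$. For a vector field $u$ and a matrix field $A$ put $u_n=u\cdot N$, $u_t=u-u_nN$, $A_{tn}=(I-N\otimes N)AN$. Let - $Q_h^k$ be the piecewise polynomials of degree $\le k$ on $\mathcal T$ and $Q_{h,0}^k=\{q\in Q_h^k:\int_\Omega q\,dV=0\}$; - $F_h^k=[Q_h^k]^{d\times d}$, and $[Q_h^{k-1}]^{d\times d}_{\rm skew}$ the skew-symmetric elements of $[Q_h^{k-1}]^{d\times d}$; - $\Sigma_h^k$ be the $A\in [Q_h^k]^{d\times d}$ whose tangential-normal component $A_{tn}$ is continuous across interior facets; - $\mathcal{RT}^k$ be the Raviart–Thomas space of vector fields with $u|_T\in \mathcal P^k(T)^d+\tilde{\mathcal P}^k(T)X$ on every cell $T$ ($\tilde{\mathcal P}^k$: homogeneous polynomials of degree $k$) and continuous normal component. For a piecewise polynomial $u$ with continuous normal component and $A\in\Sigma_h^k$ put $$\langle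 \mathrm{Grad}\,u,A\rangle_{\mathcal T}=\sum_{T}\int_T A:\mathrm{Grad}\,u\,dV-\sum_{F}\int_F A_{tn}\cdot[\![u_t]\!]\,dA ,$$ the second sum being over all interior and boundary facets ($[\![u_t]\!]=u_t$ on the boundary). Let $\mathbb C$ be a linear map of $\mathbb R^{d\times d}$ with $\mathbb CA:A>0$ for $A\ne0$. Let $\Gamma$ be split, along facets, into $\Gamma_{D,t}$ and $\Gamma_{N,t}$, and let $V_h$ be a linear space of piecewise polynomial vector fields with continuous normal component; put $V_{h,0}=\{v\in V_h: v_n=0\text{ on }\Gamma\}$. **Problem.** For homogeneous boundary data ($u_n=0$ on $\Gamma$; $u_t=0$ on $\Gamma_{D,t}$, imposed weakly; $\sigma_{tn}=0$ on $\Gamma_{N,t}$) and a body force $\bar B\in L^2(\Omega;\mathbb R^d)$, find $u\in V_{h,0}$, $\sigma\in\Sigma_h^k$ with $\sigma_{tn}=0$ on $\Gamma_{N,t}$, $\varepsilon\in F_h^k$, $\omega\in[Q_h^{k-1}]^{d\times d}_{\rm skew}$, $p\in Q_{h,0}^k$ such that $$\begin{aligned} &\int_\Omega \mathbb C\varepsilon:\delta\varepsilon\,dV+\int_\Omega\sigma:\delta\varepsilon\,dV-\int_\Omega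 p\,\mathrm{tr}\,\delta\varepsilon\,dV=0,\\ &\int_\Omega \varepsilon:\delta\sigma\,dV-\langle \mathrm{Grad}\,u,\delta\sigma\rangle_{\mathcal T}+\int_\Omega\omega:\delta\sigma\,dV=0,\\ &-\langle\mathrm{Grad}\,\delta u,\sigma\rangle_{\mathcal T}=\int_\Omega\bar B\cdot\delta u\,dV,\qquad \int_\Omega\delta\omega:\sigma\,dV=0,\qquad \int_\Omega-\delta p\,\mathrm{tr}\,\varepsilon\,dV=0 \end{aligned}$$ for all $\delta\varepsilon\in F_h^k$, $\delta\sigma\in\Sigma_h^k$ with $\delta\sigma_{tn}=0$ on $\Gamma_{N,t}$, $\delta u\in V_{h,0}$, $\delta\omega\in[Q_h^{k-1}]^{d\times d}_{\rm skew}$, $\delta p\in Q_{h,0}^k$. **Theorem (pressure-robustness).** Let $\bar B=\mathrm{Grad}\,\Psi$ with $\Psi\in H^1(\Omega)$ and $\int_\Omega\Psi\,dV=0$, and assume $\mathrm{div}(V_{h,0})=Q_{h,0}^k$. Let $\Pi^k\Psi$ be the $L^2(\Omega)$-projection of $\Psi$ onto $Q_h^k$ (which exists and is unique). Then $$(u,\varepsilon,p,\sigma,\omega)=(0,\,0,\,\Pi^k\Psi,\,\Pi^k\Psi\,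 I,\,0)$$ solves the problem, and every solution has $\varepsilon=0$, $p=\Pi^k\Psi$, $\sigma=\Pi^k\Psi\,I$. If $V_h\subseteq\mathcal{RT}^k$ (in particular if $V_h=\mathcal{RT}^k$), it is the unique solution. -/

import Mathlib

open MeasureTheory
open scoped Matrix

noncomputable section

namespace MCS

/-- The Euclidean space `ℝ^d`. -/
abbrev E (d : ℕ) : Type := EuclideanSpace ℝ (Fin d)

/-- Real polynomials in the `d` coordinates. -/
abbrev Poly (d : ℕ) : Type := MvPolynomial (Fin d) ℝ

variable {d : ℕ}

/-! ### Pointwise values and pointwise tensor algebra -/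

/-- Value of a polynomial at a point of `ℝ^d`. -/
def polyAt (p : Poly d) (x : E d) : ℝ := MvPolynomial.eval (fun i => x i) p

/-- Value of a vector of polynomials at a point. -/
def vecAt (v : Fin d → Poly d) (x : E d) : E d := WithLp.toLp 2 fun i => polyAt (v i) x

/-- Value of a matrix of polynomials at a point. -/
def matAt (A : Matrix (Fin d) (Fin d) (Poly d)) (x : E d) : Matrix (Fin d) (Fin d) ℝ :=
  Matrix.of fun i j => polyAt (A i j) x

/-- Frobenius product `A : B`. -/
def frob (A B : Matrix (Fin d) (Fin d) ℝ) : ℝ := ∑ i, ∑ j, A i j * B i j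

/-- Tangential part `(I - N ⊗ N) w` with respect to a unit normal `N`. -/
def tangential (N w : E d) : E d := w - inner ℝ N w • N

/-- Tangential-normal component `(I - N ⊗ N) A N` of a matrix. -/
def tnComponent (A : Matrix (Fin d) (Fin d) ℝ) (N : E d) : E d :=
  tangential N (WithLp.toLp 2 (A *ᵥ (fun i => N i)))

/-- Gradient `(Grad v)ᵢⱼ = ∂ⱼ vᵢ`. -/
def grad (v : Fin d → Poly d) : Matrix (Fin d) (Fin d) (Poly d) :=
  Matrix.of fun i j => MvPolynomial.pderiv j (v i)

/-- Divergence of a polynomial vector field. -/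
def divergence (v : Fin d → Poly d) : Poly d := ∑ i, MvPolynomial.pderiv i (v i)

/-! ### Simplicial meshes -/

/-- A finite conforming mesh of non-degenerate (affine) `d`-simplices in `ℝ^d`; a cell is given by
its set of vertices. -/
structure Triangulation (d : ℕ) where
  cells : Finset (Finset (E d))
  card_cell : ∀ T ∈ cells, T.card = d + 1
  indep : ∀ T ∈ cells, AffineIndependent ℝ (fun v : T => (v : E d))
  conforming : ∀ T ∈ cells, ∀ T' ∈ cells,
    convexHull ℝ (T : Set (E d)) ∩ convexHull ℝ (T' : Set (E d)) =
      convexHull ℝ ((T : Set (E d)) ∩ (T' : Set (E d)))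

open Classical in
/-- Vertex set of the facet of the simplex `T` opposite to its vertex `v`. -/
def facet (T : Finset (E d)) (v : E d) : Finset (E d) := T.erase v

/-- The closed simplex spanned by a set of vertices. -/
def hull (T : Finset (E d)) : Set (E d) := convexHull ℝ (T : Set (E d))

/-- Outer unit normal of the simplex `T` on its facet opposite to `v`: the normalized component,
orthogonal to that facet, of the vector from `v` to (the centroid of) the facet. -/
def outerNormal (T : Finset (E d)) (v : E d) : E d :=
  let w : E d := ((vectorSpan ℝ (facet T v : Set (E d)))ᗮ).starProjection
    ((facet T v).centroid ℝ id - v)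
  ‖w‖⁻¹ • w

namespace Triangulation

variable (M : Triangulation d)

/-- The type of cells of the mesh. -/
abbrev Cell : Type := {T : Finset (E d) // T ∈ M.cells}

/-- The meshed (open) domain `Ω`. -/
def domain : Set (E d) := interior (⋃ T ∈ M.cells, hull T)

/-- The facets lying on the boundary `Γ` of `Ω`: those belonging to exactly one cell. -/
def boundaryFacets : Set (Finset (E d)) :=
  {F | ∃ T ∈ M.cells, ∃ v ∈ T, F = facet T v ∧ ∀ T' ∈ M.cells, F ⊆ T' → T' = T}

/-! ### Piecewise polynomial fields

A piecewise polynomial is one polynomial for each cell (as cells have non-empty interior, this is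
the same as its class modulo null sets). -/

/-- Piecewise polynomial scalar fields. -/
abbrev Scalar : Type := M.Cell → Poly d

/-- Piecewise polynomial vector fields. -/
abbrev Vector : Type := M.Cell → Fin d → Poly d

/-- Piecewise polynomial matrix fields. -/
abbrev Tensor : Type := M.Cell → Matrix (Fin d) (Fin d) (Poly d)

/-- `∫_Ω f dV` for a function `f` given cell by cell. -/
def integral (f : M.Cell → E d → ℝ) : ℝ := ∑ T : M.Cell, ∫ x in hull T.1, f T x

open Classical in
/-- `∫_Γ' f dA` over the part of the boundary formed by the facets in `Γ'`, where
`f T v x` is the integrand on the facet of `T` opposite to `v`. -/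
def boundaryIntegral (Γ' : Set (Finset (E d))) (f : M.Cell → E d → E d → ℝ) : ℝ :=
  ∑ T : M.Cell, ∑ v ∈ T.1,
    if facet T.1 v ∈ Γ' then ∫ x in hull (facet T.1 v), f T v x ∂μHE[d - 1] else 0

/-- The pressure space `Q_h^k`: piecewise polynomials of degree at most `k`. -/
def Q (k : ℕ) : Set M.Scalar :=
  {q | ∀ T, q T ∈ MvPolynomial.restrictTotalDegree (Fin d) ℝ k}

/-- The elements of `Q_h^k` with vanishing mean value over `Ω`. -/
def QZeroMean (k : ℕ) : Set M.Scalar :=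
  {q | q ∈ M.Q k ∧ M.integral (fun T x => polyAt (q T) x) = 0}

/-- Piecewise polynomial vector fields (of any degree) in `H(div)`: the normal jump
`u|_{T₁} · N_{T₁} + u|_{T₂} · N_{T₂}` vanishes on every interior facet. -/
def HDiv : Set M.Vector :=
  {u | ∀ T T' : M.Cell, T ≠ T' → ∀ v ∈ T.1, ∀ v' ∈ T'.1, facet T.1 v = facet T'.1 v' →
    ∀ x ∈ hull (facet T.1 v),
      inner ℝ (vecAt (u T) x) (outerNormal T.1 v)
        + inner ℝ (vecAt (u T') x) (outerNormal T'.1 v') = 0}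

/-- The Raviart--Thomas space `RT^k`: on each cell `P^k(T; ℝ^d) + P̃^k(T) X`, where `P̃^k` are the
homogeneous polynomials of degree `k`, with continuous normal component. -/
def RT (k : ℕ) : Set M.Vector :=
  {u | u ∈ M.HDiv ∧ ∀ T : M.Cell, ∃ w : Fin d → Poly d, ∃ q : Poly d,
    (∀ i, w i ∈ MvPolynomial.restrictTotalDegree (Fin d) ℝ k) ∧
    q ∈ MvPolynomial.homogeneousSubmodule (Fin d) ℝ k ∧
    ∀ i, u T i = w i + q * MvPolynomial.X i}

/-- `u · N = g` on all boundary facets in `Γ'`. -/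
def NormalTraceEq (Γ' : Set (Finset (E d))) (u : M.Vector) (g : Finset (E d) → E d → ℝ) : Prop :=
  ∀ T : M.Cell, ∀ v ∈ T.1, facet T.1 v ∈ Γ' → ∀ x ∈ hull (facet T.1 v),
    inner ℝ (vecAt (u T) x) (outerNormal T.1 v) = g (facet T.1 v) x

/-- Piecewise matrix-valued polynomials of degree at most `k`, without continuity. On affine meshes
this is both the broken stress space and its transpose, the strain space `F_h^k`. -/
def Strain (k : ℕ) : Set M.Tensor :=
  {A | ∀ T i j, A T i j ∈ MvPolynomial.restrictTotalDegree (Fin d) ℝ k}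

/-- The stress space `Σ_h^k`: piecewise polynomials of degree at most `k` whose tangential-normal
component is continuous over interior facets. (For the outer normals `N_{T₁} = -N_{T₂}`, continuity
means that the two outer tangential-normal traces add up to zero.) -/
def Stress (k : ℕ) : Set M.Tensor :=
  {A | A ∈ M.Strain k ∧
    ∀ T T' : M.Cell, T ≠ T' → ∀ v ∈ T.1, ∀ v' ∈ T'.1, facet T.1 v = facet T'.1 v' →
    ∀ x ∈ hull (facet T.1 v),
      tnComponent (matAt (A T) x) (outerNormal T.1 v)
        + tnComponent (matAt (A T') x) (outerNormal T'.1 v') = 0}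

/-- `(I - N ⊗ N) A N = g` on all boundary facets in `Γ'`. -/
def TNTraceEq (Γ' : Set (Finset (E d))) (A : M.Tensor) (g : Finset (E d) → E d → E d) : Prop :=
  ∀ T : M.Cell, ∀ v ∈ T.1, facet T.1 v ∈ Γ' → ∀ x ∈ hull (facet T.1 v),
    tnComponent (matAt (A T) x) (outerNormal T.1 v) = g (facet T.1 v) x

/-- Piecewise polynomial skew-symmetric matrix fields of degree at most `m`. -/
def Skew (m : ℕ) : Set M.Tensor :=
  {A | A ∈ M.Strain m ∧ ∀ T, (A T)ᵀ = -A T}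

/-- The discrete duality pairing
`⟨Grad u, A⟩ = ∑_T ∫_T A : Grad u dV - ∑_F ∫_F A_{tn} · ⟦u_t⟧ dA` of a tangential-normal continuous
`A` with a normal continuous `u`. The facet sum (over interior and boundary facets, with
`⟦u_t⟧ = u_t` on the boundary) is written as a sum over the cell boundaries, with outer normals. -/
def pairing (u : M.Vector) (A : M.Tensor) : ℝ :=
  M.integral (fun T x => frob (matAt (A T) x) (matAt (grad (u T)) x))
    - ∑ T : M.Cell, ∑ v ∈ T.1, ∫ x in hull (facet T.1 v),
        inner ℝ (tnComponent (matAt (A T) x) (outerNormal T.1 v))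
          (tangential (outerNormal T.1 v) (vecAt (u T) x)) ∂μHE[d - 1]

/-- `P` is the `L²(Ω)`-projection of `Ψ` onto `Q_h^k`. -/
def IsL2Projection (k : ℕ) (Ψ : E d → ℝ) (P : M.Scalar) : Prop :=
  P ∈ M.Q k ∧ ∀ q ∈ M.Q k,
    M.integral (fun T x => polyAt (P T) x * polyAt (q T) x)
      = M.integral (fun T x => Ψ x * polyAt (q T) x)

/-! ### The small strain problem -/

/-- Data of the boundary value problem: body force, the splittings `Γ = Γ_{D,n} ∪ Γ_{N,n}` and
`Γ = Γ_{D,t} ∪ Γ_{N,t}` of the boundary (unions of boundary facets), and the prescribed boundary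
displacements `Un`, `Ut` and tractions `Tn`, `Tt`, given facet by facet. -/
structure Data where
  B : E d → E d
  ΓDn : Set (Finset (E d))
  ΓDt : Set (Finset (E d))
  ΓDn_subset : ΓDn ⊆ M.boundaryFacets
  ΓDt_subset : ΓDt ⊆ M.boundaryFacets
  Un : Finset (E d) → E d → ℝ
  Ut : Finset (E d) → E d → E d
  Tn : Finset (E d) → E d → ℝ
  Tt : Finset (E d) → E d → E d

variable {M} in
/-- `Γ_{N,n}`. -/
def Data.ΓNn (D : M.Data) : Set (Finset (E d)) := M.boundaryFacets \ D.ΓDn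

variable {M} in
/-- `Γ_{N,t}`. -/
def Data.ΓNt (D : M.Data) : Set (Finset (E d)) := M.boundaryFacets \ D.ΓDt

variable {M} in
/-- `L*_ext(δσ) = ∫_{Γ_{D,t}} Ut · δσ_{tn} dA`. -/
def Data.loadStress (D : M.Data) (δσ : M.Tensor) : ℝ :=
  M.boundaryIntegral D.ΓDt fun T v x =>
    inner ℝ (D.Ut (facet T.1 v) x) (tnComponent (matAt (δσ T) x) (outerNormal T.1 v))

variable {M} in
/-- `L_ext(δu) = ∫_Ω B · δu dV + ∫_{Γ_{N,n}} Tn δu_n dA`. -/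
def Data.load (D : M.Data) (δu : M.Vector) : ℝ :=
  M.integral (fun T x => inner ℝ (D.B x) (vecAt (δu T) x))
    + M.boundaryIntegral D.ΓNn fun T v x =>
        D.Tn (facet T.1 v) x * inner ℝ (vecAt (δu T) x) (outerNormal T.1 v)

/-- The unknowns: displacement `u`, stress `σ`, strain `ε`, rotation `ω`, pressure `p`. -/
@[ext]
structure Fields where
  u : M.Vector
  σ : M.Tensor
  ε : M.Tensor
  ω : M.Tensor
  p : M.Scalar

/-- `S` solves the discrete small strain problem of order `k` with elasticity tensor `C`,
displacement space `V` and pressure space `Qp`. -/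
structure IsSolution (k : ℕ) (C : Matrix (Fin d) (Fin d) ℝ →ₗ[ℝ] Matrix (Fin d) (Fin d) ℝ)
    (D : M.Data) (V : Set M.Vector) (Qp : Set M.Scalar) (S : M.Fields) : Prop where
  mem_u : S.u ∈ V
  mem_σ : S.σ ∈ M.Stress k
  mem_ε : S.ε ∈ M.Strain k
  mem_ω : S.ω ∈ M.Skew (k - 1)
  mem_p : S.p ∈ Qp
  bc_u : M.NormalTraceEq D.ΓDn S.u D.Un
  bc_σ : M.TNTraceEq D.ΓNt S.σ D.Tt
  eq_ε : ∀ δε ∈ M.Strain k,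
    M.integral (fun T x => frob (C (matAt (S.ε T) x)) (matAt (δε T) x))
      + M.integral (fun T x => frob (matAt (S.σ T) x) (matAt (δε T) x))
      - M.integral (fun T x => polyAt (S.p T) x * (matAt (δε T) x).trace) = 0
  eq_σ : ∀ δσ ∈ M.Stress k, M.TNTraceEq D.ΓNt δσ (fun _ _ => 0) →
    M.integral (fun T x => frob (matAt (S.ε T) x) (matAt (δσ T) x))
      - M.pairing S.u δσ
      + M.integral (fun T x => frob (matAt (S.ω T) x) (matAt (δσ T) x)) = D.loadStress δσ
  eq_u : ∀ δu ∈ V, M.NormalTraceEq D.ΓDn δu (fun _ _ => 0) →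
    -M.pairing δu S.σ = D.load δu
  eq_ω : ∀ δω ∈ M.Skew (k - 1),
    M.integral (fun T x => frob (matAt (δω T) x) (matAt (S.σ T) x)) = 0
  eq_p : ∀ δp ∈ Qp,
    M.integral (fun T x => -(polyAt (δp T) x * (matAt (S.ε T) x).trace)) = 0

/-- The fields `u = 0`, `σ = P I`, `ε = 0`, `ω = 0`, `p = P`. -/
def hydrostatic (P : M.Scalar) : M.Fields where
  u := 0
  σ := fun T => P T • (1 : Matrix (Fin d) (Fin d) (Poly d))
  ε := 0
  ω := 0
  p := P

end Triangulation

/-- `Ψ ∈ H¹(Ω)` with weak gradient `B`: both are square integrable over the open set `Ω`, and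
`∫_Ω Ψ ∂ᵢφ = -∫_Ω Bᵢ φ` for all smooth `φ` with compact support in `Ω`. -/
def HasWeakGradient (Ω : Set (E d)) (Ψ : E d → ℝ) (B : E d → E d) : Prop :=
  MemLp Ψ 2 (volume.restrict Ω) ∧ MemLp B 2 (volume.restrict Ω) ∧
    ∀ φ : E d → ℝ, ContDiff ℝ ((⊤ : ℕ∞) : WithTop ℕ∞) φ → HasCompactSupport φ → tsupport φ ⊆ Ω →
      ∀ i : Fin d,
        ∫ x in Ω, Ψ x * fderiv ℝ φ x (EuclideanSpace.single i 1) = -∫ x in Ω, B x i * φ x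

end MCS

end

/-! A hydrostatic stress `p I` has no tangential-normal component. It therefore lies in Σ_h^k for
every `p ∈ Q_h^k`, has zero tangential traction, and pairs with a displacement through its
divergence only: `⟨Grad u, p I⟩ = ∫ p div u` (`pairing_isotropic`). A gradient force does the work
`-∫ Ψ div δu` on `δu ∈ V_{h,0}`, and since `div δu ∈ Q_h^k`, `Ψ` may be replaced by its projection
`P` (`load_eq_neg_intPoly`). So `P I` carries the load without any deformation.

The analytic core is Green's formula `∫ B · w + Ψ div w = 0` for piecewise smooth `w` with
continuous normal component and no flux through Γ (`integral_greenIntegrand_eq_zero`). It is derived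
directly from test functions with compact support in Ω, without traces of `Ψ`. Near facets free of
flux, `w` is cut off at scale `1/n`; the error `∇χₙ · w` stays bounded because `∇λ · w = O(λ)`
there, and dominated convergence applies. On each cell, `w` is split into one part per facet
carrying the flux through it. Parts of neighbouring cells cancel, the remaining ones vanish.

For an arbitrary solution, testing compatibility with `σ - P I` leaves `∫ C ε : ε = 0`, so `ε = 0`;
the constitutive equation then gives `σ = p I`, and surjectivity of the divergence gives `p = P`.

For uniqueness of `u` and `ω`, note that `⟨Grad u, A⟩ = ∫ ω : A` for all admissible `A`. Taking `A =
(div u) I` yields `div u = 0`, hence degree at most `k` in the Raviart–Thomas case. Bubble stresses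
give `Grad u = ω` (`grad_eq_of_pairing`), so `u` is a rigid motion on each cell, and stresses
carried by one facet give tangential continuity (`tangential_eq_of_jump_eq_zero`). A rigid motion on
a set of cells closed under adjacency that is tangential to the boundary vanishes
(`eq_zero_of_rigid`), again by Green's formula, now with a linear potential. -/

namespace MCS

variable {d : ℕ}

/-! ### Barycentric coordinates of a simplex -/

/-- `T` is the vertex set of a non-degenerate `d`-simplex. -/
structure IsSimplex (T : Finset (E d)) : Prop where
  card : T.card = d + 1
  indep : AffineIndependent ℝ (fun v : T => (v : E d))

theorem Triangulation.isSimplex (M : Triangulation d) (T : M.Cell) : IsSimplex T.1 :=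
  ⟨M.card_cell _ T.2, M.indep _ T.2⟩

/-- The vertices of a non-degenerate simplex as an affine basis. -/
noncomputable def IsSimplex.basis {T : Finset (E d)} (hT : IsSimplex T) :
    AffineBasis T ℝ (E d) :=
  ⟨fun v => v, hT.indep, by
    rw [hT.indep.affineSpan_eq_top_iff_card_eq_finrank_add_one]
    simp [hT.card]⟩

open Classical in
/-- The barycentric coordinate of the vertex `v` of the simplex `T`. -/
noncomputable def bary (T : Finset (E d)) (v : E d) : E d →ᵃ[ℝ] ℝ :=
  if h : IsSimplex T ∧ v ∈ T then h.1.basis.coord ⟨v, h.2⟩ else 0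

/-- The (constant) gradient of a barycentric coordinate. -/
noncomputable def baryGrad (T : Finset (E d)) (v : E d) : E d :=
  (InnerProductSpace.toDual ℝ (E d)).symm (LinearMap.toContinuousLinearMap (bary T v).linear)

theorem bary_sub (T : Finset (E d)) (v x y : E d) :
    bary T v y - bary T v x = inner ℝ (baryGrad T v) (y - x) := by
  rw [baryGrad, InnerProductSpace.toDual_symm_apply]
  simp [← vsub_eq_sub, AffineMap.linearMap_vsub]

theorem bary_eq (T : Finset (E d)) (v x : E d) :
    bary T v x = inner ℝ (baryGrad T v) x + bary T v 0 := by
  have := bary_sub T v 0 x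
  rw [sub_zero] at this
  linarith

theorem continuous_bary (T : Finset (E d)) (v : E d) : Continuous (bary T v) :=
  (bary T v).continuous_of_finiteDimensional

theorem contDiff_bary (T : Finset (E d)) (v : E d) {n : WithTop ℕ∞} :
    ContDiff ℝ n (bary T v) := by
  have h : (bary T v : E d → ℝ) = fun x => inner ℝ (baryGrad T v) x + bary T v 0 :=
    funext fun x => bary_eq T v x
  rw [h]
  exact (contDiff_const.inner ℝ contDiff_id).add contDiff_const

theorem hasFDerivAt_bary (T : Finset (E d)) (v x : E d) :
    HasFDerivAt (bary T v) (innerSL ℝ (baryGrad T v)) x := by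
  have h : (bary T v : E d → ℝ) = fun x => innerSL ℝ (baryGrad T v) x + bary T v 0 :=
    funext fun x => by simpa using bary_eq T v x
  rw [h]
  exact (innerSL ℝ (baryGrad T v)).hasFDerivAt.add_const _

theorem mem_facet {T : Finset (E d)} {u v : E d} : u ∈ facet T v ↔ u ≠ v ∧ u ∈ T := by
  simp [facet]

theorem hull_facet_subset (T : Finset (E d)) (v : E d) : hull (facet T v) ⊆ hull T :=
  convexHull_mono fun _ hu => (mem_facet.1 hu).2

theorem isCompact_hull (T : Finset (E d)) : IsCompact (hull T) :=
  T.finite_toSet.isCompact_convexHull (𝕜 := ℝ)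

theorem measurableSet_hull (T : Finset (E d)) : MeasurableSet (hull T) :=
  (isCompact_hull T).isClosed.measurableSet

theorem convex_hull (T : Finset (E d)) : Convex ℝ (hull T) := convex_convexHull ℝ _

theorem subset_hull {T : Finset (E d)} {v : E d} (hv : v ∈ T) : v ∈ hull T :=
  subset_convexHull ℝ _ hv

namespace IsSimplex

variable {T : Finset (E d)}

theorem bary_eq_coord (hT : IsSimplex T) {v : E d} (hv : v ∈ T) : bary T v = hT.basis.coord ⟨v, hv⟩ :=
  dif_pos ⟨hT, hv⟩

theorem bary_self (hT : IsSimplex T) {v : E d} (hv : v ∈ T) : bary T v v = 1 := by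
  rw [hT.bary_eq_coord hv]
  exact hT.basis.coord_apply_eq ⟨v, hv⟩

theorem bary_of_ne (hT : IsSimplex T) {u v : E d} (hv : v ∈ T) (hu : u ∈ T) (h : u ≠ v) : bary T v u = 0 := by
  rw [hT.bary_eq_coord hv]
  exact hT.basis.coord_apply_ne (i := ⟨v, hv⟩) (j := ⟨u, hu⟩) (fun e => h (congrArg Subtype.val e).symm)

theorem sum_bary (hT : IsSimplex T) (x : E d) : ∑ v ∈ T, bary T v x = 1 := by
  rw [← hT.basis.sum_coord_apply_eq_one x, ← Finset.sum_coe_sort T]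
  exact Finset.sum_congr rfl fun v _ => by rw [hT.bary_eq_coord v.2]

theorem sum_bary_smul (hT : IsSimplex T) (x : E d) : ∑ v ∈ T, bary T v x • v = x := by
  conv_rhs => rw [← hT.basis.linear_combination_coord_eq_self x]
  rw [← Finset.sum_coe_sort T]
  exact Finset.sum_congr rfl fun v _ => by rw [hT.bary_eq_coord v.2]; rfl

theorem range_basis (hT : IsSimplex T) : Set.range hT.basis = (T : Set (E d)) := by
  ext x
  constructor
  · rintro ⟨v, rfl⟩
    exact v.2
  · intro hx
    exact ⟨⟨x, hx⟩, rfl⟩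

theorem mem_hull_iff (hT : IsSimplex T) {x : E d} : x ∈ hull T ↔ ∀ v ∈ T, 0 ≤ bary T v x := by
  rw [hull, ← hT.range_basis, hT.basis.convexHull_eq_nonneg_coord]
  constructor
  · intro h v hv
    rw [hT.bary_eq_coord hv]
    exact h _
  · rintro h ⟨v, hv⟩
    rw [← hT.bary_eq_coord hv]
    exact h v hv

theorem mem_interior_hull_iff (hT : IsSimplex T) {x : E d} : x ∈ interior (hull T) ↔ ∀ v ∈ T, 0 < bary T v x := by
  rw [hull, ← hT.range_basis, hT.basis.interior_convexHull]
  constructor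
  · intro h v hv
    rw [hT.bary_eq_coord hv]
    exact h _
  · rintro h ⟨v, hv⟩
    rw [← hT.bary_eq_coord hv]
    exact h v hv

theorem nonempty (hT : IsSimplex T) : T.Nonempty := by
  rw [← Finset.card_pos, hT.card]
  omega

theorem interior_hull_nonempty (hT : IsSimplex T) : (interior (hull T)).Nonempty := by
  have : Nonempty T := hT.nonempty.to_subtype
  rw [hull, ← hT.range_basis]
  exact ⟨_, hT.basis.centroid_mem_interior_convexHull⟩

/-- Once the coordinate of `v` vanishes, the barycentric expansion of the point runs over the
vertices of the facet alone. Facet geometry thereby becomes a matter of signs of barycentric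
coordinates. -/
theorem mem_hull_facet_iff (hT : IsSimplex T) {v x : E d} (hv : v ∈ T) :
    x ∈ hull (facet T v) ↔ x ∈ hull T ∧ bary T v x = 0 := by
  classical
  constructor
  · intro hx
    refine ⟨hull_facet_subset T v hx, ?_⟩
    have h : hull (facet T v) ⊆ bary T v ⁻¹' {0} := by
      refine convexHull_min ?_ ((convex_singleton (0 : ℝ)).affine_preimage (bary T v))
      intro u hu
      obtain ⟨h1, h2⟩ := mem_facet.1 hu
      exact hT.bary_of_ne hv h2 h1
    exact h hx
  · rintro ⟨hx, h0⟩
    rw [hT.mem_hull_iff] at hx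
    have h1 := hT.sum_bary x
    have h2 := hT.sum_bary_smul x
    rw [← Finset.add_sum_erase _ _ hv, h0] at h1 h2
    rw [zero_smul, zero_add] at h2
    rw [zero_add] at h1
    rw [← h2]
    exact (convex_hull _).sum_mem (fun u hu => hx u (Finset.mem_of_mem_erase hu)) h1
      (fun u hu => subset_hull (by simpa [facet] using hu))

/-- A vector is expanded in the edge vectors at the vertex `v`. -/
theorem sum_inner_smul_sub (hT : IsSimplex T) (v y : E d) :
    ∑ u ∈ T, inner ℝ (baryGrad T u) y • (u - v) = y := by
  have h (u : E d) : inner ℝ (baryGrad T u) y = bary T u y - bary T u 0 := by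
    rw [bary_sub, sub_zero]
  simp only [h, smul_sub, sub_smul, Finset.sum_sub_distrib, hT.sum_bary_smul, ← Finset.sum_smul,
    hT.sum_bary]
  simp

/-- A vector is expanded in the gradients of the barycentric coordinates. -/
theorem sum_inner_sub_smul (hT : IsSimplex T) (v y : E d) :
    ∑ u ∈ T, inner ℝ y (u - v) • baryGrad T u = y := by
  refine ext_inner_right ℝ fun z => ?_
  rw [sum_inner]
  conv_rhs => rw [← hT.sum_inner_smul_sub v z, inner_sum]
  refine Finset.sum_congr rfl fun u _ => ?_
  rw [inner_smul_left, inner_smul_right]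
  simp [mul_comm]

theorem inner_baryGrad_sub (hT : IsSimplex T) {u v x : E d} (hu : u ∈ T) (hv : v ∈ T) (h : v ≠ u) :
    inner ℝ (baryGrad T u) (x - v) = bary T u x := by
  rw [← bary_sub, hT.bary_of_ne hu hv h, sub_zero]

theorem baryGrad_ne_zero (hT : IsSimplex T) (hd : 1 ≤ d) {v : E d} (hv : v ∈ T) : baryGrad T v ≠ 0 := by
  intro h
  obtain ⟨u, hu, huv⟩ := T.exists_mem_ne (by rw [hT.card]; omega) v
  have h1 := bary_sub T v u v
  rw [h, inner_zero_left, hT.bary_self hv, hT.bary_of_ne hv hu huv] at h1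
  norm_num at h1

theorem facet_nonempty (hT : IsSimplex T) (hd : 1 ≤ d) (v : E d) : (facet T v).Nonempty := by
  obtain ⟨u, hu, huv⟩ := T.exists_mem_ne (by rw [hT.card]; omega) v
  exact ⟨u, mem_facet.2 ⟨huv, hu⟩⟩

/-- A vector orthogonal to the directions of a facet is a multiple of the gradient. -/
theorem exists_smul_baryGrad_of_orthogonal (hT : IsSimplex T) (hd : 1 ≤ d) {v y : E d} (hv : v ∈ T)
    (h : ∀ u ∈ facet T v, ∀ u' ∈ facet T v, inner ℝ y (u - u') = 0) :
    ∃ c : ℝ, y = c • baryGrad T v := by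
  classical
  obtain ⟨a, ha⟩ := hT.facet_nonempty hd v
  refine ⟨inner ℝ y (v - a), ?_⟩
  conv_lhs => rw [← hT.sum_inner_sub_smul a y]
  rw [Finset.sum_eq_single_of_mem v hv]
  intro u hu huv
  rw [h u (mem_facet.2 ⟨huv, hu⟩) a ha, zero_smul]

theorem inner_baryGrad_eq_zero (hT : IsSimplex T) {v x y : E d} (hv : v ∈ T) (hx : x ∈ hull (facet T v))
    (hy : y ∈ hull (facet T v)) : inner ℝ (baryGrad T v) (x - y) = 0 := by
  rw [← bary_sub, ((hT.mem_hull_facet_iff hv).1 hx).2, ((hT.mem_hull_facet_iff hv).1 hy).2,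
    sub_self]

/-- The orthogonal complement of the facet directions is the line spanned by the gradient of the
coordinate of `v`. This coordinate falls from 1 to 0 on the way from `v` to the facet, which fixes
the sign. -/
theorem outerNormal_eq (hT : IsSimplex T) (hd : 1 ≤ d) {v : E d} (hv : v ∈ T) :
    outerNormal T v = -(‖baryGrad T v‖⁻¹ • baryGrad T v) := by
  have hg := hT.baryGrad_ne_zero hd hv
  set g := baryGrad T v with hgdef
  have hn : ‖g‖ ≠ 0 := norm_ne_zero_iff.2 hg
  set W := vectorSpan ℝ (facet T v : Set (E d)) with hW
  have hmem (y : E d) : y ∈ Wᗮ ↔ ∃ c : ℝ, y = c • g := by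
    constructor
    · intro hy
      refine hT.exists_smul_baryGrad_of_orthogonal hd hv fun u hu u' hu' => ?_
      rw [real_inner_comm]
      exact hy _ (vsub_mem_vectorSpan ℝ hu hu')
    · rintro ⟨c, rfl⟩
      refine Submodule.smul_mem _ _ ?_
      rw [Submodule.mem_orthogonal]
      intro z hz
      rw [hW, vectorSpan] at hz
      induction hz using Submodule.span_induction with
      | mem z hz =>
        obtain ⟨a, ha, b, hb, rfl⟩ := hz
        rw [real_inner_comm]
        exact hT.inner_baryGrad_eq_zero hv (subset_hull ha) (subset_hull hb)
      | zero => simp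
      | add a b _ _ ha hb => rw [inner_add_left, ha, hb, add_zero]
      | smul c a _ ha => rw [inner_smul_left, ha, mul_zero]
  have hc : (facet T v).centroid ℝ id ∈ hull (facet T v) := by
    exact Finset.centroid_mem_convexHull _ (hT.facet_nonempty hd v)
  have hproj : Wᗮ.starProjection ((facet T v).centroid ℝ id - v) = -((‖g‖ ^ 2)⁻¹ • g) := by
    refine Submodule.eq_starProjection_of_mem_of_inner_eq_zero ((hmem _).2 ⟨-(‖g‖ ^ 2)⁻¹, by simp⟩) ?_
    intro y hy
    obtain ⟨c, rfl⟩ := (hmem y).1 hy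
    have h1 : inner ℝ g ((facet T v).centroid ℝ id - v) = -1 := by
      rw [← bary_sub, hT.bary_self hv, ((hT.mem_hull_facet_iff hv).1 hc).2]
      norm_num
    rw [inner_smul_right, real_inner_comm, inner_sub_right, h1, inner_neg_right, inner_smul_right,
      real_inner_self_eq_norm_sq]
    field_simp
    simp
  rw [outerNormal, hproj, norm_neg, norm_smul, norm_inv, norm_pow, norm_norm, smul_neg, smul_smul]
  congr 2
  field_simp

theorem outerNormal_eq_smul (hT : IsSimplex T) (hd : 1 ≤ d) {v : E d} (hv : v ∈ T) :
    ∃ c : ℝ, 0 < c ∧ outerNormal T v = -(c • baryGrad T v) :=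
  ⟨‖baryGrad T v‖⁻¹, inv_pos.2 (norm_pos_iff.2 (hT.baryGrad_ne_zero hd hv)),
    hT.outerNormal_eq hd hv⟩

theorem norm_outerNormal (hT : IsSimplex T) (hd : 1 ≤ d) {v : E d} (hv : v ∈ T) : ‖outerNormal T v‖ = 1 := by
  rw [hT.outerNormal_eq hd hv, norm_neg, norm_smul, norm_inv, norm_norm,
    inv_mul_cancel₀ (norm_ne_zero_iff.2 (hT.baryGrad_ne_zero hd hv))]

theorem inner_outerNormal_eq_zero_iff (hT : IsSimplex T) (hd : 1 ≤ d) {v y : E d} (hv : v ∈ T) :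
    inner ℝ y (outerNormal T v) = 0 ↔ inner ℝ (baryGrad T v) y = 0 := by
  obtain ⟨c, hc, h⟩ := hT.outerNormal_eq_smul hd hv
  rw [h, inner_neg_right, inner_smul_right, neg_eq_zero, mul_eq_zero, real_inner_comm]
  simp [hc.ne']

/-- A continuously differentiable function that vanishes on a facet is bounded, on the simplex, by
a multiple of the barycentric coordinate that vanishes there. -/
theorem exists_abs_le_mul_bary (hT : IsSimplex T) (hd : 1 ≤ d) {v : E d} (hv : v ∈ T) {f : E d → ℝ}
    (hf : ContDiff ℝ 1 f) (h0 : ∀ x ∈ hull (facet T v), f x = 0) :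
    ∃ C : ℝ, ∀ x ∈ hull T, |f x| ≤ C * bary T v x := by
  classical
  -- A point of the simplex lies on a segment from `v` to a point `y` of the facet, at distance `λ_v
  -- * dist v y` from `y`. The Lipschitz bound is applied between these two points, as `f y = 0`.
  obtain ⟨K, hK⟩ := hf.contDiffOn.exists_lipschitzOnWith one_ne_zero (convex_hull T) (isCompact_hull T)
  refine ⟨K * Metric.diam (hull T), fun x hx => ?_⟩
  have hT' : (T : Set (E d)) = insert v (facet T v : Set (E d)) := by
    simp [facet, hv]
  have hx' := hx
  rw [hull, hT', convexHull_insert (hT.facet_nonempty hd v)] at hx'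
  simp only [convexJoin_singleton_left, Set.mem_iUnion] at hx'
  obtain ⟨y, hy, a, b, ha, hb, hab, rfl⟩ := hx'
  have hyT := hull_facet_subset T v hy
  have hbary : bary T v (a • v + b • y) = a := by
    rw [Convex.combo_affine_apply hab, hT.bary_self hv, ((hT.mem_hull_facet_iff hv).1 hy).2]
    simp
  have hd1 := hK.dist_le_mul _ hx _ hyT
  rw [h0 y hy, Real.dist_eq, sub_zero] at hd1
  have hd2 : dist (a • v + b • y) y = a * dist v y := by
    rw [dist_eq_norm, dist_eq_norm]
    have : a • v + b • y - y = a • (v - y) := by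
      have : b = 1 - a := by linarith
      rw [this]; module
    rw [this, norm_smul, Real.norm_of_nonneg ha]
  have hd3 : dist v y ≤ Metric.diam (hull T) :=
    Metric.dist_le_diam_of_mem (isCompact_hull T).isBounded (subset_hull hv) hyT
  rw [hbary]
  calc |f (a • v + b • y)| ≤ K * (a * dist v y) := by rw [← hd2]; exact hd1
    _ ≤ K * (a * Metric.diam (hull T)) := by gcongr
    _ = K * Metric.diam (hull T) * a := by ring

end IsSimplex

end MCS

namespace MCS

variable {d : ℕ}

/-! ### Adjacent cells and the measure of the mesh -/

theorem bary_sum_smul (S : Finset (E d)) (s : E d) (A : Finset (E d)) (w : E d → ℝ)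
    (hw : ∑ u ∈ A, w u = 1) : bary S s (∑ u ∈ A, w u • u) = ∑ u ∈ A, w u * bary S s u := by
  rw [bary_eq, inner_sum]
  have h : ∀ u ∈ A, w u * bary S s u = inner ℝ (baryGrad S s) (w u • u) + w u * bary S s 0 := by
    intro u _
    rw [bary_eq S s u, inner_smul_right, mul_add]
  rw [Finset.sum_congr rfl h, Finset.sum_add_distrib, ← Finset.sum_mul, hw, one_mul]

namespace IsSimplex

variable {T T' : Finset (E d)}

theorem bary_eq_sum (hT : IsSimplex T) (S : Finset (E d)) (s x : E d) :
    bary S s x = ∑ u ∈ T, bary T u x * bary S s u := by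
  conv_lhs => rw [← hT.sum_bary_smul x]
  exact bary_sum_smul S s T (fun u => bary T u x) (hT.sum_bary x)

/-- Both sides are affine and vanish on the common facet, so it suffices to compare them at `v`. The
sign of the factor `bary T' v' v` records on which side of the facet the second cell lies. -/
theorem bary_eq_mul_of_facet_eq (hT : IsSimplex T) (hT' : IsSimplex T') {v v' : E d} (hv : v ∈ T)
    (hv' : v' ∈ T') (h : facet T v = facet T' v') (x : E d) :
    bary T' v' x = bary T' v' v * bary T v x := by
  rw [hT.bary_eq_sum T' v' x, Finset.sum_eq_single_of_mem v hv, mul_comm]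
  intro u hu huv
  have hu' : u ∈ facet T' v' := h ▸ mem_facet.2 ⟨huv, hu⟩
  obtain ⟨h1, h2⟩ := mem_facet.1 hu'
  rw [hT'.bary_of_ne hv' h2 h1, mul_zero]

theorem baryGrad_eq_smul_of_facet_eq (hT : IsSimplex T) (hT' : IsSimplex T') {v v' : E d}
    (hv : v ∈ T) (hv' : v' ∈ T') (h : facet T v = facet T' v') :
    baryGrad T' v' = bary T' v' v • baryGrad T v := by
  refine ext_inner_right ℝ fun y => ?_
  have h1 := bary_sub T' v' 0 y
  have h2 := bary_sub T v 0 y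
  rw [sub_zero] at h1 h2
  rw [inner_smul_left, ← h1, ← h2, hT.bary_eq_mul_of_facet_eq hT' hv hv' h y,
    hT.bary_eq_mul_of_facet_eq hT' hv hv' h 0]
  simp
  ring

/-- A point in the hyperplane of the common facet is an affine combination of the vertices of that
facet, with the same weights for both cells. -/
theorem bary_eq_of_facet_eq (hT : IsSimplex T) (hT' : IsSimplex T') {v v' u x : E d}
    (h : facet T v = facet T' v') (hu : u ∈ facet T v) (hx : bary T v x = 0) :
    bary T' u x = bary T u x := by
  classical
  have hu2 := (mem_facet.1 hu).2
  have hu' := (mem_facet.1 (h ▸ hu : u ∈ facet T' v')).2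
  rw [hT.bary_eq_sum T' u x, Finset.sum_eq_single_of_mem u hu2, hT'.bary_self hu', mul_one]
  intro s hs hsu
  by_cases hsv : s = v
  · rw [hsv, hx, zero_mul]
  · have hs' := (mem_facet.1 (h ▸ mem_facet.2 ⟨hsv, hs⟩ : s ∈ facet T' v')).2
    rw [hT'.bary_of_ne hu' hs' hsu, mul_zero]

theorem volume_frontier_hull (T : Finset (E d)) : volume (frontier (hull T)) = 0 :=
  (convex_hull T).addHaar_frontier _

theorem volume_hull_facet (hT : IsSimplex T) {v : E d} (hv : v ∈ T) :
    volume (hull (facet T v)) = 0 := by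
  refine measure_mono_null ?_ (volume_frontier_hull T)
  intro x hx
  rw [(isCompact_hull T).isClosed.frontier_eq]
  refine ⟨hull_facet_subset T v hx, fun hi => ?_⟩
  exact (hT.mem_interior_hull_iff.1 hi v hv).ne' ((hT.mem_hull_facet_iff hv).1 hx).2

theorem volume_hull_pos (hT : IsSimplex T) : 0 < volume (hull T) :=
  Measure.measure_pos_of_nonempty_interior _ hT.interior_hull_nonempty

theorem exists_bary_pos_of_facet (hT : IsSimplex T) (hd : 1 ≤ d) {v : E d} (hv : v ∈ T) :
    ∃ x, bary T v x = 0 ∧ ∀ u ∈ facet T v, 0 < bary T u x := by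
  classical
  have hne := hT.facet_nonempty hd v
  have hcard : (0 : ℝ) < (facet T v).card := by exact_mod_cast hne.card_pos
  have hw : ∑ _u ∈ facet T v, ((facet T v).card : ℝ)⁻¹ = 1 := by
    simp [hcard.ne']
  refine ⟨∑ u ∈ facet T v, ((facet T v).card : ℝ)⁻¹ • u, ?_, fun u hu => ?_⟩
  · rw [bary_sum_smul T v _ (fun _ => ((facet T v).card : ℝ)⁻¹) hw]
    refine Finset.sum_eq_zero fun u hu => ?_
    obtain ⟨h1, h2⟩ := mem_facet.1 hu
    rw [hT.bary_of_ne hv h2 h1, mul_zero]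
  · rw [bary_sum_smul T u _ (fun _ => ((facet T v).card : ℝ)⁻¹) hw,
      Finset.sum_eq_single_of_mem u hu, hT.bary_self (mem_facet.1 hu).2, mul_one]
    · exact inv_pos.2 hcard
    · intro s hs hsu
      rw [hT.bary_of_ne (mem_facet.1 hu).2 (mem_facet.1 hs).2 hsu, mul_zero]

end IsSimplex

namespace Triangulation

variable (M : Triangulation d)

theorem inter_subset_facet {T T' : M.Cell} (hne : T ≠ T') {v v' : E d} (hv : v ∈ T.1)
    (h : facet T.1 v = facet T'.1 v') : (T.1 : Set (E d)) ∩ T'.1 ⊆ facet T.1 v := by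
  classical
  rintro u ⟨hu, hu'⟩
  refine mem_facet.2 ⟨?_, hu⟩
  rintro rfl
  refine hne (Subtype.ext (Finset.eq_of_subset_of_card_le ?_ ?_))
  · intro s hs
    by_cases hsu : s = u
    · exact hsu ▸ hu'
    · exact (mem_facet.1 (h ▸ mem_facet.2 ⟨hsu, hs⟩ : s ∈ facet T'.1 v')).2
  · rw [M.card_cell _ T.2, M.card_cell _ T'.2]

/-- Two cells with a common facet lie on different sides of it. -/
theorem bary_neg_of_facet_eq (hd : 1 ≤ d) {T T' : M.Cell} (hne : T ≠ T') {v v' : E d}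
    (hv : v ∈ T.1) (hv' : v' ∈ T'.1) (h : facet T.1 v = facet T'.1 v') :
    bary T'.1 v' v < 0 := by
  by_contra hc
  push Not at hc
  have hT := M.isSimplex T
  have hT' := M.isSimplex T'
  obtain ⟨x, hx0, hx⟩ := hT.exists_bary_pos_of_facet hd hv
  -- If the factor were non-negative, a short step from a point inside the facet towards `v` would
  -- stay in both cells. Conformity would put the new point on the facet, although its coordinate
  -- for `v` is `t > 0`.
  have hev : ∀ᶠ t : ℝ in nhdsWithin 0 (Set.Ioi 0), ∀ u ∈ facet T.1 v,
      0 < bary T.1 u (x + t • (v - x)) ∧ 0 < bary T'.1 u (x + t • (v - x)) := by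
    refine Filter.Eventually.filter_mono nhdsWithin_le_nhds ?_
    rw [Filter.eventually_all_finset]
    intro u hu
    have hcont : Continuous fun t : ℝ => x + t • (v - x) := by fun_prop
    refine (((continuous_bary T.1 u).comp hcont).continuousAt.eventually_const_lt ?_).and
      (((continuous_bary T'.1 u).comp hcont).continuousAt.eventually_const_lt ?_)
    · simpa using hx u hu
    · simpa [hT.bary_eq_of_facet_eq hT' h hu hx0] using hx u hu
  obtain ⟨t, ht, ht0⟩ := (hev.and self_mem_nhdsWithin).exists
  have ht0 : 0 < t := ht0
  set y := x + t • (v - x) with hy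
  have hyv : bary T.1 v y = t := by
    have h1 := bary_sub T.1 v x y
    have h2 := bary_sub T.1 v x v
    rw [hx0, sub_zero] at h1 h2
    rw [h1, hy, add_sub_cancel_left, inner_smul_right, ← h2, hT.bary_self hv, mul_one]
  have hyT : y ∈ hull T.1 := by
    rw [hT.mem_hull_iff]
    intro u hu
    by_cases huv : u = v
    · rw [huv, hyv]; exact ht0.le
    · exact (ht u (mem_facet.2 ⟨huv, hu⟩)).1.le
  have hyT' : y ∈ hull T'.1 := by
    rw [hT'.mem_hull_iff]
    intro u hu
    by_cases huv : u = v'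
    · rw [huv, hT.bary_eq_mul_of_facet_eq hT' hv hv' h, hyv]; exact mul_nonneg hc ht0.le
    · exact (ht u (h ▸ mem_facet.2 ⟨huv, hu⟩)).2.le
  have hyF : y ∈ hull (facet T.1 v) := by
    have : y ∈ convexHull ℝ ((T.1 : Set (E d)) ∩ T'.1) := by
      rw [← M.conforming _ T.2 _ T'.2]; exact ⟨hyT, hyT'⟩
    exact convexHull_mono (M.inter_subset_facet hne hv h) this
  rw [((hT.mem_hull_facet_iff hv).1 hyF).2] at hyv
  exact ht0.ne hyv

theorem vertex_eq_of_facet_eq {T : Finset (E d)} {v v' : E d} (hv : v ∈ T)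
    (h : facet T v = facet T v') : v = v' := by
  by_contra hne
  exact (mem_facet.1 (h ▸ mem_facet.2 ⟨hne, hv⟩ : v ∈ facet T v)).1 rfl

/-- A facet belongs to at most two cells. -/
theorem cell_eq_of_facet_eq (hd : 1 ≤ d) {T T' T'' : M.Cell} (h' : T ≠ T') (h'' : T ≠ T'')
    {v v' v'' : E d} (hv : v ∈ T.1) (hv' : v' ∈ T'.1) (hv'' : v'' ∈ T''.1)
    (hf' : facet T.1 v = facet T'.1 v') (hf'' : facet T.1 v = facet T''.1 v'') : T' = T'' := by
  by_contra hne
  have h1 := M.bary_neg_of_facet_eq hd h' hv hv' hf'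
  have h2 := M.bary_neg_of_facet_eq hd h'' hv hv'' hf''
  have h3 := M.bary_neg_of_facet_eq hd hne hv' hv'' (hf'.symm.trans hf'')
  -- Three cells at one facet would lie pairwise on opposite sides: `bary T'' v'' v` is negative and
  -- at the same time a product of two negative numbers.
  rw [(M.isSimplex T').bary_eq_mul_of_facet_eq (M.isSimplex T'') hv' hv''
    (hf'.symm.trans hf'') v] at h2
  nlinarith

theorem outerNormal_eq_neg (hd : 1 ≤ d) {T T' : M.Cell} (hne : T ≠ T') {v v' : E d}
    (hv : v ∈ T.1) (hv' : v' ∈ T'.1) (h : facet T.1 v = facet T'.1 v') :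
    outerNormal T'.1 v' = -outerNormal T.1 v := by
  have hc := M.bary_neg_of_facet_eq hd hne hv hv' h
  have hg := (M.isSimplex T).baryGrad_ne_zero hd hv
  rw [(M.isSimplex T).outerNormal_eq hd hv, (M.isSimplex T').outerNormal_eq hd hv',
    (M.isSimplex T).baryGrad_eq_smul_of_facet_eq (M.isSimplex T') hv hv' h, norm_smul,
    Real.norm_of_nonpos hc.le, smul_smul, neg_neg, ← neg_smul]
  congr 1
  have := norm_ne_zero_iff.2 hg
  field_simp [hc.ne]

/-- Near a point inside the shared facet, the sign of the coordinate of `v` decides which of the two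
cells contains a given point. Hence test fields may live across the facet. -/
theorem mem_interior_union_hull (hd : 1 ≤ d) {T T' : M.Cell} (hne : T ≠ T') {v v' x : E d}
    (hv : v ∈ T.1) (hv' : v' ∈ T'.1) (h : facet T.1 v = facet T'.1 v') (hx : x ∈ hull T.1)
    (hpos : ∀ u ∈ facet T.1 v, 0 < bary T.1 u x) : x ∈ interior (hull T.1 ∪ hull T'.1) := by
  have hT := M.isSimplex T
  have hT' := M.isSimplex T'
  rcases (hT.mem_hull_iff.1 hx v hv).lt_or_eq with hvx | hvx
  · refine interior_mono Set.subset_union_left (hT.mem_interior_hull_iff.2 fun u hu => ?_)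
    by_cases huv : u = v
    · exact huv ▸ hvx
    · exact hpos u (mem_facet.2 ⟨huv, hu⟩)
  · rw [mem_interior_iff_mem_nhds]
    have hev : ∀ᶠ y in nhds x, ∀ u ∈ facet T.1 v, 0 < bary T.1 u y ∧ 0 < bary T'.1 u y := by
      rw [Filter.eventually_all_finset]
      intro u hu
      refine ((continuous_bary T.1 u).continuousAt.eventually_const_lt (hpos u hu)).and
        ((continuous_bary T'.1 u).continuousAt.eventually_const_lt ?_)
      rw [hT.bary_eq_of_facet_eq hT' h hu hvx.symm]
      exact hpos u hu
    filter_upwards [hev] with y hy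
    rcases le_total 0 (bary T.1 v y) with h0 | h0
    · refine Or.inl (hT.mem_hull_iff.2 fun u hu => ?_)
      by_cases huv : u = v
      · exact huv ▸ h0
      · exact (hy u (mem_facet.2 ⟨huv, hu⟩)).1.le
    · refine Or.inr (hT'.mem_hull_iff.2 fun u hu => ?_)
      by_cases huv : u = v'
      · rw [huv, hT.bary_eq_mul_of_facet_eq hT' hv hv' h]
        exact mul_nonneg_of_nonpos_of_nonpos (M.bary_neg_of_facet_eq hd hne hv hv' h).le h0
      · exact (hy u (h ▸ mem_facet.2 ⟨huv, hu⟩)).2.le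

/-- Some vertex of `T` is missing in `T'`, as both have equally many; conformity then confines the
intersection to the facet of `T` opposite to it, a null set. -/
theorem volume_hull_inter {T T' : M.Cell} (hne : T ≠ T') :
    volume (hull T.1 ∩ hull T'.1) = 0 := by
  obtain ⟨v, hv, hv'⟩ : ∃ v ∈ T.1, v ∉ T'.1 := by
    by_contra hc
    push Not at hc
    refine hne (Subtype.ext (Finset.eq_of_subset_of_card_le hc ?_))
    rw [M.card_cell _ T.2, M.card_cell _ T'.2]
  refine measure_mono_null ?_ ((M.isSimplex T).volume_hull_facet hv)
  rw [hull, hull, M.conforming _ T.2 _ T'.2]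
  refine convexHull_mono ?_
  rintro u ⟨hu, hu'⟩
  exact mem_facet.2 ⟨fun e => hv' (e ▸ hu'), hu⟩

theorem interior_hull_subset_domain (T : M.Cell) : interior (hull T.1) ⊆ M.domain :=
  interior_mono (Set.subset_biUnion_of_mem (u := fun T => hull T) T.2)

theorem interior_union_hull_subset_domain (T T' : M.Cell) :
    interior (hull T.1 ∪ hull T'.1) ⊆ M.domain :=
  interior_mono (Set.union_subset (Set.subset_biUnion_of_mem (u := fun T => hull T) T.2)
    (Set.subset_biUnion_of_mem (u := fun T => hull T) T'.2))

theorem ae_mem_interior_hull (T : Finset (E d)) :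
    ∀ᵐ x ∂volume.restrict (hull T), x ∈ interior (hull T) := by
  rw [ae_restrict_iff' (measurableSet_hull T)]
  have := measure_eq_zero_iff_ae_notMem.1 (IsSimplex.volume_frontier_hull T)
  filter_upwards [this] with x hx hxT
  by_contra hi
  exact hx (by rw [(isCompact_hull T).isClosed.frontier_eq]; exact ⟨hxT, hi⟩)

theorem hull_ae_le_domain (T : M.Cell) : hull T.1 ≤ᵐ[volume] M.domain := by
  have := (ae_restrict_iff' (measurableSet_hull T.1)).1 (ae_mem_interior_hull T.1)
  filter_upwards [this] with x hx hxT
  exact M.interior_hull_subset_domain T (hx hxT)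

/-- The two sets differ at most by frontiers of cells, which are null because cells are convex. -/
theorem domain_ae_eq : M.domain =ᵐ[volume] ⋃ T : M.Cell, hull T.1 := by
  have h : ∀ᵐ x ∂volume, ∀ T : M.Cell, x ∈ hull T.1 → x ∈ M.domain :=
    ae_all_iff.2 fun T => M.hull_ae_le_domain T
  filter_upwards [h] with x hx
  refine propext ⟨fun hxd => ?_, fun hxu => ?_⟩
  · have := interior_subset (s := ⋃ T ∈ M.cells, hull T) hxd
    simp only [Set.mem_iUnion] at this
    obtain ⟨T, hT, hxT⟩ := this
    exact Set.mem_iUnion.2 ⟨⟨T, hT⟩, hxT⟩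
  · obtain ⟨T, hT⟩ := Set.mem_iUnion.1 hxu
    exact hx T hT

variable {M} in
theorem integrableOn_hull {F : Type*} [NormedAddCommGroup F] {f : E d → F}
    (hf : IntegrableOn f M.domain) (T : M.Cell) : IntegrableOn f (hull T.1) :=
  hf.mono_set_ae (M.hull_ae_le_domain T)

theorem setIntegral_domain {f : E d → ℝ} (hf : IntegrableOn f M.domain) :
    ∫ x in M.domain, f x = M.integral fun _ x => f x := by
  have hm : ∀ T : M.Cell, NullMeasurableSet (hull T.1) volume := fun T =>
    (measurableSet_hull T.1).nullMeasurableSet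
  have hdisj : Pairwise (Function.onFun (AEDisjoint volume) fun T : M.Cell => hull T.1) :=
    fun T T' hne => M.volume_hull_inter hne
  have hint : IntegrableOn f (⋃ T : M.Cell, hull T.1) := hf.congr_set_ae M.domain_ae_eq.symm
  rw [setIntegral_congr_set M.domain_ae_eq, integral_iUnion_ae hm hdisj hint, tsum_fintype]
  rfl

theorem volume_domain_lt_top : volume M.domain < ⊤ := by
  have h : IsCompact (⋃ T : M.Cell, hull T.1) := isCompact_iUnion fun T => isCompact_hull T.1
  rw [measure_congr M.domain_ae_eq]
  exact h.measure_lt_top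

end Triangulation

end MCS

namespace MCS

open scoped ContDiff
open Filter Topology

variable {d : ℕ}

/-! ### Green's formula for weak gradients on a mesh -/

/-- Divergence of a vector field. -/
noncomputable def fieldDiv (w : E d → E d) (x : E d) : ℝ :=
  ∑ i, fderiv ℝ w x (EuclideanSpace.single i 1) i

/-- The integrand `B · w + Ψ div w` of Green's formula. -/
noncomputable def greenIntegrand (Ψ : E d → ℝ) (B w : E d → E d) (x : E d) : ℝ :=
  inner ℝ (B x) (w x) + Ψ x * fieldDiv w x

theorem inner_eq_sum (x y : E d) : inner ℝ x y = ∑ i, x i * y i := by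
  simp [PiLp.inner_apply, mul_comm]

theorem sum_smul_single (x : E d) : ∑ i, x i • EuclideanSpace.single i (1 : ℝ) = x := by
  ext j
  simp [Finset.sum_apply, Pi.single_apply]

theorem fieldDiv_add {w w' : E d → E d} {x : E d} (hw : DifferentiableAt ℝ w x)
    (hw' : DifferentiableAt ℝ w' x) :
    fieldDiv (fun y => w y + w' y) x = fieldDiv w x + fieldDiv w' x := by
  simp [fieldDiv, fderiv_fun_add hw hw', Finset.sum_add_distrib]

theorem fieldDiv_sub {w w' : E d → E d} {x : E d} (hw : DifferentiableAt ℝ w x)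
    (hw' : DifferentiableAt ℝ w' x) :
    fieldDiv (fun y => w y - w' y) x = fieldDiv w x - fieldDiv w' x := by
  simp [fieldDiv, fderiv_fun_sub hw hw', Finset.sum_sub_distrib]

theorem fieldDiv_smul {χ : E d → ℝ} {w : E d → E d} {x : E d} (hχ : DifferentiableAt ℝ χ x)
    (hw : DifferentiableAt ℝ w x) :
    fieldDiv (fun y => χ y • w y) x = χ x * fieldDiv w x + fderiv ℝ χ x (w x) := by
  rw [fieldDiv, fieldDiv, fderiv_fun_smul hχ hw, Finset.mul_sum]
  conv_rhs => rw [← sum_smul_single (w x), map_sum, ← Finset.sum_add_distrib]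
  refine Finset.sum_congr rfl fun i _ => ?_
  simp [mul_comm]

theorem continuous_fieldDiv {w : E d → E d} (hw : ContDiff ℝ ∞ w) : Continuous (fieldDiv w) := by
  have h : Continuous (fderiv ℝ w) := hw.continuous_fderiv (by simp)
  unfold fieldDiv
  fun_prop

theorem greenIntegrand_eq_zero {Ψ : E d → ℝ} {B w : E d → E d} {x : E d} (h : x ∉ tsupport w) :
    greenIntegrand Ψ B w x = 0 := by
  simp [greenIntegrand, fieldDiv, fderiv_of_notMem_tsupport ℝ h, image_eq_zero_of_notMem_tsupport h]

theorem greenIntegrand_congr {Ψ : E d → ℝ} {B w w' : E d → E d} {x : E d} (h : w =ᶠ[𝓝 x] w') :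
    greenIntegrand Ψ B w x = greenIntegrand Ψ B w' x := by
  rw [greenIntegrand, greenIntegrand, h.self_of_nhds, fieldDiv, fieldDiv, h.fderiv_eq]

theorem greenIntegrand_add {Ψ : E d → ℝ} {B w w' : E d → E d} (hw : ContDiff ℝ ∞ w)
    (hw' : ContDiff ℝ ∞ w') (x : E d) :
    greenIntegrand Ψ B (fun y => w y + w' y) x
      = greenIntegrand Ψ B w x + greenIntegrand Ψ B w' x := by
  rw [greenIntegrand, fieldDiv_add (hw.differentiable (by simp) x) (hw'.differentiable (by simp) x),
    inner_add_right, greenIntegrand, greenIntegrand]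
  ring

theorem greenIntegrand_sub {Ψ : E d → ℝ} {B w w' : E d → E d} (hw : ContDiff ℝ ∞ w)
    (hw' : ContDiff ℝ ∞ w') (x : E d) :
    greenIntegrand Ψ B (fun y => w y - w' y) x
      = greenIntegrand Ψ B w x - greenIntegrand Ψ B w' x := by
  rw [greenIntegrand, fieldDiv_sub (hw.differentiable (by simp) x) (hw'.differentiable (by simp) x),
    inner_sub_right, greenIntegrand, greenIntegrand]
  ring

theorem integrableOn_inner {K : Set (E d)} (hK : IsCompact K) {B w : E d → E d}
    (hB : IntegrableOn B K) (hw : ContinuousOn w K) :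
    IntegrableOn (fun x => inner ℝ (B x) (w x)) K := by
  simp only [inner_eq_sum]
  refine integrable_finsetSum _ fun i _ => ?_
  refine IntegrableOn.mul_continuousOn (g := fun x => B x i) (g' := fun x => w x i) ?_ ?_ hK
  · exact (EuclideanSpace.proj (𝕜 := ℝ) i).integrable_comp hB
  · exact (EuclideanSpace.proj (𝕜 := ℝ) i).continuous.comp_continuousOn hw

theorem integrableOn_greenIntegrand {K : Set (E d)} (hK : IsCompact K) {Ψ : E d → ℝ}
    {B w : E d → E d} (hΨ : IntegrableOn Ψ K) (hB : IntegrableOn B K) (hw : ContDiff ℝ ∞ w) :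
    IntegrableOn (greenIntegrand Ψ B w) K :=
  (integrableOn_inner hK hB hw.continuous.continuousOn).add
    (hΨ.mul_continuousOn (continuous_fieldDiv hw).continuousOn hK)

theorem HasWeakGradient.setIntegral_greenIntegrand {Ω : Set (E d)} {Ψ : E d → ℝ} {B w : E d → E d}
    (h : HasWeakGradient Ω Ψ B) (hw : ContDiff ℝ ∞ w) (hc : HasCompactSupport w)
    (hs : tsupport w ⊆ Ω) : ∫ x in Ω, greenIntegrand Ψ B w x = 0 := by
  obtain ⟨hΨ, hB, hgrad⟩ := h
  have hwi (i : Fin d) : ContDiff ℝ ∞ (fun x => w x i) :=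
    (EuclideanSpace.proj (𝕜 := ℝ) i).contDiff.comp hw
  have hsub (i : Fin d) : tsupport (fun x => w x i) ⊆ tsupport w := by
    refine closure_mono fun x hx => ?_
    rw [Function.mem_support] at hx ⊢
    intro h0
    simp [h0] at hx
  have hci (i : Fin d) : HasCompactSupport (fun x => w x i) :=
    hc.mono' (subset_closure.trans (hsub i))
  have hfd (i : Fin d) (x : E d) : fderiv ℝ w x (EuclideanSpace.single i 1) i
      = fderiv ℝ (fun x => w x i) x (EuclideanSpace.single i 1) := by
    have h1 := (EuclideanSpace.proj (𝕜 := ℝ) i).hasFDerivAt.comp x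
      (hw.differentiable (by simp) x).hasFDerivAt
    have h2 : fderiv ℝ (fun x => w x i) x = _ := h1.fderiv
    rw [h2]
    rfl
  have hdc (i : Fin d) :
      Continuous fun x => fderiv ℝ (fun x => w x i) x (EuclideanSpace.single i 1) :=
    ((hwi i).continuous_fderiv (by simp)).clm_apply continuous_const
  have hBi (i : Fin d) : Integrable (fun x => B x i * w x i) (volume.restrict Ω) := by
    have h1 : MemLp (fun x => B x i) 2 (volume.restrict Ω) :=
      (EuclideanSpace.proj (𝕜 := ℝ) i).comp_memLp' hB
    exact h1.integrable_mul (q := 2) ((hwi i).continuous.memLp_of_hasCompactSupport (hci i))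
  have hΨi (i : Fin d) : Integrable
      (fun x => Ψ x * fderiv ℝ (fun x => w x i) x (EuclideanSpace.single i 1))
      (volume.restrict Ω) :=
    hΨ.integrable_mul (q := 2) ((hdc i).memLp_of_hasCompactSupport
      ((hci i).fderiv_apply (𝕜 := ℝ) (EuclideanSpace.single i 1)))
  have heq (x : E d) : greenIntegrand Ψ B w x = ∑ i, (B x i * w x i
      + Ψ x * fderiv ℝ (fun x => w x i) x (EuclideanSpace.single i 1)) := by
    rw [greenIntegrand, inner_eq_sum, fieldDiv, Finset.mul_sum, ← Finset.sum_add_distrib]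
    simp only [hfd]
  simp only [heq]
  rw [integral_finsetSum _ fun i _ => (hBi i).fun_add (hΨi i)]
  refine Finset.sum_eq_zero fun i _ => ?_
  rw [integral_add (hBi i) (hΨi i), hgrad _ (hwi i) (hci i) ((hsub i).trans hs) i, add_neg_cancel]

/-! #### Cut-off functions -/

/-- A smooth step from `0` (up to `1`) to `1` (from `2` on). -/
noncomputable def smoothStep (t : ℝ) : ℝ := Real.smoothTransition (t - 1)

theorem contDiff_smoothStep : ContDiff ℝ ∞ smoothStep :=
  Real.smoothTransition.contDiff.comp (contDiff_id.sub contDiff_const)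

theorem smoothStep_eq_zero {t : ℝ} (h : t ≤ 1) : smoothStep t = 0 :=
  Real.smoothTransition.zero_of_nonpos (by linarith)

theorem smoothStep_eq_one {t : ℝ} (h : 2 ≤ t) : smoothStep t = 1 :=
  Real.smoothTransition.one_of_one_le (by linarith)

theorem abs_smoothStep_le_one (t : ℝ) : |smoothStep t| ≤ 1 := by
  rw [smoothStep, abs_of_nonneg (Real.smoothTransition.nonneg _)]
  exact Real.smoothTransition.le_one _

/-- The derivative is supported in `[1, 2]`. The weight `t` is there to absorb the factor `n` that
appears when `smoothStep (n * λ)` is differentiated. -/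
theorem exists_abs_mul_deriv_smoothStep_le : ∃ K : ℝ, 0 ≤ K ∧ ∀ t, |t * deriv smoothStep t| ≤ K := by
  have hcont : Continuous fun t => t * deriv smoothStep t :=
    continuous_id.mul (contDiff_smoothStep.continuous_deriv (by simp))
  obtain ⟨K, hK⟩ := (isCompact_Icc (a := (1 : ℝ)) (b := 2)).exists_bound_of_continuousOn
    hcont.continuousOn
  refine ⟨K, (norm_nonneg _).trans (hK 1 (by norm_num)), fun t => ?_⟩
  by_cases ht : t ∈ Set.Icc (1 : ℝ) 2
  · exact hK t ht
  · have hK0 : 0 ≤ K := (norm_nonneg _).trans (hK 1 (by norm_num))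
    have h0 : deriv smoothStep t = 0 := by
      rw [Set.mem_Icc, not_and_or, not_le, not_le] at ht
      rcases ht with ht | ht
      · have : smoothStep =ᶠ[𝓝 t] fun _ => 0 := by
          filter_upwards [eventually_lt_nhds ht] with s hs using smoothStep_eq_zero hs.le
        rw [this.deriv_eq, deriv_const]
      · have : smoothStep =ᶠ[𝓝 t] fun _ => 1 := by
          filter_upwards [eventually_gt_nhds ht] with s hs using smoothStep_eq_one hs.le
        rw [this.deriv_eq, deriv_const]
    rw [h0, mul_zero, abs_zero]
    exact hK0

/-- Cut-off away from the facets of `T` opposite to the vertices in `A`. -/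
noncomputable def cutoff (T A : Finset (E d)) (n : ℕ) (x : E d) : ℝ :=
  ∏ v ∈ A, smoothStep (n * bary T v x)

theorem contDiff_cutoff (T A : Finset (E d)) (n : ℕ) : ContDiff ℝ ∞ (cutoff T A n) :=
  contDiff_prod fun v _ => contDiff_smoothStep.comp (contDiff_const.mul (contDiff_bary T v))

theorem cutoff_eq_zero {T A : Finset (E d)} {n : ℕ} {v x : E d} (hv : v ∈ A)
    (h : n * bary T v x ≤ 1) : cutoff T A n x = 0 :=
  Finset.prod_eq_zero hv (smoothStep_eq_zero h)

theorem abs_cutoff_le_one (T A : Finset (E d)) (n : ℕ) (x : E d) : |cutoff T A n x| ≤ 1 := by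
  rw [cutoff, Finset.abs_prod]
  exact Finset.prod_le_one (fun _ _ => abs_nonneg _) fun _ _ => abs_smoothStep_le_one _

/-- Equality on a neighbourhood, rather than at the point only, makes the derivatives agree too, as
the divergence requires. -/
theorem eventually_cutoff_eq_one {T A : Finset (E d)} {x : E d} (h : ∀ v ∈ A, 0 < bary T v x) :
    ∀ᶠ n : ℕ in atTop, ∀ᶠ y in 𝓝 x, cutoff T A n y = 1 := by
  have h1 : ∀ᶠ n : ℕ in atTop, ∀ v ∈ A, 2 < n * bary T v x := by
    rw [eventually_all_finset]
    intro v hv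
    exact (tendsto_natCast_atTop_atTop.atTop_mul_const (h v hv)).eventually_gt_atTop 2
  filter_upwards [h1] with n hn
  have h2 : ∀ᶠ y in 𝓝 x, ∀ v ∈ A, 2 < n * bary T v y := by
    rw [eventually_all_finset]
    intro v hv
    exact (continuous_const.mul (continuous_bary T v)).continuousAt.eventually_const_lt (hn v hv)
  filter_upwards [h2] with y hy
  exact Finset.prod_eq_one fun v hv => smoothStep_eq_one (hy v hv).le

/-- The factor for `v` contributes `n S'(n λ_v) ∇λ_v · w` with `S` the smooth step. Since `|∇λ_v ·
w| ≤ C λ_v`, the factor `n` is matched by `λ_v`, and `t S'(t)` at `t = n λ_v` is bounded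
independently of `n`. -/
theorem abs_fderiv_cutoff_le {T A : Finset (E d)} {K : ℝ}
    (hK : ∀ t, |t * deriv smoothStep t| ≤ K) {C : E d → ℝ} {w x : E d}
    (hC : ∀ v ∈ A, |inner ℝ (baryGrad T v) w| ≤ C v * bary T v x)
    (hC0 : ∀ v ∈ A, 0 ≤ C v) (hpos : ∀ v ∈ A, 0 ≤ bary T v x) (n : ℕ) :
    |fderiv ℝ (cutoff T A n) x w| ≤ ∑ v ∈ A, C v * K := by
  classical
  have hder (v : E d) : HasFDerivAt (fun y => smoothStep (n * bary T v y))
      (deriv smoothStep (n * bary T v x) • ((n : ℝ) • innerSL ℝ (baryGrad T v))) x := by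
    have h1 : HasDerivAt smoothStep (deriv smoothStep (n * bary T v x)) (n * bary T v x) :=
      (contDiff_smoothStep.differentiable (by simp) _).hasDerivAt
    exact HasDerivAt.comp_hasFDerivAt (h₂ := smoothStep) x h1 ((hasFDerivAt_bary T v x).const_mul (n : ℝ))
  have hprod := HasFDerivAt.finsetProd (u := A) fun v _ => hder v
  have hfd : fderiv ℝ (cutoff T A n) x = _ := hprod.fderiv
  rw [hfd]
  simp only [sum_apply, smul_apply, smul_eq_mul,
    innerSL_apply_apply]
  refine (Finset.abs_sum_le_sum_abs _ _).trans (Finset.sum_le_sum fun v hv => ?_)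
  rw [abs_mul]
  have h1 : |∏ u ∈ A.erase v, smoothStep (n * bary T u x)| ≤ 1 := abs_cutoff_le_one T _ n x
  have h2 : |deriv smoothStep (n * bary T v x) * (n * inner ℝ (baryGrad T v) w)| ≤ C v * K := by
    rw [abs_mul, abs_mul, Nat.abs_cast]
    calc |deriv smoothStep (n * bary T v x)| * (n * |inner ℝ (baryGrad T v) w|)
        ≤ |deriv smoothStep (n * bary T v x)| * (n * (C v * bary T v x)) := by
          gcongr; exact hC v hv
      _ = C v * |n * bary T v x * deriv smoothStep (n * bary T v x)| := by
          rw [abs_mul, abs_mul, Nat.abs_cast, abs_of_nonneg (hpos v hv)]; ring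
      _ ≤ C v * K := mul_le_mul_of_nonneg_left (hK _) (hC0 v hv)
  calc _ ≤ 1 * (C v * K) := mul_le_mul h1 h2 (abs_nonneg _) zero_le_one
    _ = C v * K := one_mul _

/-- Cutting off a field near facets on which its normal component vanishes does not change the
integral in Green's formula in the limit. -/
theorem IsSimplex.tendsto_setIntegral_cutoff {T A : Finset (E d)} (hT : IsSimplex T) (hd : 1 ≤ d)
    (hA : A ⊆ T) {Ψ : E d → ℝ} {B w : E d → E d} (hΨ : IntegrableOn Ψ (hull T))
    (hB : IntegrableOn B (hull T)) (hw : ContDiff ℝ ∞ w)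
    (hn : ∀ v ∈ A, ∀ x ∈ hull (facet T v), inner ℝ (baryGrad T v) (w x) = 0) :
    Tendsto (fun n : ℕ => ∫ x in hull T, greenIntegrand Ψ B (fun y => cutoff T A n y • w y) x) atTop
      (𝓝 (∫ x in hull T, greenIntegrand Ψ B w x)) := by
  classical
  obtain ⟨K, hK0, hK⟩ := exists_abs_mul_deriv_smoothStep_le
  have hex : ∀ v, ∃ C : ℝ, v ∈ A → 0 ≤ C ∧
      ∀ x ∈ hull T, |inner ℝ (baryGrad T v) (w x)| ≤ C * bary T v x := by
    intro v
    by_cases hv : v ∈ A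
    · obtain ⟨C, hC⟩ := hT.exists_abs_le_mul_bary hd (hA hv)
        (f := fun x => inner ℝ (baryGrad T v) (w x))
        ((contDiff_const.inner ℝ hw).of_le (by simp)) (hn v hv)
      refine ⟨|C|, fun _ => ⟨abs_nonneg _, fun x hx => (hC x hx).trans ?_⟩⟩
      exact mul_le_mul_of_nonneg_right (le_abs_self C) (hT.mem_hull_iff.1 hx v (hA hv))
    · exact ⟨0, fun h => absurd h hv⟩
  choose C hC using hex
  obtain ⟨Cw, hCw⟩ := (isCompact_hull T).exists_bound_of_continuousOn hw.continuous.continuousOn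
  obtain ⟨Cd, hCd⟩ := (isCompact_hull T).exists_bound_of_continuousOn
    (continuous_fieldDiv hw).continuousOn
  have hsm (n : ℕ) : ContDiff ℝ ∞ fun y => cutoff T A n y • w y := (contDiff_cutoff T A n).smul hw
  -- `Cw` and `Cd` bound the field and its divergence on the cell, and the sum bounds `∇χₙ · w`.
  -- Pointwise convergence holds in the interior, where the cut-off is eventually 1.
  refine tendsto_integral_of_dominated_convergence
    (fun x => ‖B x‖ * Cw + ‖Ψ x‖ * (Cd + ∑ v ∈ A, C v * K)) ?_ ?_ ?_ ?_
  · exact fun n => (integrableOn_greenIntegrand (isCompact_hull T) hΨ hB (hsm n)).1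
  · exact (hB.norm.mul_const _).add (hΨ.norm.mul_const _)
  · intro n
    refine (ae_restrict_iff' (measurableSet_hull T)).2 (ae_of_all _ fun x hx => ?_)
    rw [greenIntegrand, fieldDiv_smul ((contDiff_cutoff T A n).differentiable (by simp) x)
      (hw.differentiable (by simp) x)]
    refine (norm_add_le _ _).trans (add_le_add ?_ ?_)
    · refine (norm_inner_le_norm _ _).trans (mul_le_mul_of_nonneg_left ?_ (norm_nonneg _))
      rw [norm_smul]
      calc _ ≤ 1 * ‖w x‖ :=
            mul_le_mul_of_nonneg_right (abs_cutoff_le_one T A n x) (norm_nonneg _)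
        _ ≤ Cw := by rw [one_mul]; exact hCw x hx
    · rw [norm_mul]
      refine mul_le_mul_of_nonneg_left ((norm_add_le _ _).trans (add_le_add ?_ ?_)) (norm_nonneg _)
      · rw [norm_mul]
        calc _ ≤ 1 * ‖fieldDiv w x‖ :=
              mul_le_mul_of_nonneg_right (abs_cutoff_le_one T A n x) (norm_nonneg _)
          _ ≤ Cd := by rw [one_mul]; exact hCd x hx
      · exact abs_fderiv_cutoff_le hK (fun v hv => (hC v hv).2 x hx) (fun v hv => (hC v hv).1)
          (fun v hv => hT.mem_hull_iff.1 hx v (hA hv)) n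
  · filter_upwards [Triangulation.ae_mem_interior_hull T] with x hx
    refine tendsto_const_nhds.congr' ?_
    filter_upwards [eventually_cutoff_eq_one
      (fun v hv => hT.mem_interior_hull_iff.1 hx v (hA hv))] with n hn
    refine greenIntegrand_congr ?_
    filter_upwards [hn] with y hy
    rw [hy, one_smul]

end MCS

/-! ### Green's formula on one cell, on two adjacent cells and on the whole mesh. -/

namespace MCS

open scoped ContDiff Manifold
open Filter Topology

variable {d : ℕ}

theorem exists_contDiff_one_of_compact_subset {K O : Set (E d)} (hK : IsCompact K) (hO : IsOpen O)
    (hKO : K ⊆ O) : ∃ ρ : E d → ℝ, ContDiff ℝ ∞ ρ ∧ HasCompactSupport ρ ∧ tsupport ρ ⊆ O ∧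
      ∀ x ∈ K, ρ x = 1 := by
  obtain ⟨L, hL, hKL, hLO⟩ := exists_compact_between hK hO hKO
  obtain ⟨f, h0, h1, -⟩ := exists_contMDiffMap_zero_one_of_isClosed 𝓘(ℝ, E d) (n := (⊤ : ℕ∞))
    (isOpen_interior (s := L)).isClosed_compl hK.isClosed
    (Set.disjoint_left.2 fun x hx hxK => hx (hKL hxK))
  have hsub : tsupport f ⊆ L := by
    refine closure_minimal (fun x hx => ?_) hL.isClosed
    by_contra hxL
    exact hx (h0 fun hi => hxL (interior_subset hi))
  exact ⟨f, f.contMDiff.contDiff, hL.of_isClosed_subset (isClosed_tsupport _) hsub,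
    hsub.trans hLO, h1⟩

namespace Triangulation

variable {M : Triangulation d} {Ψ : E d → ℝ} {B : E d → E d}

theorem integrableOn_of_memLp {F : Type*} [NormedAddCommGroup F] {f : E d → F}
    (hf : MemLp f 2 (volume.restrict M.domain)) : IntegrableOn f M.domain := by
  have : IsFiniteMeasure (volume.restrict M.domain) := ⟨by
    rw [Measure.restrict_apply_univ]; exact M.volume_domain_lt_top⟩
  exact hf.integrable (by norm_num)

/-- Green's formula on one cell for a field without normal trace. -/
theorem setIntegral_green_cell (hd : 1 ≤ d) (h : HasWeakGradient M.domain Ψ B) (T : M.Cell)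
    {w : E d → E d} (hw : ContDiff ℝ ∞ w)
    (hn : ∀ v ∈ T.1, ∀ x ∈ hull (facet T.1 v), inner ℝ (baryGrad T.1 v) (w x) = 0) :
    ∫ x in hull T.1, greenIntegrand Ψ B w x = 0 := by
  have hT := M.isSimplex T
  have hlim := hT.tendsto_setIntegral_cutoff hd subset_rfl
    (integrableOn_hull (integrableOn_of_memLp h.1) T)
    (integrableOn_hull (integrableOn_of_memLp h.2.1) T) hw hn
  refine tendsto_nhds_unique hlim (tendsto_const_nhds.congr fun n => ?_)
  set w' : E d → E d := fun y => cutoff T.1 T.1 n y • w y with hw'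
  -- The cut-off field lives where `1 ≤ n * λ` for all coordinates, a closed set inside the open
  -- cell, so it is an admissible test field.
  have hsub : tsupport w' ⊆ interior (hull T.1) := by
    have hcl : IsClosed {x : E d | ∀ v ∈ T.1, 1 ≤ (n : ℝ) * bary T.1 v x} := by
      simp only [Set.ofPred_forall]
      exact isClosed_biInter fun v _ =>
        isClosed_le continuous_const (continuous_const.mul (continuous_bary T.1 v))
    refine (closure_minimal (fun x hx v hv => ?_) hcl).trans fun x hx => ?_
    · by_contra hlt
      exact hx (by rw [hw']; simp [cutoff_eq_zero hv (not_le.1 hlt).le])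
    · refine hT.mem_interior_hull_iff.2 fun v hv => ?_
      exact pos_of_mul_pos_right (lt_of_lt_of_le one_pos (hx v hv)) (Nat.cast_nonneg n)
  have hc : HasCompactSupport w' := (isCompact_hull T.1).of_isClosed_subset (isClosed_tsupport _)
    (hsub.trans interior_subset)
  have h0 := h.setIntegral_greenIntegrand (w := w') ((contDiff_cutoff T.1 T.1 n).smul hw) hc
    (hsub.trans (M.interior_hull_subset_domain T))
  rw [setIntegral_eq_integral_of_forall_compl_eq_zero fun x hx => greenIntegrand_eq_zero
    fun hx' => hx (M.interior_hull_subset_domain T (hsub hx'))] at h0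
  rw [setIntegral_eq_integral_of_forall_compl_eq_zero fun x hx => greenIntegrand_eq_zero
    fun hx' => hx (interior_subset (hsub hx'))]
  exact h0.symm

/-- Green's formula on two adjacent cells for a field that vanishes near the boundary of the common
facet. -/
theorem setIntegral_green_pair_of_vanishing (hd : 1 ≤ d) (h : HasWeakGradient M.domain Ψ B)
    {T T' : M.Cell} (hne : T ≠ T') {v v' : E d} (hv : v ∈ T.1) (hv' : v' ∈ T'.1)
    (hF : facet T.1 v = facet T'.1 v') {w w' : E d → E d} (hw : ContDiff ℝ ∞ w)
    (hw' : ContDiff ℝ ∞ w') {n : ℕ}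
    (h0 : ∀ u ∈ facet T.1 v, ∀ x, (n : ℝ) * bary T.1 u x ≤ 1 → w x = 0)
    (h0' : ∀ u ∈ facet T.1 v, ∀ x, (n : ℝ) * bary T'.1 u x ≤ 1 → w' x = 0)
    (hn : ∀ x ∈ hull (facet T.1 v), inner ℝ (baryGrad T.1 v) (w x - w' x) = 0) :
    (∫ x in hull T.1, greenIntegrand Ψ B w x) + ∫ x in hull T'.1, greenIntegrand Ψ B w' x = 0 := by
  have hT := M.isSimplex T
  have hT' := M.isSimplex T'
  -- Outside `K` the field `w` vanishes on `T`. `K` may touch the common facet but avoids all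
  -- others, so it is a compact subset of the interior of the two cells.
  set K : Set (E d) := hull T.1 ∩ {x | ∀ u ∈ facet T.1 v, 1 ≤ (n : ℝ) * bary T.1 u x} with hKdef
  have hK : IsCompact K := by
    refine (isCompact_hull T.1).inter_right ?_
    simp only [Set.ofPred_forall]
    exact isClosed_biInter fun v _ =>
      isClosed_le continuous_const (continuous_const.mul (continuous_bary T.1 v))
  have hKO : K ⊆ interior (hull T.1 ∪ hull T'.1) := fun x hx =>
    M.mem_interior_union_hull hd hne hv hv' hF hx.1 fun u hu =>
      pos_of_mul_pos_right (lt_of_lt_of_le one_pos (hx.2 u hu)) (Nat.cast_nonneg n)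
  have hwK : ∀ x ∈ hull T.1, x ∉ K → w x = 0 := by
    intro x hx hxK
    have : ∃ u ∈ facet T.1 v, (n : ℝ) * bary T.1 u x < 1 := by
      by_contra hc
      push Not at hc
      exact hxK ⟨hx, hc⟩
    obtain ⟨u, hu, hlt⟩ := this
    exact h0 u hu x hlt.le
  -- The product `z = ρ w` continues `w` smoothly from `T` into `T'` with compact support in Ω, so
  -- Green's formula holds for it. What remains is `w' - z` on `T'`, which has no normal trace on
  -- any facet.
  obtain ⟨ρ, hρ, hρc, hρs, hρ1⟩ := exists_contDiff_one_of_compact_subset hK isOpen_interior hKO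
  set z : E d → E d := fun x => ρ x • w x with hz
  have hzs : ContDiff ℝ ∞ z := hρ.smul hw
  have hzsub : tsupport z ⊆ tsupport ρ := closure_mono fun x hx => by
    rw [Function.mem_support] at hx ⊢
    intro h0
    exact hx (by simp [hz, h0])
  have hzw : ∀ x ∈ hull T.1, z x = w x := by
    intro x hx
    by_cases hxK : x ∈ K
    · simp [hz, hρ1 x hxK]
    · simp [hz, hwK x hx hxK]
  have hΨ (S : M.Cell) := integrableOn_hull (integrableOn_of_memLp h.1) S
  have hB (S : M.Cell) := integrableOn_hull (integrableOn_of_memLp h.2.1) S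
  have hz0 : (∫ x in hull T.1, greenIntegrand Ψ B z x)
      + ∫ x in hull T'.1, greenIntegrand Ψ B z x = 0 := by
    have h1 := h.setIntegral_greenIntegrand hzs (hρc.mono' (subset_closure.trans hzsub))
      (hzsub.trans (hρs.trans (M.interior_union_hull_subset_domain T T')))
    rw [setIntegral_eq_integral_of_forall_compl_eq_zero fun x hx => greenIntegrand_eq_zero
      fun hx' => hx (M.interior_union_hull_subset_domain T T' (hρs (hzsub hx')))] at h1
    rw [← setIntegral_union₀ (M.volume_hull_inter hne) (measurableSet_hull T'.1).nullMeasurableSet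
      (integrableOn_greenIntegrand (isCompact_hull _) (hΨ T) (hB T) hzs)
      (integrableOn_greenIntegrand (isCompact_hull _) (hΨ T') (hB T') hzs),
      setIntegral_eq_integral_of_forall_compl_eq_zero fun x hx => greenIntegrand_eq_zero
      fun hx' => hx (interior_subset (hρs (hzsub hx')))]
    exact h1
  have hTz : ∫ x in hull T.1, greenIntegrand Ψ B z x = ∫ x in hull T.1, greenIntegrand Ψ B w x := by
    refine integral_congr_ae ?_
    filter_upwards [ae_mem_interior_hull T.1] with x hx
    refine greenIntegrand_congr ?_
    filter_upwards [isOpen_interior.mem_nhds hx] with y hy using hzw y (interior_subset hy)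
  have hdiff : ∫ x in hull T'.1, greenIntegrand Ψ B (fun y => w' y - z y) x = 0 := by
    refine setIntegral_green_cell hd h T' (hw'.sub hzs) fun u hu x hx => ?_
    obtain ⟨hxT', hux⟩ := (hT'.mem_hull_facet_iff hu).1 hx
    by_cases huv : u = v'
    · subst huv
      rw [← hF] at hx
      rw [hT.baryGrad_eq_smul_of_facet_eq hT' hv hu hF, inner_smul_left,
        hzw x (hull_facet_subset _ _ hx), ← neg_sub, inner_neg_right, hn x hx]
      simp
    · have huF : u ∈ facet T.1 v := hF ▸ mem_facet.2 ⟨huv, hu⟩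
      have h1 : w' x = 0 := h0' u huF x (by rw [hux, mul_zero]; exact zero_le_one)
      -- Either the point is in `T`, hence on the common facet and in the region where `w` is cut
      -- off; or it is outside `T`, and if it were in the support of `z` it would be interior to
      -- `T'`.
      have h2 : z x = 0 := by
        by_cases hxT : x ∈ hull T.1
        · have hvx : bary T.1 v x = 0 := by
            have : x ∈ convexHull ℝ ((T.1 : Set (E d)) ∩ T'.1) := by
              rw [← M.conforming _ T.2 _ T'.2]; exact ⟨hxT, hxT'⟩
            exact ((hT.mem_hull_facet_iff hv).1
              (convexHull_mono (M.inter_subset_facet hne hv hF) this)).2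
          rw [hzw x hxT]
          refine h0 u huF x ?_
          rw [← hT.bary_eq_of_facet_eq hT' hF huF hvx, hux, mul_zero]
          exact zero_le_one
        · refine image_eq_zero_of_notMem_tsupport fun hxz => ?_
          have hxi : x ∈ interior (hull T'.1) := by
            rw [mem_interior_iff_mem_nhds]
            filter_upwards [isOpen_interior.mem_nhds (hρs (hzsub hxz)),
              (isCompact_hull T.1).isClosed.isOpen_compl.mem_nhds hxT] with y hy hyT
            exact (interior_subset hy).resolve_left hyT
          exact (hT'.mem_interior_hull_iff.1 hxi u hu).ne' hux
      simp [h1, h2]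
  simp only [greenIntegrand_sub hw' hzs] at hdiff
  rw [integral_sub (integrableOn_greenIntegrand (isCompact_hull _) (hΨ T') (hB T') hw')
    (integrableOn_greenIntegrand (isCompact_hull _) (hΨ T') (hB T') hzs)] at hdiff
  linarith

/-- Green's formula on two adjacent cells for a field with continuous normal component and
without normal trace on the other facets. -/
theorem setIntegral_green_pair (hd : 1 ≤ d) (h : HasWeakGradient M.domain Ψ B)
    {T T' : M.Cell} (hne : T ≠ T') {v v' : E d} (hv : v ∈ T.1) (hv' : v' ∈ T'.1)
    (hF : facet T.1 v = facet T'.1 v') {w w' : E d → E d} (hw : ContDiff ℝ ∞ w)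
    (hw' : ContDiff ℝ ∞ w')
    (h0 : ∀ u ∈ facet T.1 v, ∀ x ∈ hull (facet T.1 u), inner ℝ (baryGrad T.1 u) (w x) = 0)
    (h0' : ∀ u ∈ facet T.1 v, ∀ x ∈ hull (facet T'.1 u), inner ℝ (baryGrad T'.1 u) (w' x) = 0)
    (hn : ∀ x ∈ hull (facet T.1 v), inner ℝ (baryGrad T.1 v) (w x - w' x) = 0) :
    (∫ x in hull T.1, greenIntegrand Ψ B w x) + ∫ x in hull T'.1, greenIntegrand Ψ B w' x = 0 := by
  have hT := M.isSimplex T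
  have hT' := M.isSimplex T'
  have hΨ (S : M.Cell) := integrableOn_hull (integrableOn_of_memLp h.1) S
  have hB (S : M.Cell) := integrableOn_hull (integrableOn_of_memLp h.2.1) S
  have hsub : facet T.1 v ⊆ T.1 := fun u hu => (mem_facet.1 hu).2
  have hsub' : facet T.1 v ⊆ T'.1 := fun u hu => (mem_facet.1 (hF ▸ hu : u ∈ facet T'.1 v')).2
  have hlim := (hT.tendsto_setIntegral_cutoff hd hsub (hΨ T) (hB T) hw h0).add
    (hT'.tendsto_setIntegral_cutoff hd hsub' (hΨ T') (hB T') hw' h0')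
  refine tendsto_nhds_unique hlim (tendsto_const_nhds.congr fun n => ?_)
  symm
  refine setIntegral_green_pair_of_vanishing hd h hne hv hv' hF
    ((contDiff_cutoff _ _ n).smul hw) ((contDiff_cutoff _ _ n).smul hw') (n := n)
    (fun u hu x hx => ?_) (fun u hu x hx => ?_) (fun x hx => ?_)
  · rw [cutoff_eq_zero hu hx, zero_smul]
  · rw [cutoff_eq_zero hu hx, zero_smul]
  -- The two cut-offs agree on the common facet, so the multiplication preserves normal continuity.
  · have : cutoff T'.1 (facet T.1 v) n x = cutoff T.1 (facet T.1 v) n x :=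
      Finset.prod_congr rfl fun u hu => by
        rw [hT.bary_eq_of_facet_eq hT' hF hu ((hT.mem_hull_facet_iff hv).1 hx).2]
    rw [this, ← smul_sub, inner_smul_right, hn x hx, mul_zero]

/-- Green's formula `∫ B · w + Ψ div w = 0` for a field that is smooth on every cell, has a
continuous normal component, and has no normal component on the boundary. -/
theorem integral_greenIntegrand_eq_zero (hd : 1 ≤ d) (h : HasWeakGradient M.domain Ψ B)
    {w : M.Cell → E d → E d} (hw : ∀ T, ContDiff ℝ ∞ (w T))
    (hn : ∀ T T' : M.Cell, T ≠ T' → ∀ v ∈ T.1, ∀ v' ∈ T'.1, facet T.1 v = facet T'.1 v' →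
      ∀ x ∈ hull (facet T.1 v),
        inner ℝ (w T x) (outerNormal T.1 v) + inner ℝ (w T' x) (outerNormal T'.1 v') = 0)
    (hb : ∀ T : M.Cell, ∀ v ∈ T.1, facet T.1 v ∈ M.boundaryFacets → ∀ x ∈ hull (facet T.1 v),
      inner ℝ (w T x) (outerNormal T.1 v) = 0) :
    M.integral (fun T => greenIntegrand Ψ B (w T)) = 0 := by
  classical
  have hΨ (S : M.Cell) := integrableOn_hull (integrableOn_of_memLp h.1) S
  have hB (S : M.Cell) := integrableOn_hull (integrableOn_of_memLp h.2.1) S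
  -- the part of the field that carries the normal trace on the facet opposite to `v`
  set r : M.Cell → E d → E d → E d := fun T v x => -inner ℝ (baryGrad T.1 v) (w T x) • (x - v)
    with hr
  have hrs (T : M.Cell) (v : E d) : ContDiff ℝ ∞ (r T v) :=
    ((contDiff_const.inner ℝ (hw T)).neg).smul (contDiff_id.sub contDiff_const)
  -- `x - v` is tangential to every facet through `v`, while `∇λ_v · (x - v) = -1` on the opposite
  -- one. So `r T v` has the normal trace of `w T` there and none elsewhere.
  have hr0 (T : M.Cell) {u v : E d} (hu : u ∈ T.1) (hv : v ∈ T.1) (huv : v ≠ u) :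
      ∀ x ∈ hull (facet T.1 u), inner ℝ (baryGrad T.1 u) (r T v x) = 0 := by
    intro x hx
    rw [hr]
    simp only
    rw [inner_smul_right, (M.isSimplex T).inner_baryGrad_sub hu hv huv,
      (((M.isSimplex T).mem_hull_facet_iff hu).1 hx).2, mul_zero]
  have hr1 (T : M.Cell) {v : E d} (hv : v ∈ T.1) :
      ∀ x ∈ hull (facet T.1 v),
        inner ℝ (baryGrad T.1 v) (r T v x) = inner ℝ (baryGrad T.1 v) (w T x) := by
    intro x hx
    rw [hr]
    simp only
    rw [inner_smul_right, ← bary_sub, (M.isSimplex T).bary_self hv,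
      (((M.isSimplex T).mem_hull_facet_iff hv).1 hx).2]
    ring
  have hsum (T : M.Cell) : ContDiff ℝ ∞ fun x => ∑ v ∈ T.1, r T v x :=
    ContDiff.sum fun v _ => hrs T v
  have hcell (T : M.Cell) : ∫ x in hull T.1, greenIntegrand Ψ B (w T) x
      = ∑ v ∈ T.1, ∫ x in hull T.1, greenIntegrand Ψ B (r T v) x := by
    -- The remainder after subtracting all facet parts has no normal trace and drops out by the
    -- formula on one cell.
    have h1 : ∫ x in hull T.1, greenIntegrand Ψ B (fun y => w T y - ∑ v ∈ T.1, r T v y) x = 0 := by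
      refine setIntegral_green_cell hd h T ((hw T).sub (hsum T)) fun u hu x hx => ?_
      rw [inner_sub_right, inner_sum, Finset.sum_eq_single_of_mem u hu, hr1 T hu x hx, sub_self]
      exact fun v hv hvu => hr0 T hu hv hvu x hx
    simp only [greenIntegrand_sub (hw T) (hsum T)] at h1
    rw [integral_sub (integrableOn_greenIntegrand (isCompact_hull _) (hΨ T) (hB T) (hw T))
      (integrableOn_greenIntegrand (isCompact_hull _) (hΨ T) (hB T) (hsum T)), sub_eq_zero] at h1
    rw [h1, ← integral_finsetSum _ fun v _ =>
      integrableOn_greenIntegrand (isCompact_hull _) (hΨ T) (hB T) (hrs T v)]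
    congr 1
    ext x
    have h2 (A : Finset (E d)) : greenIntegrand Ψ B (fun y => ∑ v ∈ A, r T v y) x
        = ∑ v ∈ A, greenIntegrand Ψ B (r T v) x := by
      induction A using Finset.induction_on with
      | empty => simp [greenIntegrand, fieldDiv]
      | insert v A hv ih =>
        simp only [Finset.sum_insert hv]
        rw [greenIntegrand_add (hrs T v) (ContDiff.sum fun v _ => hrs T v), ih]
    exact h2 T.1
  set a : (Σ _ : M.Cell, E d) → ℝ :=
    fun p => ∫ x in hull p.1.1, greenIntegrand Ψ B (r p.1 p.2) x with ha
  have htot : M.integral (fun T => greenIntegrand Ψ B (w T))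
      = ∑ p ∈ (Finset.univ : Finset M.Cell).sigma fun T => T.1, a p := by
    rw [Finset.sum_sigma, Triangulation.integral]
    exact Finset.sum_congr rfl fun T _ => hcell T
  rw [htot]
  -- facets that have a neighbouring cell cancel in pairs, the others have no normal trace
  let P : (Σ _ : M.Cell, E d) → (Σ _ : M.Cell, E d) → Prop := fun p q =>
    p.1 ≠ q.1 ∧ q.2 ∈ q.1.1 ∧ facet p.1.1 p.2 = facet q.1.1 q.2
  have hpair : ∀ p q : (Σ _ : M.Cell, E d), p.2 ∈ p.1.1 → P p q → a p + a q = 0 := by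
    rintro ⟨T, v⟩ ⟨T', v'⟩ hv ⟨hne, hv', hF⟩
    simp only at hv hne hv' hF
    have hc := M.bary_neg_of_facet_eq hd hne hv hv' hF
    refine setIntegral_green_pair hd h hne hv hv' hF (hrs T v) (hrs T' v') ?_ ?_ ?_
    · exact fun u hu => hr0 T (mem_facet.1 hu).2 hv (mem_facet.1 hu).1.symm
    · intro u hu
      rw [hF] at hu
      exact hr0 T' (mem_facet.1 hu).2 hv' (mem_facet.1 hu).1.symm
    · intro x hx
      have h1 := hn T T' hne v hv v' hv' hF x hx
      rw [M.outerNormal_eq_neg hd hne hv hv' hF, inner_neg_right, ← sub_eq_add_neg,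
        ← inner_sub_left, (M.isSimplex T).inner_outerNormal_eq_zero_iff hd hv] at h1
      have h2 := hr1 T' hv' x (hF ▸ hx)
      rw [(M.isSimplex T).baryGrad_eq_smul_of_facet_eq (M.isSimplex T') hv hv' hF,
        inner_smul_left, inner_smul_left] at h2
      have h3 := mul_left_cancel₀ (by simpa using hc.ne) h2
      rw [inner_sub_right, hr1 T hv x hx, h3, ← inner_sub_right, h1]
  have hbdry : ∀ p : (Σ _ : M.Cell, E d), p.2 ∈ p.1.1 → (¬ ∃ q, P p q) → a p = 0 := by
    rintro ⟨T, v⟩ hv hno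
    simp only at hv
    refine setIntegral_green_cell hd h T (hrs T v) fun u hu x hx => ?_
    by_cases huv : u = v
    · subst huv
      rw [hr1 T hu x hx, ← (M.isSimplex T).inner_outerNormal_eq_zero_iff hd hu]
      refine hb T u hu ⟨T.1, T.2, u, hu, rfl, fun T' hT' hsub => ?_⟩ x hx
      by_contra hne
      refine hno ?_
      -- A second cell containing the facet has exactly one further vertex, hence this facet as one
      -- of its own, and would be the partner excluded by `hno`.
      obtain ⟨v', hv', hvF⟩ : ∃ v' ∈ T', v' ∉ facet T.1 u := by
        by_contra hc
        push Not at hc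
        have h1 := Finset.card_le_card (show T' ⊆ facet T.1 u from hc)
        rw [M.card_cell _ hT', facet, Finset.card_erase_of_mem hu, M.card_cell _ T.2] at h1
        omega
      refine ⟨⟨⟨T', hT'⟩, v'⟩, fun e => hne (congrArg Subtype.val e).symm, hv', ?_⟩
      refine Finset.eq_of_subset_of_card_le (fun s hs => mem_facet.2 ⟨?_, hsub hs⟩) ?_
      · rintro rfl
        exact hvF hs
      · simp only
        rw [facet, facet, Finset.card_erase_of_mem hv', Finset.card_erase_of_mem hu,
          M.card_cell _ hT', M.card_cell _ T.2]
    · exact hr0 T hu hv (Ne.symm huv) x hx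
  have huniq : ∀ p q q' : (Σ _ : M.Cell, E d), p.2 ∈ p.1.1 → P p q → P p q' → q = q' := by
    rintro ⟨T, v⟩ ⟨T', v'⟩ ⟨T'', v''⟩ hv ⟨hne, hv', hF⟩ ⟨hne', hv'', hF'⟩
    simp only at hv hne hv' hF hne' hv'' hF'
    obtain rfl := M.cell_eq_of_facet_eq hd hne hne' hv hv' hv'' hF hF'
    rw [vertex_eq_of_facet_eq hv' (hF.symm.trans hF')]
  have hsymm : ∀ p q : (Σ _ : M.Cell, E d), p.2 ∈ p.1.1 → P p q → P q p :=
    fun p q hp hpq => ⟨hpq.1.symm, hp, hpq.2.2.symm⟩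
  -- The involution exchanges the two sides of an interior facet and fixes the sides without
  -- partner, whose terms are zero.
  refine Finset.sum_involution (fun p _ => if hp : ∃ q, P p q then hp.choose else p) ?_ ?_ ?_ ?_
  · intro p hp
    have hp2 : p.2 ∈ p.1.1 := (Finset.mem_sigma.1 hp).2
    by_cases hex : ∃ q, P p q
    · rw [dif_pos hex]
      exact hpair p _ hp2 hex.choose_spec
    · rw [dif_neg hex, hbdry p hp2 hex, add_zero]
  · intro p hp hap heq
    have hp2 : p.2 ∈ p.1.1 := (Finset.mem_sigma.1 hp).2
    by_cases hex : ∃ q, P p q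
    · rw [dif_pos hex] at heq
      exact hex.choose_spec.1 (congrArg Sigma.fst heq).symm
    · exact hap (hbdry p hp2 hex)
  · intro p hp
    by_cases hex : ∃ q, P p q
    · rw [dif_pos hex]
      exact Finset.mem_sigma.2 ⟨Finset.mem_univ _, hex.choose_spec.2.1⟩
    · rw [dif_neg hex]
      exact hp
  · intro p hp
    have hp2 : p.2 ∈ p.1.1 := (Finset.mem_sigma.1 hp).2
    by_cases hex : ∃ q, P p q
    · have hq := hsymm p _ hp2 hex.choose_spec
      have hex' : ∃ q, P hex.choose q := ⟨p, hq⟩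
      simp only [dif_pos hex, dif_pos hex']
      exact huniq _ _ _ hex.choose_spec.2.1 hex'.choose_spec hq
    · simp only [dif_neg hex]

end Triangulation

end MCS

namespace MCS

open scoped ContDiff

variable {d : ℕ}

/-! ### Polynomial fields -/

@[simp] theorem polyAt_zero (x : E d) : polyAt (0 : Poly d) x = 0 := map_zero _
@[simp] theorem polyAt_one (x : E d) : polyAt (1 : Poly d) x = 1 := map_one _
@[simp] theorem polyAt_add (p q : Poly d) (x : E d) :
    polyAt (p + q) x = polyAt p x + polyAt q x := map_add _ _ _
@[simp] theorem polyAt_sub (p q : Poly d) (x : E d) :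
    polyAt (p - q) x = polyAt p x - polyAt q x := map_sub _ _ _
@[simp] theorem polyAt_neg (p : Poly d) (x : E d) : polyAt (-p) x = -polyAt p x := map_neg _ _
@[simp] theorem polyAt_mul (p q : Poly d) (x : E d) :
    polyAt (p * q) x = polyAt p x * polyAt q x := map_mul _ _ _
@[simp] theorem polyAt_smul (c : ℝ) (p : Poly d) (x : E d) :
    polyAt (c • p) x = c * polyAt p x := MvPolynomial.smul_eval _ _ _
@[simp] theorem polyAt_C (c : ℝ) (x : E d) : polyAt (MvPolynomial.C c : Poly d) x = c :=
  MvPolynomial.eval_C _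
@[simp] theorem polyAt_X (i : Fin d) (x : E d) : polyAt (MvPolynomial.X i : Poly d) x = x i :=
  MvPolynomial.eval_X _
@[simp] theorem polyAt_sum {ι : Type*} (s : Finset ι) (p : ι → Poly d) (x : E d) :
    polyAt (∑ i ∈ s, p i) x = ∑ i ∈ s, polyAt (p i) x := map_sum _ _ _

theorem contDiff_polyAt (p : Poly d) : ContDiff ℝ ∞ (polyAt p) := by
  induction p using MvPolynomial.induction_on with
  | C c =>
    have : polyAt (MvPolynomial.C c : Poly d) = fun _ => c := funext fun x => polyAt_C c x
    rw [this]
    exact contDiff_const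
  | add p q hp hq =>
    have : polyAt (p + q) = fun x => polyAt p x + polyAt q x := funext fun x => polyAt_add p q x
    rw [this]
    exact hp.add hq
  | mul_X p i hp =>
    have : polyAt (p * MvPolynomial.X i) = fun x => polyAt p x * x i :=
      funext fun x => by rw [polyAt_mul, polyAt_X]
    rw [this]
    exact hp.mul (EuclideanSpace.proj (𝕜 := ℝ) i).contDiff

theorem continuous_polyAt (p : Poly d) : Continuous (polyAt p) := (contDiff_polyAt p).continuous

theorem integrableOn_polyAt (p : Poly d) (T : Finset (E d)) : IntegrableOn (polyAt p) (hull T) :=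
  (continuous_polyAt p).continuousOn.integrableOn_compact (isCompact_hull T)

theorem fderiv_polyAt (p : Poly d) (x : E d) (i : Fin d) :
    fderiv ℝ (polyAt p) x (EuclideanSpace.single i 1) = polyAt (MvPolynomial.pderiv i p) x := by
  have hdiff (p : Poly d) : DifferentiableAt ℝ (polyAt p) x :=
    (contDiff_polyAt p).differentiable (by simp) x
  induction p using MvPolynomial.induction_on with
  | C c =>
    have : polyAt (MvPolynomial.C c : Poly d) = fun _ => c := funext fun x => polyAt_C c x
    rw [this]
    simp
  | add p q hp hq =>
    have : polyAt (p + q) = fun x => polyAt p x + polyAt q x := funext fun x => polyAt_add p q x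
    rw [this, fderiv_fun_add (hdiff p) (hdiff q), map_add, polyAt_add, ← hp, ← hq]
    rfl
  | mul_X p j hp =>
    have h1 : polyAt (p * MvPolynomial.X j) = fun x => polyAt p x * EuclideanSpace.proj (𝕜 := ℝ) j x :=
      funext fun x => by rw [polyAt_mul, polyAt_X]; rfl
    rw [h1, fderiv_fun_mul (hdiff p) (EuclideanSpace.proj (𝕜 := ℝ) j).differentiableAt,
      ContinuousLinearMap.fderiv, MvPolynomial.pderiv_mul, polyAt_add, polyAt_mul, polyAt_mul, ← hp,
      MvPolynomial.pderiv_X]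
    by_cases hij : j = i
    · subst hij
      simp
      ring
    · simp [hij]
      ring

theorem vecAt_apply (v : Fin d → Poly d) (x : E d) (i : Fin d) : vecAt v x i = polyAt (v i) x := rfl

theorem matAt_apply (A : Matrix (Fin d) (Fin d) (Poly d)) (x : E d) (i j : Fin d) :
    matAt A x i j = polyAt (A i j) x := rfl

theorem contDiff_vecAt (v : Fin d → Poly d) : ContDiff ℝ ∞ (vecAt v) := by
  rw [contDiff_euclidean]
  exact fun i => contDiff_polyAt (v i)

theorem fderiv_vecAt (v : Fin d → Poly d) (x : E d) (i j : Fin d) :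
    fderiv ℝ (vecAt v) x (EuclideanSpace.single j 1) i
      = polyAt (MvPolynomial.pderiv j (v i)) x := by
  have h1 := (EuclideanSpace.proj (𝕜 := ℝ) i).hasFDerivAt.comp x
    ((contDiff_vecAt v).differentiable (by simp) x).hasFDerivAt
  have h2 : fderiv ℝ (polyAt (v i)) x = _ := h1.fderiv
  rw [← fderiv_polyAt, h2]
  rfl

theorem fieldDiv_vecAt (v : Fin d → Poly d) (x : E d) :
    fieldDiv (vecAt v) x = polyAt (divergence v) x := by
  rw [fieldDiv, divergence, polyAt_sum]
  exact Finset.sum_congr rfl fun i _ => fderiv_vecAt v x i i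

/-- A polynomial that vanishes on a non-empty open set is zero. -/
theorem eq_zero_of_polyAt_eq_zero {U : Set (E d)} (hU : IsOpen U) (hne : U.Nonempty) {p : Poly d}
    (h : ∀ x ∈ U, polyAt p x = 0) : p = 0 := by
  obtain ⟨x, hx⟩ := hne
  have hc : Continuous fun y : Fin d → ℝ => (WithLp.toLp 2 y : E d) := PiLp.continuous_toLp 2 _
  obtain ⟨r, hr, hball⟩ := Metric.isOpen_iff.1 (hU.preimage hc) (fun i => x i) hx
  refine MvPolynomial.funext_set (fun i => Metric.ball (x i) r) (fun i => ?_) fun y hy => ?_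
  · rw [Real.ball_eq_Ioo]
    exact Set.Ioo_infinite (by linarith)
  · rw [← ball_pi _ hr] at hy
    rw [map_zero]
    exact h _ (hball hy)

theorem poly_ext {p q : Poly d} (h : ∀ x, polyAt p x = polyAt q x) : p = q :=
  MvPolynomial.funext fun y => h (WithLp.toLp 2 y)

/-- A non-negative continuous function without integral vanishes almost everywhere, hence on the
open interior, hence as a polynomial. This turns vanishing energies into identities of polynomials.
-/
theorem IsSimplex.poly_eq_zero {T : Finset (E d)} (hT : IsSimplex T) {p : Poly d}
    (hp : ∀ x ∈ hull T, 0 ≤ polyAt p x) (h : ∫ x in hull T, polyAt p x = 0) : p = 0 := by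
  have h1 := (setIntegral_eq_zero_iff_of_nonneg_ae
    ((ae_restrict_iff' (measurableSet_hull T)).2 (ae_of_all _ hp)) (integrableOn_polyAt p T)).1 h
  have h2 := Measure.eqOn_open_of_ae_eq
    (ae_restrict_of_ae_restrict_of_subset interior_subset h1) isOpen_interior
    (continuous_polyAt p).continuousOn continuousOn_const
  exact eq_zero_of_polyAt_eq_zero isOpen_interior hT.interior_hull_nonempty fun x hx => h2 hx

/-- The Frobenius product of polynomial matrices. -/
noncomputable def frobPoly (A B : Matrix (Fin d) (Fin d) (Poly d)) : Poly d :=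
  ∑ i, ∑ j, A i j * B i j

theorem polyAt_frobPoly (A B : Matrix (Fin d) (Fin d) (Poly d)) (x : E d) :
    polyAt (frobPoly A B) x = frob (matAt A x) (matAt B x) := by
  simp [frobPoly, frob, matAt_apply]

theorem frobPoly_comm (A B : Matrix (Fin d) (Fin d) (Poly d)) : frobPoly A B = frobPoly B A := by
  simp only [frobPoly, mul_comm]

theorem frobPoly_sub (A B B' : Matrix (Fin d) (Fin d) (Poly d)) :
    frobPoly A (B - B') = frobPoly A B - frobPoly A B' := by
  simp [frobPoly, mul_sub, Finset.sum_sub_distrib]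

theorem frobPoly_smul_one (A : Matrix (Fin d) (Fin d) (Poly d)) (p : Poly d) :
    frobPoly A (p • 1) = p * A.trace := by
  simp [frobPoly, Matrix.one_apply, Matrix.trace, Finset.mul_sum, mul_comm]

theorem polyAt_trace (A : Matrix (Fin d) (Fin d) (Poly d)) (x : E d) :
    polyAt A.trace x = (matAt A x).trace := by
  simp [Matrix.trace, matAt_apply]

theorem trace_grad (v : Fin d → Poly d) : (grad v).trace = divergence v := rfl

theorem trace_eq_zero_of_skew {A : Matrix (Fin d) (Fin d) (Poly d)} (h : Aᵀ = -A) :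
    A.trace = 0 := by
  have h1 : A.trace = -A.trace := by rw [← Matrix.trace_neg, ← h, Matrix.trace_transpose]
  exact self_eq_neg.1 h1

/-- The action of a linear map of matrices on polynomial matrices. -/
noncomputable def mapPoly (C : Matrix (Fin d) (Fin d) ℝ →ₗ[ℝ] Matrix (Fin d) (Fin d) ℝ)
    (A : Matrix (Fin d) (Fin d) (Poly d)) : Matrix (Fin d) (Fin d) (Poly d) :=
  Matrix.of fun i j => ∑ k, ∑ l, C (Matrix.single k l 1) i j • A k l

theorem matAt_mapPoly (C : Matrix (Fin d) (Fin d) ℝ →ₗ[ℝ] Matrix (Fin d) (Fin d) ℝ)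
    (A : Matrix (Fin d) (Fin d) (Poly d)) (x : E d) : matAt (mapPoly C A) x = C (matAt A x) := by
  have h : matAt A x = ∑ k, ∑ l, matAt A x k l • Matrix.single k l (1 : ℝ) := by
    conv_lhs => rw [Matrix.matrix_eq_sum_single (matAt A x)]
    simp [Matrix.smul_single]
  conv_rhs => rw [h]
  ext i j
  simp only [map_sum, map_smul, Matrix.sum_apply, Matrix.smul_apply, smul_eq_mul]
  simp [matAt_apply, mapPoly, mul_comm]

theorem eq_zero_of_matAt_eq_zero {U : Set (E d)} (hU : IsOpen U) (hne : U.Nonempty)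
    {A : Matrix (Fin d) (Fin d) (Poly d)} (h : ∀ x ∈ U, matAt A x = 0) : A = 0 := by
  ext1 i j
  exact eq_zero_of_polyAt_eq_zero hU hne fun x hx => congrFun (congrFun (h x hx) i) j

theorem eq_zero_of_frobPoly_mapPoly_eq_zero
    {C : Matrix (Fin d) (Fin d) ℝ →ₗ[ℝ] Matrix (Fin d) (Fin d) ℝ}
    (hC : ∀ A, A ≠ 0 → 0 < frob (C A) A) {A : Matrix (Fin d) (Fin d) (Poly d)}
    (h : frobPoly (mapPoly C A) A = 0) : A = 0 := by
  refine eq_zero_of_matAt_eq_zero isOpen_univ Set.univ_nonempty fun x _ => ?_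
  by_contra hne
  have h1 := hC _ hne
  rw [← matAt_mapPoly, ← polyAt_frobPoly, h, polyAt_zero] at h1
  exact h1.false

theorem eq_zero_of_frobPoly_self_eq_zero {A : Matrix (Fin d) (Fin d) (Poly d)}
    (h : frobPoly A A = 0) : A = 0 := by
  ext1 i j
  refine poly_ext fun x => ?_
  have h1 : ∑ i, ∑ j, polyAt (A i j) x * polyAt (A i j) x = 0 := by
    rw [← polyAt_zero x, ← h]
    simp [frobPoly]
  have h2 := (Finset.sum_eq_zero_iff_of_nonneg fun _ _ =>
    Finset.sum_nonneg fun _ _ => mul_self_nonneg _).1 h1 i (Finset.mem_univ i)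
  have h3 := (Finset.sum_eq_zero_iff_of_nonneg fun _ _ => mul_self_nonneg _).1 h2 j
    (Finset.mem_univ j)
  exact mul_self_eq_zero.1 h3

namespace Triangulation

variable (M : Triangulation d)

/-- The integral of a piecewise polynomial. -/
noncomputable def intPoly : M.Scalar →ₗ[ℝ] ℝ where
  toFun q := M.integral fun T x => polyAt (q T) x
  map_add' p q := by
    simp only [integral, Pi.add_apply, polyAt_add, ← Finset.sum_add_distrib]
    exact Finset.sum_congr rfl fun T _ =>
      integral_add (integrableOn_polyAt _ _) (integrableOn_polyAt _ _)
  map_smul' c p := by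
    simp only [integral, Pi.smul_apply, polyAt_smul, RingHom.id_apply, smul_eq_mul,
      Finset.mul_sum]
    exact Finset.sum_congr rfl fun T _ => integral_const_mul _ _

theorem intPoly_apply (q : M.Scalar) : M.intPoly q = M.integral fun T x => polyAt (q T) x := rfl

variable {M}

theorem eq_zero_of_intPoly_eq_zero {q : M.Scalar} (hq : ∀ T, ∀ x ∈ hull T.1, 0 ≤ polyAt (q T) x)
    (h : M.intPoly q = 0) : q = 0 := by
  funext T
  have h1 := (Finset.sum_eq_zero_iff_of_nonneg
    fun T _ => setIntegral_nonneg (measurableSet_hull T.1) (hq T)).1 h T (Finset.mem_univ T)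
  exact (M.isSimplex T).poly_eq_zero (hq T) h1

theorem eq_zero_of_intPoly_mul_self {q : M.Scalar} (h : M.intPoly (q * q) = 0) : q = 0 := by
  have h1 := eq_zero_of_intPoly_eq_zero (q := q * q)
    (fun T x _ => by rw [Pi.mul_apply, polyAt_mul]; exact mul_self_nonneg _) h
  exact funext fun T => mul_self_eq_zero.1 (congrFun h1 T)

end Triangulation

end MCS

namespace MCS

open scoped ContDiff

variable {d : ℕ}

/-! ### The `L²`-projection -/

/-- The `L²` product is definite on the finite-dimensional space of polynomials of degree at most
`k`, so the map it induces into the dual is injective and therefore onto; `p` represents integration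
against `Ψ`. -/
theorem IsSimplex.exists_cell_projection {T : Finset (E d)} (hT : IsSimplex T) (k : ℕ)
    {Ψ : E d → ℝ} (hΨ : IntegrableOn Ψ (hull T)) :
    ∃ p ∈ MvPolynomial.restrictTotalDegree (Fin d) ℝ k,
      ∀ q ∈ MvPolynomial.restrictTotalDegree (Fin d) ℝ k,
        ∫ x in hull T, polyAt p x * polyAt q x = ∫ x in hull T, Ψ x * polyAt q x := by
  set W := MvPolynomial.restrictTotalDegree (Fin d) ℝ k with hW
  have hint (p : Poly d) : IntegrableOn (fun x => Ψ x * polyAt p x) (hull T) :=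
    hΨ.mul_continuousOn (continuous_polyAt p).continuousOn (isCompact_hull T)
  let I : Poly d →ₗ[ℝ] ℝ :=
    { toFun := fun p => ∫ x in hull T, polyAt p x
      map_add' := fun p q => by
        simp only [polyAt_add]
        exact integral_add (integrableOn_polyAt p T) (integrableOn_polyAt q T)
      map_smul' := fun c p => by
        simp only [polyAt_smul]
        exact integral_const_mul _ _ }
  let ℓ : W →ₗ[ℝ] ℝ :=
    { toFun := fun p => ∫ x in hull T, Ψ x * polyAt p.1 x
      map_add' := fun p q => by
        simp only [Submodule.coe_add, polyAt_add, mul_add]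
        exact integral_add (hint p) (hint q)
      map_smul' := fun c p => by
        simp only [Submodule.coe_smul, polyAt_smul, mul_left_comm _ c]
        exact integral_const_mul _ _ }
  let b : W →ₗ[ℝ] Module.Dual ℝ W :=
    ((LinearMap.mul ℝ (Poly d)).compr₂ I).compl₁₂ W.subtype W.subtype
  have hb (p q : W) : b p q = ∫ x in hull T, polyAt p.1 x * polyAt q.1 x := by
    change ∫ x in hull T, polyAt (p.1 * q.1) x = _
    simp only [polyAt_mul]
  have hinj : Function.Injective b := by
    rw [injective_iff_map_eq_zero]
    intro p hp
    have h1 : b p p = 0 := by rw [hp]; rfl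
    have h2 := hT.poly_eq_zero (p := p.1 * p.1)
      (fun x _ => by rw [polyAt_mul]; exact mul_self_nonneg _) h1
    exact Subtype.ext (mul_self_eq_zero.1 h2)
  have hsurj : Function.Surjective b :=
    (LinearMap.injective_iff_surjective_of_finrank_eq_finrank
      (Subspace.dual_finrank_eq (K := ℝ) (V := W)).symm).1 hinj
  obtain ⟨p, hp⟩ := hsurj ℓ
  refine ⟨p.1, p.2, fun q hq => ?_⟩
  have := LinearMap.congr_fun hp ⟨q, hq⟩
  rw [hb] at this
  exact this

namespace Triangulation

variable {M : Triangulation d} {k : ℕ}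

theorem IsL2Projection.intPoly_mul {Ψ : E d → ℝ} {P : M.Scalar} (hP : M.IsL2Projection k Ψ P)
    {q : M.Scalar} (hq : q ∈ M.Q k) :
    M.intPoly (P * q) = M.integral fun T x => Ψ x * polyAt (q T) x := by
  rw [← hP.2 q hq, intPoly_apply]
  simp only [Pi.mul_apply, polyAt_mul]

theorem sub_mem_Q {p q : M.Scalar} (hp : p ∈ M.Q k) (hq : q ∈ M.Q k) : p - q ∈ M.Q k :=
  fun T => Submodule.sub_mem _ (hp T) (hq T)

theorem existsUnique_isL2Projection (k : ℕ) {Ψ : E d → ℝ} (hΨ : IntegrableOn Ψ M.domain) :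
    ∃! P : M.Scalar, M.IsL2Projection k Ψ P := by
  choose P hP hPq using fun T : M.Cell =>
    (M.isSimplex T).exists_cell_projection k (integrableOn_hull hΨ T)
  refine ⟨P, ⟨hP, fun q hq => Finset.sum_congr rfl fun T _ => hPq T _ (hq T)⟩, fun P' hP' => ?_⟩
  have hPP : M.IsL2Projection k Ψ P :=
    ⟨hP, fun q hq => Finset.sum_congr rfl fun T _ => hPq T _ (hq T)⟩
  have hsub := sub_mem_Q hP'.1 hPP.1
  refine sub_eq_zero.1 (eq_zero_of_intPoly_mul_self ?_)
  rw [sub_mul, map_sub, hP'.intPoly_mul hsub, hPP.intPoly_mul hsub, sub_self]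

/-- The constant 1 is an admissible test function, so the projection preserves the mean value. -/
theorem IsL2Projection.mem_QZeroMean {Ψ : E d → ℝ} {P : M.Scalar} (hP : M.IsL2Projection k Ψ P)
    (hΨ : IntegrableOn Ψ M.domain) (hmean : ∫ x in M.domain, Ψ x = 0) : P ∈ M.QZeroMean k := by
  refine ⟨hP.1, ?_⟩
  have h1 : (1 : M.Scalar) ∈ M.Q k := fun T => by
    rw [MvPolynomial.mem_restrictTotalDegree]
    simp
  have h2 := hP.intPoly_mul h1
  simp only [Pi.one_apply, polyAt_one, mul_one] at h2
  rw [← M.setIntegral_domain hΨ, hmean] at h2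
  exact h2

/-! ### The pairing with hydrostatic stresses -/

theorem tangential_zero (N : E d) : tangential N 0 = 0 := by simp [tangential]

theorem tangential_sub (N w w' : E d) :
    tangential N (w - w') = tangential N w - tangential N w' := by
  simp only [tangential, inner_sub_right]
  module

theorem toLp_sub_mulVec (A B : Matrix (Fin d) (Fin d) ℝ) (N : E d) :
    (WithLp.toLp 2 ((A - B) *ᵥ fun i => N i) : E d)
      = WithLp.toLp 2 (A *ᵥ fun i => N i) - WithLp.toLp 2 (B *ᵥ fun i => N i) := by
  rw [Matrix.sub_mulVec]
  rfl

theorem tnComponent_sub (A B : Matrix (Fin d) (Fin d) ℝ) (N : E d) :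
    tnComponent (A - B) N = tnComponent A N - tnComponent B N := by
  rw [tnComponent, toLp_sub_mulVec, tangential_sub]
  rfl

theorem tangential_smul_self {N : E d} (hN : ‖N‖ = 1) (c : ℝ) : tangential N (c • N) = 0 := by
  rw [tangential, inner_smul_right, real_inner_self_eq_norm_sq, hN]
  simp

theorem tnComponent_eq_zero {A : Matrix (Fin d) (Fin d) ℝ} {N : E d} (hN : ‖N‖ = 1) {c : ℝ}
    (h : A *ᵥ (fun i => N i) = c • fun i => N i) : tnComponent A N = 0 := by
  rw [tnComponent, h]
  exact tangential_smul_self hN c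

theorem matAt_sub (A B : Matrix (Fin d) (Fin d) (Poly d)) (x : E d) :
    matAt (A - B) x = matAt A x - matAt B x := by
  ext i j
  exact polyAt_sub _ _ _

theorem matAt_smul_one (p : Poly d) (x : E d) :
    matAt (p • (1 : Matrix (Fin d) (Fin d) (Poly d))) x = polyAt p x • 1 := by
  ext i j
  by_cases h : i = j <;> simp [matAt_apply, h]

theorem tnComponent_smul_one {T : Finset (E d)} (hT : IsSimplex T) (hd : 1 ≤ d) {v : E d}
    (hv : v ∈ T) (p : Poly d) (x : E d) :
    tnComponent (matAt (p • (1 : Matrix (Fin d) (Fin d) (Poly d))) x) (outerNormal T v) = 0 := by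
  refine tnComponent_eq_zero (hT.norm_outerNormal hd hv) (c := polyAt p x) ?_
  rw [matAt_smul_one, Matrix.smul_mulVec, Matrix.one_mulVec]

theorem pairing_eq_intPoly_sub (u : M.Vector) (A : M.Tensor) :
    M.pairing u A = M.intPoly (fun T => frobPoly (A T) (grad (u T)))
      - ∑ T : M.Cell, ∑ v ∈ T.1, ∫ x in hull (facet T.1 v),
        inner ℝ (tnComponent (matAt (A T) x) (outerNormal T.1 v))
          (tangential (outerNormal T.1 v) (vecAt (u T) x)) ∂μHE[d - 1] := by
  simp only [pairing, intPoly_apply, polyAt_frobPoly]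

theorem pairing_eq_intPoly {u : M.Vector} {A : M.Tensor}
    (h : ∀ T : M.Cell, ∀ v ∈ T.1, ∀ x ∈ hull (facet T.1 v),
      tnComponent (matAt (A T) x) (outerNormal T.1 v) = 0) :
    M.pairing u A = M.intPoly (fun T => frobPoly (A T) (grad (u T))) := by
  rw [pairing_eq_intPoly_sub, sub_eq_self]
  refine Finset.sum_eq_zero fun T _ => Finset.sum_eq_zero fun v hv => ?_
  refine setIntegral_eq_zero_of_forall_eq_zero fun x hx => ?_
  rw [h T v hv x hx, inner_zero_left]

/-- The hydrostatic stress `p I`. -/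
noncomputable def isotropic (p : M.Scalar) : M.Tensor :=
  fun T => p T • (1 : Matrix (Fin d) (Fin d) (Poly d))

theorem tnComponent_isotropic (hd : 1 ≤ d) (p : M.Scalar) {T : M.Cell} {v : E d} (hv : v ∈ T.1)
    (x : E d) : tnComponent (matAt (isotropic p T) x) (outerNormal T.1 v) = 0 :=
  tnComponent_smul_one (M.isSimplex T) hd hv (p T) x

/-- This is the mechanism of pressure-robustness: all facet terms vanish, and the product of a
multiple of the identity with the gradient sees only its trace. -/
theorem pairing_isotropic (hd : 1 ≤ d) (u : M.Vector) (p : M.Scalar) :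
    M.pairing u (isotropic p) = M.intPoly (p * fun T => divergence (u T)) := by
  rw [pairing_eq_intPoly fun T v hv x _ => tnComponent_isotropic hd p hv x]
  congr 1
  funext T
  rw [frobPoly_comm, isotropic, frobPoly_smul_one, trace_grad]
  rfl

/-- The facet integrands of both pairings agree pointwise, so splitting off the hydrostatic part
requires no integrability on facets. -/
theorem pairing_sub_isotropic (hd : 1 ≤ d) (u : M.Vector) (A : M.Tensor) (p : M.Scalar) :
    M.pairing u (A - isotropic p)
      = M.pairing u A - M.intPoly (p * fun T => divergence (u T)) := by
  rw [pairing_eq_intPoly_sub, pairing_eq_intPoly_sub]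
  have h1 : (fun T => frobPoly ((A - isotropic p) T) (grad (u T)))
      = (fun T => frobPoly (A T) (grad (u T))) - p * fun T => divergence (u T) := by
    funext T
    rw [Pi.sub_apply, frobPoly_comm, frobPoly_sub, isotropic, frobPoly_smul_one, trace_grad,
      frobPoly_comm]
    rfl
  rw [h1, map_sub, sub_right_comm]
  congr 2
  refine Finset.sum_congr rfl fun T _ => Finset.sum_congr rfl fun v hv => ?_
  refine setIntegral_congr_fun (measurableSet_hull _) fun x _ => ?_
  rw [Pi.sub_apply, matAt_sub, tnComponent_sub, tnComponent_isotropic hd p hv, sub_zero]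

theorem isotropic_mem_Stress (hd : 1 ≤ d) {p : M.Scalar} (hp : p ∈ M.Q k) :
    isotropic p ∈ M.Stress k := by
  refine ⟨fun T i j => ?_, fun T T' _ v hv v' hv' _ x _ => ?_⟩
  · by_cases h : i = j
    · simpa [isotropic, h] using hp T
    · simp [isotropic, Matrix.one_apply_ne h]
  · rw [tnComponent_isotropic hd p hv, tnComponent_isotropic hd p hv', add_zero]

theorem sub_isotropic_mem_Stress (hd : 1 ≤ d) {A : M.Tensor} (hA : A ∈ M.Stress k) {p : M.Scalar}
    (hp : p ∈ M.Q k) : A - isotropic p ∈ M.Stress k := by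
  have hp' := isotropic_mem_Stress hd hp
  refine ⟨fun T i j => Submodule.sub_mem _ (hA.1 T i j) (hp'.1 T i j),
    fun T T' hne v hv v' hv' hF x hx => ?_⟩
  rw [Pi.sub_apply, Pi.sub_apply, matAt_sub, matAt_sub, tnComponent_sub, tnComponent_sub,
    tnComponent_isotropic hd p hv, tnComponent_isotropic hd p hv', sub_zero, sub_zero]
  exact hA.2 T T' hne v hv v' hv' hF x hx

/-! ### The solution for a gradient force -/

theorem loadStress_eq_zero {D : M.Data} (hUt : ∀ F ∈ D.ΓDt, ∀ x ∈ hull F, D.Ut F x = 0)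
    (A : M.Tensor) : D.loadStress A = 0 := by
  classical
  refine Finset.sum_eq_zero fun T _ => Finset.sum_eq_zero fun v _ => ?_
  split_ifs with h
  · refine setIntegral_eq_zero_of_forall_eq_zero fun x hx => ?_
    simp only [hUt _ h x hx, inner_zero_left]
  · rfl

theorem load_eq {D : M.Data} (hΓ : D.ΓDn = M.boundaryFacets) (u : M.Vector) :
    D.load u = M.integral fun T x => inner ℝ (D.B x) (vecAt (u T) x) := by
  classical
  rw [Data.load, add_eq_left]
  refine Finset.sum_eq_zero fun T _ => Finset.sum_eq_zero fun v _ => ?_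
  rw [if_neg]
  simp [Data.ΓNn, hΓ]

/-- The work of a gradient force, for a discrete displacement without normal trace. -/
theorem load_eq_neg_intPoly (hd : 1 ≤ d) {D : M.Data} (hΓ : D.ΓDn = M.boundaryFacets) {Ψ : E d → ℝ}
    (hΨ : HasWeakGradient M.domain Ψ D.B) {P : M.Scalar} (hP : M.IsL2Projection k Ψ P)
    {u : M.Vector} (hu : u ∈ M.HDiv) (hn : M.NormalTraceEq D.ΓDn u fun _ _ => 0)
    (hdiv : (fun T => divergence (u T)) ∈ M.Q k) :
    D.load u = -M.intPoly (P * fun T => divergence (u T)) := by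
  -- Because `div u ∈ Q_h^k`, the projection `P` can be exchanged for `Ψ`; the claim is then Green's
  -- formula for `u`.
  rw [load_eq hΓ, hP.intPoly_mul hdiv, eq_neg_iff_add_eq_zero, ← integral_greenIntegrand_eq_zero hd
    hΨ (w := fun T => vecAt (u T)) (fun T => contDiff_vecAt _) hu
    (fun T v hv hF => hn T v hv (hΓ ▸ hF)), integral, integral, integral, ← Finset.sum_add_distrib]
  refine Finset.sum_congr rfl fun T _ => ?_
  rw [← integral_add]
  · simp only [greenIntegrand, fieldDiv_vecAt]
  · exact integrableOn_inner (isCompact_hull _)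
      (integrableOn_hull (integrableOn_of_memLp hΨ.2.1) T) (contDiff_vecAt _).continuous.continuousOn
  · exact (integrableOn_hull (integrableOn_of_memLp hΨ.1) T).mul_continuousOn
      (continuous_polyAt _).continuousOn (isCompact_hull _)

/-- The hypotheses on the data and on the displacement space under which a gradient force is
balanced by the pressure. -/
structure GradientForce (k : ℕ) (D : M.Data) (Ψ : E d → ℝ) (V : Submodule ℝ M.Vector) : Prop where
  dim_pos : 1 ≤ d
  normal_boundary : D.ΓDn = M.boundaryFacets
  normal_zero : ∀ F ∈ D.ΓDn, ∀ x ∈ hull F, D.Un F x = 0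
  tangential_zero : ∀ F ∈ D.ΓDt, ∀ x ∈ hull F, D.Ut F x = 0
  traction_zero : ∀ F ∈ D.ΓNt, ∀ x ∈ hull F, D.Tt F x = 0
  weakGradient : HasWeakGradient M.domain Ψ D.B
  mean_zero : ∫ x in M.domain, Ψ x = 0
  subset_HDiv : (V : Set M.Vector) ⊆ M.HDiv
  range_div : {q : M.Scalar | ∃ v ∈ V, M.NormalTraceEq D.ΓDn v (fun _ _ => 0) ∧
      q = fun T => divergence (v T)} = M.QZeroMean k

namespace GradientForce

variable {D : M.Data} {Ψ : E d → ℝ} {V : Submodule ℝ M.Vector} {P : M.Scalar}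
  {C : Matrix (Fin d) (Fin d) ℝ →ₗ[ℝ] Matrix (Fin d) (Fin d) ℝ} {S : M.Fields}

theorem divergence_mem (H : GradientForce k D Ψ V) {u : M.Vector} (hu : u ∈ V)
    (hn : M.NormalTraceEq D.ΓDn u fun _ _ => 0) : (fun T => divergence (u T)) ∈ M.QZeroMean k := by
  rw [← H.range_div]
  exact ⟨u, hu, hn, rfl⟩

theorem load_eq (H : GradientForce k D Ψ V) (hP : M.IsL2Projection k Ψ P) {u : M.Vector}
    (hu : u ∈ V) (hn : M.NormalTraceEq D.ΓDn u fun _ _ => 0) :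
    D.load u = -M.intPoly (P * fun T => divergence (u T)) :=
  load_eq_neg_intPoly H.dim_pos H.normal_boundary H.weakGradient hP (H.subset_HDiv hu) hn
    (H.divergence_mem hu hn).1

theorem projection_mem (H : GradientForce k D Ψ V) (hP : M.IsL2Projection k Ψ P) :
    P ∈ M.QZeroMean k :=
  hP.mem_QZeroMean (integrableOn_of_memLp H.weakGradient.1) H.mean_zero

/-- Only the momentum balance has content: both sides are the work of `P` on the divergence. In the
constitutive equation stress and pressure cancel, and skew fields are orthogonal to `P I`. -/
theorem isSolution_hydrostatic (H : GradientForce k D Ψ V) (hP : M.IsL2Projection k Ψ P) :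
    M.IsSolution k C D V (M.QZeroMean k) (M.hydrostatic P) where
  mem_u := V.zero_mem
  mem_σ := isotropic_mem_Stress H.dim_pos hP.1
  mem_ε := fun T i j => Submodule.zero_mem _
  mem_ω := ⟨fun T i j => Submodule.zero_mem _, fun T => by simp [hydrostatic]⟩
  mem_p := H.projection_mem hP
  bc_u := fun T v hv hF x hx => by
    rw [H.normal_zero _ hF x hx]
    have : vecAt ((M.hydrostatic P).u T) x = 0 := by
      ext i
      exact polyAt_zero x
    rw [this, inner_zero_left]
  bc_σ := fun T v hv hF x hx => by
    rw [H.traction_zero _ hF x hx]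
    exact tnComponent_smul_one (M.isSimplex T) H.dim_pos hv _ x
  eq_ε := fun δε _ => by
    have h0 (T : M.Cell) (x : E d) : matAt ((M.hydrostatic P).ε T) x = 0 := by
      ext i j
      exact polyAt_zero x
    have h1 (T : M.Cell) (x : E d) : frob (matAt ((M.hydrostatic P).σ T) x) (matAt (δε T) x)
        = polyAt ((M.hydrostatic P).p T) x * (matAt (δε T) x).trace := by
      rw [← polyAt_frobPoly, frobPoly_comm, ← polyAt_trace, ← polyAt_mul, ← frobPoly_smul_one]
      rfl
    simp only [h0, h1, map_zero]
    simp [frob, integral]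
  eq_σ := fun δσ hδσ _ => by
    have h0 (T : M.Cell) (x : E d) : matAt ((M.hydrostatic P).ε T) x = 0 := by
      ext i j
      exact polyAt_zero x
    have h0' (T : M.Cell) (x : E d) : matAt ((M.hydrostatic P).ω T) x = 0 := by
      ext i j
      exact polyAt_zero x
    have h1 (T : M.Cell) (x : E d) : vecAt ((M.hydrostatic P).u T) x = 0 := by
      ext i
      exact polyAt_zero x
    have h2 (T : M.Cell) (x : E d) : matAt (grad ((M.hydrostatic P).u T)) x = 0 := by
      ext i j
      simp [hydrostatic, matAt_apply, grad]
    rw [loadStress_eq_zero H.tangential_zero, pairing]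
    simp only [h0, h0', h1, h2, MCS.Triangulation.tangential_zero, inner_zero_right]
    simp [frob, integral]
  eq_u := fun δu hδu hn => by
    rw [H.load_eq hP hδu hn, neg_inj]
    exact pairing_isotropic H.dim_pos δu P
  eq_ω := fun δω hδω => by
    have h1 (T : M.Cell) (x : E d) : frob (matAt (δω T) x) (matAt ((M.hydrostatic P).σ T) x) = 0 := by
      rw [← polyAt_frobPoly, hydrostatic, frobPoly_smul_one, trace_eq_zero_of_skew (hδω.2 T),
        mul_zero, polyAt_zero]
    simp [h1, integral]
  eq_p := fun δp _ => by
    have h0 (T : M.Cell) (x : E d) : matAt ((M.hydrostatic P).ε T) x = 0 := by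
      ext i j
      exact polyAt_zero x
    simp [h0, integral]

theorem normalTrace_eq_zero (H : GradientForce k D Ψ V)
    (hS : M.IsSolution k C D V (M.QZeroMean k) S) : M.NormalTraceEq D.ΓDn S.u fun _ _ => 0 :=
  fun T v hv hF x hx => (hS.bc_u T v hv hF x hx).trans (H.normal_zero _ hF x hx)

theorem pairing_stress (H : GradientForce k D Ψ V) (hP : M.IsL2Projection k Ψ P)
    (hS : M.IsSolution k C D V (M.QZeroMean k) S) {u : M.Vector} (hu : u ∈ V)
    (hn : M.NormalTraceEq D.ΓDn u fun _ _ => 0) :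
    M.pairing u S.σ = M.intPoly (P * fun T => divergence (u T)) := by
  have h := hS.eq_u u hu hn
  rw [H.load_eq hP hu hn, neg_inj] at h
  exact h

/-- An energy argument. Testing compatibility with `σ - P I` eliminates `u`, since `σ` and `P I`
pair equally with it, and eliminates `ω` by the weak symmetry of `σ` and the zero trace of `ω`. With
the incompressibility constraint tested by `P` this leaves `∫ ε : σ = 0`; tested by `p`, it reduces
the constitutive equation to `∫ C ε : ε = 0`. -/
theorem strain_eq_zero (H : GradientForce k D Ψ V) (hC : ∀ A, A ≠ 0 → 0 < frob (C A) A)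
    (hP : M.IsL2Projection k Ψ P) (hS : M.IsSolution k C D V (M.QZeroMean k) S) : S.ε = 0 := by
  have hn := H.normalTrace_eq_zero hS
  have htest : M.TNTraceEq D.ΓNt (S.σ - isotropic P) fun _ _ => 0 := by
    intro T v hv hF x hx
    rw [Pi.sub_apply, matAt_sub, tnComponent_sub,
      tnComponent_isotropic H.dim_pos P hv, sub_zero, hS.bc_σ T v hv hF x hx,
      H.traction_zero _ hF x hx]
  have e1 := hS.eq_σ _ (sub_isotropic_mem_Stress H.dim_pos hS.mem_σ hP.1) htest
  rw [pairing_sub_isotropic H.dim_pos, H.pairing_stress hP hS hS.mem_u hn, sub_self, sub_zero,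
    loadStress_eq_zero H.tangential_zero] at e1
  have e2 := hS.eq_ω _ hS.mem_ω
  have e3 := hS.eq_ε _ hS.mem_ε
  have e4 := hS.eq_p _ hS.mem_p
  have e5 := hS.eq_p _ (H.projection_mem hP)
  simp only [← polyAt_frobPoly, ← matAt_mapPoly, ← polyAt_trace, ← polyAt_mul, ← polyAt_neg,
    ← intPoly_apply] at e1 e2 e3 e4 e5
  simp only [Pi.sub_apply, frobPoly_sub, isotropic, frobPoly_smul_one,
    trace_eq_zero_of_skew (hS.mem_ω.2 _), mul_zero, sub_zero] at e1
  rw [e2, add_zero] at e1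
  have e6 : M.intPoly (fun T => frobPoly (S.ε T) (S.σ T) - P T * (S.ε T).trace)
      = M.intPoly (fun T => frobPoly (S.ε T) (S.σ T))
        + M.intPoly (fun T => -(P T * (S.ε T).trace)) := by
    rw [← map_add]
    congr 1
    funext T
    exact sub_eq_add_neg _ _
  have e7 : M.intPoly (fun T => -(S.p T * (S.ε T).trace))
      = -M.intPoly (fun T => S.p T * (S.ε T).trace) := by
    rw [← map_neg]
    rfl
  rw [e6, e5, add_zero] at e1
  simp only [frobPoly_comm (S.σ _)] at e3
  rw [e7] at e4
  have e8 : M.intPoly (fun T => frobPoly (mapPoly C (S.ε T)) (S.ε T)) = 0 := by linarith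
  have h0 := eq_zero_of_intPoly_eq_zero (fun T x _ => ?_) e8
  · funext T
    exact eq_zero_of_frobPoly_mapPoly_eq_zero hC (congrFun h0 T)
  · rw [polyAt_frobPoly, matAt_mapPoly]
    by_cases hA : matAt (S.ε T) x = 0
    · simp [hA, frob]
    · exact (hC _ hA).le

/-- Without strain the constitutive equation makes `σ - p I` orthogonal to the broken space `F_h^k`,
of which it is an element. -/
theorem stress_eq_isotropic (H : GradientForce k D Ψ V) (hC : ∀ A, A ≠ 0 → 0 < frob (C A) A)
    (hP : M.IsL2Projection k Ψ P) (hS : M.IsSolution k C D V (M.QZeroMean k) S) :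
    S.σ = isotropic S.p := by
  have h0 := H.strain_eq_zero hC hP hS
  have e := hS.eq_ε _ (sub_isotropic_mem_Stress H.dim_pos hS.mem_σ hS.mem_p.1).1
  simp only [← polyAt_frobPoly, ← matAt_mapPoly, ← polyAt_trace, ← polyAt_mul,
    ← intPoly_apply] at e
  have h1 : (fun T => frobPoly (mapPoly C (S.ε T)) ((S.σ - isotropic S.p) T)) = 0 := by
    funext T
    simp [h0, frobPoly, mapPoly]
  rw [h1, map_zero, zero_add, ← map_sub] at e
  have h2 : ((fun T => frobPoly (S.σ T) ((S.σ - isotropic S.p) T))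
      - fun T => S.p T * ((S.σ - isotropic S.p) T).trace)
      = fun T => frobPoly ((S.σ - isotropic S.p) T) ((S.σ - isotropic S.p) T) := by
    funext T
    rw [Pi.sub_apply, ← frobPoly_smul_one, frobPoly_comm, ← frobPoly_sub]
    rfl
  rw [h2] at e
  have h3 := eq_zero_of_intPoly_eq_zero (fun T x _ => ?_) e
  · exact sub_eq_zero.1 (funext fun T => eq_zero_of_frobPoly_self_eq_zero (congrFun h3 T))
  · rw [polyAt_frobPoly]
    exact Finset.sum_nonneg fun _ _ => Finset.sum_nonneg fun _ _ => mul_self_nonneg _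

/-- Both pressures do the same work on every divergence, and by surjectivity `p - P` is itself a
divergence. -/
theorem pressure_eq (H : GradientForce k D Ψ V) (hC : ∀ A, A ≠ 0 → 0 < frob (C A) A)
    (hP : M.IsL2Projection k Ψ P) (hS : M.IsSolution k C D V (M.QZeroMean k) S) : S.p = P := by
  have hmem : S.p - P ∈ M.QZeroMean k := by
    refine ⟨sub_mem_Q hS.mem_p.1 hP.1, ?_⟩
    rw [← intPoly_apply, map_sub, intPoly_apply, intPoly_apply, hS.mem_p.2,
      (H.projection_mem hP).2, sub_zero]
  rw [← H.range_div] at hmem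
  obtain ⟨v, hv, hn, hdiv⟩ := hmem
  have h1 := H.pairing_stress hP hS hv hn
  rw [H.stress_eq_isotropic hC hP hS, pairing_isotropic H.dim_pos, ← sub_eq_zero, ← map_sub,
    ← sub_mul, ← hdiv] at h1
  exact sub_eq_zero.1 (eq_zero_of_intPoly_mul_self h1)

end GradientForce

end Triangulation

end MCS

namespace MCS

open scoped ContDiff
open MvPolynomial (pderiv)

variable {d : ℕ}

/-! ### Degrees and derivatives of polynomials -/

theorem mem_restrictTotalDegree_iff {k : ℕ} {p : Poly d} :
    p ∈ MvPolynomial.restrictTotalDegree (Fin d) ℝ k ↔ ∀ m ∈ p.support, m.degree ≤ k := by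
  rw [MvPolynomial.mem_restrictTotalDegree, MvPolynomial.totalDegree, Finset.sup_le_iff]
  rfl

theorem pderiv_mem_restrictTotalDegree {k : ℕ} {p : Poly d}
    (hp : p ∈ MvPolynomial.restrictTotalDegree (Fin d) ℝ k) (i : Fin d) :
    pderiv i p ∈ MvPolynomial.restrictTotalDegree (Fin d) ℝ (k - 1) := by
  rw [mem_restrictTotalDegree_iff] at *
  intro m hm
  rw [MvPolynomial.mem_support_iff, MvPolynomial.coeff_pderiv] at hm
  have h := hp (m + Finsupp.single i 1) (MvPolynomial.mem_support_iff.2 (left_ne_zero_of_mul hm))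
  rw [map_add, Finsupp.degree_single] at h
  omega

/-- A divergence free element of the local Raviart--Thomas space of order `k` has degree at most
`k`. -/
theorem mem_restrictTotalDegree_of_divergence_eq_zero {k : ℕ} (hk : 1 ≤ k) {u w : Fin d → Poly d}
    {q : Poly d} (hw : ∀ i, w i ∈ MvPolynomial.restrictTotalDegree (Fin d) ℝ k)
    (hq : q ∈ MvPolynomial.homogeneousSubmodule (Fin d) ℝ k)
    (hu : ∀ i, u i = w i + q * MvPolynomial.X i) (hd : 1 ≤ d) (hdiv : divergence u = 0) (i : Fin d) :
    u i ∈ MvPolynomial.restrictTotalDegree (Fin d) ℝ k := by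
  have hq' : q.IsHomogeneous k := hq
  have hE := hq'.sum_X_mul_pderiv
  -- By Euler's identity for homogeneous polynomials, `div (q X) = (k + d) q`.
  have h1 : divergence u = (∑ i, pderiv i (w i)) + (k + d : ℕ) • q := by
    simp only [divergence, hu, map_add, MvPolynomial.pderiv_mul, MvPolynomial.pderiv_X_self,
      Finset.sum_add_distrib, add_smul, ← hE]
    simp [mul_comm]
  -- `div w` has degree at most `k - 1`, which is below `k` as `1 ≤ k`. So `(k + d) q` is the whole
  -- part of degree `k` of `div u = 0`.
  have h2 : q = 0 := by
    ext m
    by_cases hm : m.degree = k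
    · have h3 : MvPolynomial.coeff m (∑ i, pderiv i (w i)) = 0 := by
        by_contra hne
        have hmem := Submodule.sum_mem (t := Finset.univ) _
          fun i _ => pderiv_mem_restrictTotalDegree (hw i) i
        rw [mem_restrictTotalDegree_iff] at hmem
        have := hmem m (MvPolynomial.mem_support_iff.2 hne)
        omega
      have h4 := congrArg (MvPolynomial.coeff m) (h1.symm.trans hdiv)
      rw [MvPolynomial.coeff_add, h3, zero_add, MvPolynomial.coeff_smul, MvPolynomial.coeff_zero,
        nsmul_eq_mul, mul_eq_zero] at h4
      refine h4.resolve_left ?_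
      exact_mod_cast (by omega : k + d ≠ 0)
    · rw [MvPolynomial.coeff_zero]
      by_contra hne
      exact hm (by rw [Finsupp.degree_eq_weight_one]; exact hq' hne)
  rw [hu, h2, zero_mul, add_zero]
  exact hw i

/-- The commutator of two derivations is a derivation, and this one annihilates the variables. -/
theorem pderiv_comm (i j : Fin d) (p : Poly d) :
    pderiv i (pderiv j p) = pderiv j (pderiv i p) := by
  have h : ⁅(pderiv i : Derivation ℝ (Poly d) (Poly d)), (pderiv j : Derivation ℝ (Poly d) (Poly d))⁆ = 0 := by
    refine MvPolynomial.derivation_ext fun k => ?_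
    classical
    simp only [Derivation.commutator_apply, MvPolynomial.pderiv_X, Pi.single_apply]
    split_ifs <;> simp
  have h1 := congrArg (fun D : Derivation ℝ (Poly d) (Poly d) => D p) h
  rw [Derivation.commutator_apply] at h1
  exact sub_eq_zero.1 h1

theorem polyAt_eq_of_pderiv_eq_zero {p : Poly d} (h : ∀ i, pderiv i p = 0) (x y : E d) :
    polyAt p x = polyAt p y := by
  refine is_const_of_fderiv_eq_zero (𝕜 := ℝ) ((contDiff_polyAt p).differentiable (by simp))
    (fun z => ?_) x y
  ext w
  conv_lhs => rw [← sum_smul_single w, map_sum]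
  simp [fderiv_polyAt, h]

/-- A polynomial vector field with skew-symmetric gradient is an infinitesimal rigid motion. -/
theorem exists_skew_of_grad_skew {u : Fin d → Poly d} (h : (grad u)ᵀ = -grad u) :
    ∃ A : E d →ₗ[ℝ] E d, (∀ x y, inner ℝ (A x) y = -inner ℝ x (A y)) ∧
      ∀ x y, vecAt u x - vecAt u y = A (x - y) := by
  have hs (i j : Fin d) : pderiv j (u i) = -pderiv i (u j) := by
    have := congrFun (congrFun h j) i
    simpa [grad] using this
  -- Alternating the skew-symmetry with the exchange of derivatives leads each second derivative
  -- back to its own negative, so the field is affine.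
  have h2 (i j k : Fin d) : pderiv k (pderiv j (u i)) = 0 := by
    have e : pderiv k (pderiv j (u i)) = -pderiv k (pderiv j (u i)) := by
      conv_lhs =>
        rw [hs i j, map_neg, pderiv_comm, hs j k, map_neg, neg_neg, pderiv_comm, hs k i, map_neg,
          pderiv_comm]
    exact self_eq_neg.1 e
  set W : Fin d → Fin d → ℝ := fun i j => polyAt (pderiv j (u i)) 0 with hW
  have hWs (i j : Fin d) : W i j = -W j i := by
    rw [hW]
    simp only
    rw [hs i j, polyAt_neg]
  let A : E d →ₗ[ℝ] E d :=
    { toFun := fun x => WithLp.toLp 2 fun i => ∑ j, W i j * x j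
      map_add' := fun x y => by
        ext i
        simp [mul_add, Finset.sum_add_distrib]
      map_smul' := fun c x => by
        ext i
        simp [Finset.mul_sum, mul_left_comm] }
  have hA (x : E d) (i : Fin d) : A x i = ∑ j, W i j * x j := rfl
  refine ⟨A, fun x y => ?_, fun x y => ?_⟩
  · simp only [inner_eq_sum, hA, Finset.sum_mul, Finset.mul_sum, ← Finset.sum_neg_distrib]
    rw [Finset.sum_comm]
    refine Finset.sum_congr rfl fun i _ => Finset.sum_congr rfl fun j _ => ?_
    rw [hWs j i]
    ring
  · ext i
    have hc : ∀ k, pderiv k (u i - ∑ j, MvPolynomial.C (W i j) * MvPolynomial.X j) = 0 := by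
      intro k
      refine poly_ext fun z => ?_
      have h3 := polyAt_eq_of_pderiv_eq_zero (h2 i k) z 0
      simp only [map_sub, map_sum, MvPolynomial.pderiv_C_mul, MvPolynomial.pderiv_X, polyAt_sub,
        polyAt_sum, polyAt_mul, polyAt_C, polyAt_zero]
      rw [Finset.sum_eq_single_of_mem k (Finset.mem_univ k), h3]
      · simp [hW]
      · intro j _ hj
        rw [Pi.single_eq_of_ne hj, polyAt_zero, mul_zero]
    have h4 := polyAt_eq_of_pderiv_eq_zero hc x y
    simp only [polyAt_sub, polyAt_sum, polyAt_mul, polyAt_C, polyAt_X] at h4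
    simp only [PiLp.sub_apply, vecAt_apply, hA, mul_sub, Finset.sum_sub_distrib]
    linarith

theorem eq_zero_of_vecAt_eq_zero {u : Fin d → Poly d} (h : ∀ x, vecAt u x = 0) : u = 0 := by
  funext i
  refine poly_ext fun x => ?_
  rw [← vecAt_apply, h x, Pi.zero_apply, polyAt_zero]
  rfl

theorem vecAt_sub (u v : Fin d → Poly d) (x : E d) : vecAt (u - v) x = vecAt u x - vecAt v x := by
  ext i
  exact polyAt_sub _ _ _

theorem grad_sub (u v : Fin d → Poly d) : grad (u - v) = grad u - grad v := by
  ext1 i j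
  exact map_sub (pderiv j) _ _

/-! ### Infinitesimal rigid motions and the facets of a simplex. -/

namespace IsSimplex

variable {T : Finset (E d)}

/-- An infinitesimal rotation that vanishes on the directions of a facet is zero. -/
theorem skew_eq_zero_of_facet (hT : IsSimplex T) (hd : 1 ≤ d) {v : E d} (hv : v ∈ T)
    {A : E d →ₗ[ℝ] E d} (hA : ∀ x y, inner ℝ (A x) y = -inner ℝ x (A y))
    (h : ∀ u ∈ facet T v, ∀ u' ∈ facet T v, A (u - u') = 0) : A = 0 := by
  -- By skew-symmetry, vanishing on the facet directions makes all values of `A` orthogonal to them,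
  -- thus multiples of `g = baryGrad T v`. Then `A g · g = 0` gives `A g = 0`, and `A y · g = -y · A
  -- g` gives the rest.
  have hpar (y : E d) : ∃ c : ℝ, A y = c • baryGrad T v :=
    hT.exists_smul_baryGrad_of_orthogonal hd hv fun u hu u' hu' => by
      rw [hA, h u hu u' hu', inner_zero_right, neg_zero]
  have hself (y : E d) : inner ℝ (A y) y = 0 := by
    have h1 := hA y y
    rw [real_inner_comm (A y) y] at h1
    linarith
  have hg := hT.baryGrad_ne_zero hd hv
  have hAg : A (baryGrad T v) = 0 := by
    obtain ⟨c, hc⟩ := hpar (baryGrad T v)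
    have h1 := hself (baryGrad T v)
    rw [hc, inner_smul_left, mul_eq_zero] at h1
    rcases h1 with h1 | h1
    · have : c = 0 := by simpa using h1
      rw [hc, this, zero_smul]
    · exact absurd (inner_self_eq_zero.1 h1) hg
  ext1 y
  obtain ⟨c, hc⟩ := hpar y
  have h1 := hA y (baryGrad T v)
  rw [hAg, inner_zero_right, neg_zero, hc, inner_smul_left, mul_eq_zero] at h1
  rcases h1 with h1 | h1
  · have : c = 0 := by simpa using h1
    rw [hc, this, zero_smul]
    rfl
  · exact absurd (inner_self_eq_zero.1 h1) hg

/-- A rigid motion that vanishes on a facet is zero. -/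
theorem eq_zero_of_facet_of_grad_skew (hT : IsSimplex T) (hd : 1 ≤ d) {v : E d} (hv : v ∈ T)
    {u : Fin d → Poly d} (h : (grad u)ᵀ = -grad u) (h0 : ∀ x ∈ hull (facet T v), vecAt u x = 0) :
    u = 0 := by
  obtain ⟨A, hA, hu⟩ := exists_skew_of_grad_skew h
  have hA0 : A = 0 := hT.skew_eq_zero_of_facet hd hv hA fun a ha b hb => by
    rw [← hu, h0 a (subset_hull ha), h0 b (subset_hull hb), sub_zero]
  obtain ⟨a, ha⟩ := hT.facet_nonempty hd v
  refine eq_zero_of_vecAt_eq_zero fun x => ?_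
  have h1 := hu x a
  rw [hA0, h0 a (subset_hull ha), sub_zero] at h1
  exact h1

/-- An infinitesimal rotation whose motion stays tangential to a facet annihilates the normal. -/
theorem skew_baryGrad_eq_zero (hT : IsSimplex T) (hd : 1 ≤ d) {v : E d} (hv : v ∈ T)
    {A : E d →ₗ[ℝ] E d} (hA : ∀ x y, inner ℝ (A x) y = -inner ℝ x (A y))
    (h : ∀ u ∈ facet T v, ∀ u' ∈ facet T v, inner ℝ (baryGrad T v) (A (u - u')) = 0) :
    A (baryGrad T v) = 0 := by
  obtain ⟨c, hc⟩ := hT.exists_smul_baryGrad_of_orthogonal hd hv (y := A (baryGrad T v))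
    fun u hu u' hu' => by rw [hA, h u hu u' hu', neg_zero]
  have h1 := hA (baryGrad T v) (baryGrad T v)
  rw [real_inner_comm (A (baryGrad T v)) (baryGrad T v)] at h1
  have h2 : inner ℝ (A (baryGrad T v)) (baryGrad T v) = 0 := by linarith
  rw [hc, inner_smul_left, mul_eq_zero] at h2
  rcases h2 with h2 | h2
  · have : c = 0 := by simpa using h2
    rw [hc, this, zero_smul]
  · exact absurd (inner_self_eq_zero.1 h2) (hT.baryGrad_ne_zero hd hv)

/-! ### Integration over facets -/

/-- The hyperplane of the facet is parametrized isometrically by `ℝⁿ`, so that Hausdorff measure on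
the facet becomes Lebesgue measure. The last property is what extends an equality almost everywhere
to the whole closed facet. -/
theorem exists_isometry_facet {n : ℕ} {T : Finset (E (n + 1))} (hT : IsSimplex T) {v : E (n + 1)}
    (hv : v ∈ T) : ∃ φ : E n → E (n + 1), Isometry φ ∧ hull (facet T v) ⊆ Set.range φ ∧
      φ ⁻¹' hull (facet T v) ⊆ closure (interior (φ ⁻¹' hull (facet T v))) := by
  have hd : 1 ≤ n + 1 := by omega
  have hg := hT.baryGrad_ne_zero hd hv
  obtain ⟨x₀, hx₀, hpos⟩ := hT.exists_bary_pos_of_facet hd hv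
  have : Fact (Module.finrank ℝ (E (n + 1)) = n + 1) := ⟨by simp⟩
  have hrank : Module.finrank ℝ (ℝ ∙ baryGrad T v)ᗮ = n :=
    Submodule.finrank_orthogonal_span_singleton hg
  let L : E n ≃ₗᵢ[ℝ] (ℝ ∙ baryGrad T v)ᗮ :=
    ((stdOrthonormalBasis ℝ (ℝ ∙ baryGrad T v)ᗮ).reindex (finCongr hrank)).repr.symm
  let φ : E n →ᵃⁱ[ℝ] E (n + 1) :=
    (AffineIsometryEquiv.vaddConst ℝ x₀).toAffineIsometry.comp
      ((Submodule.subtypeₗᵢ _).comp L.toLinearIsometry).toAffineIsometry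
  have hφ (y : E n) : φ y = (L y : E (n + 1)) + x₀ := rfl
  have hplane (y : E n) : bary T v (φ y) = 0 := by
    have h1 := bary_sub T v x₀ (φ y)
    rw [hx₀, sub_zero, hφ, add_sub_cancel_right] at h1
    rw [hφ, h1]
    exact Submodule.mem_orthogonal_singleton_iff_inner_right.1 (L y).2
  have hmem (y : E n) : φ y ∈ hull (facet T v) ↔ ∀ u ∈ facet T v, 0 ≤ bary T u (φ y) := by
    rw [hT.mem_hull_facet_iff hv, hT.mem_hull_iff]
    constructor
    · exact fun h u hu => h.1 u (mem_facet.1 hu).2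
    · refine fun h => ⟨fun u hu => ?_, hplane y⟩
      by_cases huv : u = v
      · rw [huv, hplane]
      · exact h u (mem_facet.2 ⟨huv, hu⟩)
  refine ⟨φ, φ.isometry, fun x hx => ?_, ?_⟩
  · have hx0 := ((hT.mem_hull_facet_iff hv).1 hx).2
    have h1 : x - x₀ ∈ (ℝ ∙ baryGrad T v)ᗮ := by
      rw [Submodule.mem_orthogonal_singleton_iff_inner_right, ← bary_sub, hx0, hx₀, sub_zero]
    refine ⟨L.symm ⟨x - x₀, h1⟩, ?_⟩
    rw [hφ, L.apply_symm_apply, sub_add_cancel]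
  · have hconv : Convex ℝ (φ ⁻¹' hull (facet T v)) :=
      (convex_hull (facet T v)).affine_preimage φ.toAffineMap
    have hne : (interior (φ ⁻¹' hull (facet T v))).Nonempty := by
      refine ⟨0, mem_interior_iff_mem_nhds.2 ?_⟩
      have hev : ∀ᶠ y in nhds (0 : E n), ∀ u ∈ facet T v, 0 < bary T u (φ y) := by
        rw [Filter.eventually_all_finset]
        intro u hu
        refine ((continuous_bary T u).comp φ.continuous).continuousAt.eventually_const_lt ?_
        simpa [hφ] using hpos u hu
      filter_upwards [hev] with y hy
      exact (hmem y).2 fun u hu => (hy u hu).le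
    rw [hconv.closure_interior_eq_closure_of_nonempty_interior hne]
    exact subset_closure

theorem restrict_facet_eq_map {n : ℕ} {F : Finset (E (n + 1))} {φ : E n → E (n + 1)}
    (hφ : Isometry φ) (hF : hull F ⊆ Set.range φ) :
    (μHE[n] : Measure (E (n + 1))).restrict (hull F)
      = (Measure.map φ volume).restrict (hull F) := by
  rw [← EuclideanSpace.euclideanHausdorffMeasure_eq_volume, hφ.map_euclideanHausdorffMeasure,
    Measure.restrict_restrict (measurableSet_hull F), Set.inter_eq_left.2 hF]

theorem integrableOn_facet (hT : IsSimplex T) (hd : 1 ≤ d) {v : E d} (hv : v ∈ T) {f : E d → ℝ}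
    (hf : Continuous f) : IntegrableOn f (hull (facet T v)) μHE[d - 1] := by
  obtain ⟨n, rfl⟩ : ∃ n, d = n + 1 := ⟨d - 1, by omega⟩
  obtain ⟨φ, hφ, hF, -⟩ := hT.exists_isometry_facet hv
  have hemb : MeasurableEmbedding φ := hφ.isClosedEmbedding.measurableEmbedding
  rw [Nat.add_sub_cancel, IntegrableOn, restrict_facet_eq_map hφ hF, ← IntegrableOn,
    hemb.integrableOn_map_iff]
  exact (hf.comp hφ.continuous).continuousOn.integrableOn_compact
    (hφ.isClosedEmbedding.isCompact_preimage (isCompact_hull _))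

theorem eq_zero_of_setIntegral_facet (hT : IsSimplex T) (hd : 1 ≤ d) {v : E d} (hv : v ∈ T)
    {f : E d → ℝ} (hf : Continuous f) (h0 : ∀ x, 0 ≤ f x)
    (h : ∫ x in hull (facet T v), f x ∂μHE[d - 1] = 0) : ∀ x ∈ hull (facet T v), f x = 0 := by
  obtain ⟨n, rfl⟩ : ∃ n, d = n + 1 := ⟨d - 1, by omega⟩
  obtain ⟨φ, hφ, hF, hcl⟩ := hT.exists_isometry_facet hv
  have hemb : MeasurableEmbedding φ := hφ.isClosedEmbedding.measurableEmbedding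
  rw [Nat.add_sub_cancel, restrict_facet_eq_map hφ hF, hemb.setIntegral_map] at h
  have hcont : Continuous (f ∘ φ) := hf.comp hφ.continuous
  have h1 := (setIntegral_eq_zero_iff_of_nonneg_ae (ae_of_all _ fun y => h0 (φ y))
    (hcont.continuousOn.integrableOn_compact
      (hφ.isClosedEmbedding.isCompact_preimage (isCompact_hull _)))).1 h
  have h2 := Measure.eqOn_of_ae_eq h1 hcont.continuousOn continuousOn_const hcl
  intro x hx
  obtain ⟨y, rfl⟩ := hF hx
  exact h2 hx

end IsSimplex

/-! ### Piecewise constant solenoidal fields -/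

namespace Triangulation

variable {M : Triangulation d}

/-- The linear potential of a constant force, through which Green's formula gives information on
constant fields. -/
theorem hasWeakGradient_inner (b : E d) :
    HasWeakGradient M.domain (fun x => inner ℝ b x) fun _ => b := by
  have hfin : IsFiniteMeasure (volume.restrict M.domain) := ⟨by
    rw [Measure.restrict_apply_univ]; exact M.volume_domain_lt_top⟩
  have hcont : Continuous fun x : E d => inner ℝ b x := by fun_prop
  refine ⟨?_, memLp_const b, fun φ hφ hc hs i => ?_⟩
  · have hK : IsCompact (⋃ T : M.Cell, hull T.1) := isCompact_iUnion fun T => isCompact_hull T.1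
    obtain ⟨K, hK⟩ := hK.exists_bound_of_continuousOn hcont.continuousOn
    refine MemLp.of_bound hcont.aestronglyMeasurable K ?_
    refine (ae_restrict_iff' (isOpen_interior).measurableSet).2 (ae_of_all _ fun x hx => hK x ?_)
    have := interior_subset (s := ⋃ T ∈ M.cells, hull T) hx
    simp only [Set.mem_iUnion] at this
    obtain ⟨T, hT, hxT⟩ := this
    exact Set.mem_iUnion.2 ⟨⟨T, hT⟩, hxT⟩
  · have hφc : Continuous φ := hφ.continuous
    have hdc : Continuous fun x => fderiv ℝ φ x (EuclideanSpace.single i 1) :=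
      (hφ.continuous_fderiv (by simp)).clm_apply continuous_const
    have hds : HasCompactSupport fun x => fderiv ℝ φ x (EuclideanSpace.single i 1) :=
      hc.fderiv_apply (𝕜 := ℝ) _
    have hder (x : E d) : fderiv ℝ (fun x => inner ℝ b x) x (EuclideanSpace.single i 1) = b i := by
      have h1 : HasFDerivAt (fun x => inner ℝ b x) (innerSL ℝ b) x := (innerSL ℝ b).hasFDerivAt
      rw [h1.fderiv, innerSL_apply_apply, EuclideanSpace.inner_single_right]
      simp
    have hibp := integral_mul_fderiv_eq_neg_fderiv_mul_of_integrable (μ := (volume : Measure (E d)))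
      (f := fun x => inner ℝ b x) (g := φ) (v := EuclideanSpace.single i 1)
      (by
        simp only [hder]
        exact (hφc.integrable_of_hasCompactSupport hc).const_mul _)
      ((hcont.mul hdc).integrable_of_hasCompactSupport hds.mul_left)
      ((hcont.mul hφc).integrable_of_hasCompactSupport hc.mul_left)
      (fun x _ => ((innerSL ℝ b).differentiableAt)) (fun x _ => hφ.differentiable (by simp) x)
    simp only [hder] at hibp
    rw [setIntegral_eq_integral_of_forall_compl_eq_zero, hibp,
      setIntegral_eq_integral_of_forall_compl_eq_zero]
    · intro x hx
      rw [image_eq_zero_of_notMem_tsupport fun h => hx (hs h), mul_zero]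
    · intro x hx
      rw [fderiv_of_notMem_tsupport ℝ fun h => hx (hs h)]
      simp

/-- A field that is constant on a set of cells closed under adjacency, and tangential to the
boundary there, vanishes. -/
theorem eq_zero_of_tangential (hd : 1 ≤ d) {K : Set M.Cell} (hne : K.Nonempty)
    (hK : ∀ T T' : M.Cell, T ≠ T' → ∀ v ∈ T.1, ∀ v' ∈ T'.1, facet T.1 v = facet T'.1 v' →
      T ∈ K → T' ∈ K) {b : E d}
    (hb : ∀ T ∈ K, ∀ v ∈ T.1, facet T.1 v ∈ M.boundaryFacets →
      inner ℝ b (outerNormal T.1 v) = 0) : b = 0 := by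
  classical
  -- The field equal to `b` on `K` and to zero elsewhere has a continuous normal component, as no
  -- facet joins `K` to another cell. Green's formula with the potential `b · x` says that `‖b‖²`
  -- times the volume of `K` is zero.
  have h := integral_greenIntegrand_eq_zero (M := M) hd (hasWeakGradient_inner b)
    (w := fun T _ => if T ∈ K then b else 0) (fun T => contDiff_const) ?_ ?_
  · by_contra hb0
    obtain ⟨T₀, hT₀⟩ := hne
    have hcell (T : M.Cell) : ∫ x in hull T.1, greenIntegrand (fun x => inner ℝ b x) (fun _ => b)
        (fun _ => if T ∈ K then b else 0) x = if T ∈ K then volume.real (hull T.1) * ‖b‖ ^ 2 else 0 := by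
      by_cases hT : T ∈ K <;> simp [greenIntegrand, fieldDiv, hT]
    rw [integral] at h
    simp only [hcell] at h
    have h1 := (Finset.sum_eq_zero_iff_of_nonneg fun T _ => by split_ifs <;> positivity).1 h T₀
      (Finset.mem_univ _)
    rw [if_pos hT₀] at h1
    have hvol : 0 < volume.real (hull T₀.1) :=
      ENNReal.toReal_pos (M.isSimplex T₀).volume_hull_pos.ne' (isCompact_hull _).measure_lt_top.ne
    have := norm_pos_iff.2 hb0
    exact (by positivity : volume.real (hull T₀.1) * ‖b‖ ^ 2 ≠ 0) h1
  · intro T T' hTT v hv v' hv' hF x _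
    have hiff : T ∈ K ↔ T' ∈ K :=
      ⟨hK T T' hTT v hv v' hv' hF, hK T' T hTT.symm v' hv' v hv hF.symm⟩
    rw [M.outerNormal_eq_neg hd hTT hv hv' hF]
    by_cases hT : T ∈ K
    · simp [hT, hiff.1 hT]
    · have hT' : T' ∉ K := fun h => hT (hiff.2 h)
      simp [hT, hT']
  · intro T v hv hF x _
    by_cases hT : T ∈ K
    · simp [hT, hb T hT v hv hF]
    · simp [hT]

end Triangulation

end MCS

namespace MCS

variable {d : ℕ}

/-! ### Test stresses -/

/-- The constant matrix field `a ⊗ b`. -/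
noncomputable def dyadPoly (a b : E d) : Matrix (Fin d) (Fin d) (Poly d) :=
  Matrix.of fun i j => MvPolynomial.C (a i * b j)

/-- The matrix field `∑ᵤ cᵤ ∇λᵤ ⊗ (u - v)`, whose tangential-normal trace on the boundary of the
simplex `T` is carried by the facet opposite to `v`. -/
noncomputable def edgeTensor (T : Finset (E d)) (v : E d) (c : E d → Poly d) :
    Matrix (Fin d) (Fin d) (Poly d) :=
  ∑ u ∈ T, c u • dyadPoly (baryGrad T u) (u - v)

theorem edgeTensor_apply (T : Finset (E d)) (v : E d) (c : E d → Poly d) (i j : Fin d) :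
    edgeTensor T v c i j = ∑ u ∈ T, (baryGrad T u i * (u - v) j) • c u := by
  simp only [edgeTensor, Matrix.sum_apply, Matrix.smul_apply, dyadPoly, Matrix.of_apply, smul_eq_mul]
  exact Finset.sum_congr rfl fun u _ => by rw [mul_comm, MvPolynomial.C_mul']

theorem edgeTensor_mem {T : Finset (E d)} {v : E d} {c : E d → Poly d} {k : ℕ}
    (hc : ∀ u ∈ T, c u ∈ MvPolynomial.restrictTotalDegree (Fin d) ℝ k) (i j : Fin d) :
    edgeTensor T v c i j ∈ MvPolynomial.restrictTotalDegree (Fin d) ℝ k := by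
  rw [edgeTensor_apply]
  exact Submodule.sum_mem _ fun u hu => Submodule.smul_mem _ _ (hc u hu)

theorem edgeTensor_mulVec (T : Finset (E d)) (v : E d) (c : E d → Poly d) (x N : E d) :
    (WithLp.toLp 2 (matAt (edgeTensor T v c) x *ᵥ fun i => N i) : E d)
      = ∑ u ∈ T, (polyAt (c u) x * inner ℝ (u - v) N) • baryGrad T u := by
  ext i
  simp only [Matrix.mulVec, dotProduct, matAt_apply, edgeTensor_apply, polyAt_sum, polyAt_smul,
    WithLp.ofLp_sum, Finset.sum_apply, PiLp.smul_apply, smul_eq_mul, inner_eq_sum, Finset.sum_mul,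
    Finset.mul_sum]
  rw [Finset.sum_comm]
  exact Finset.sum_congr rfl fun u _ => Finset.sum_congr rfl fun j _ => by ring

theorem frobPoly_edgeTensor (T : Finset (E d)) (v : E d) (c : E d → Poly d)
    (A : Matrix (Fin d) (Fin d) (Poly d)) :
    frobPoly A (edgeTensor T v c)
      = ∑ u ∈ T, c u * frobPoly A (dyadPoly (baryGrad T u) (u - v)) := by
  simp only [frobPoly, edgeTensor, Matrix.sum_apply, Matrix.smul_apply, smul_eq_mul, Finset.mul_sum]
  rw [Finset.sum_comm' (t' := Finset.univ) (s' := fun _ => Finset.univ) (by simp)]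
  simp only [Finset.sum_comm (t := T)]
  refine Finset.sum_congr rfl fun u _ => ?_
  rw [Finset.sum_comm]
  exact Finset.sum_congr rfl fun i _ => Finset.sum_congr rfl fun j _ => by ring

theorem frobPoly_dyad_mem {A : Matrix (Fin d) (Fin d) (Poly d)} {k : ℕ}
    (hA : ∀ i j, A i j ∈ MvPolynomial.restrictTotalDegree (Fin d) ℝ k) (a b : E d) :
    frobPoly A (dyadPoly a b) ∈ MvPolynomial.restrictTotalDegree (Fin d) ℝ k := by
  refine Submodule.sum_mem _ fun i _ => Submodule.sum_mem _ fun j _ => ?_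
  rw [dyadPoly, Matrix.of_apply, mul_comm, MvPolynomial.C_mul']
  exact Submodule.smul_mem _ _ (hA i j)

namespace IsSimplex

variable {T : Finset (E d)}

/-- Only the edge `w - v` is transversal to the facet opposite to `w`, and its term sends the normal
to a multiple of `∇λ_w`, which is normal itself. -/
theorem tnComponent_edgeTensor_of_ne (hT : IsSimplex T) (hd : 1 ≤ d) {v w : E d} (hv : v ∈ T)
    (hw : w ∈ T) (hne : w ≠ v) (c : E d → Poly d) (x : E d) :
    tnComponent (matAt (edgeTensor T v c) x) (outerNormal T w) = 0 := by
  obtain ⟨a, ha, hN⟩ := hT.outerNormal_eq_smul hd hw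
  rw [tnComponent, edgeTensor_mulVec, Finset.sum_eq_single_of_mem w hw]
  · have h1 : (polyAt (c w) x * inner ℝ (w - v) (outerNormal T w)) • baryGrad T w
        = (-(polyAt (c w) x * inner ℝ (w - v) (outerNormal T w)) * a⁻¹) • outerNormal T w := by
      generalize inner ℝ (w - v) (outerNormal T w) = t
      rw [hN, smul_neg, smul_smul, ← neg_smul]
      congr 1
      field_simp
    rw [h1, Triangulation.tangential_smul_self (hT.norm_outerNormal hd hw)]
  · intro u hu huw
    have h1 : inner ℝ (u - v) (outerNormal T w) = 0 := by
      rw [hT.inner_outerNormal_eq_zero_iff hd hw, ← bary_sub, hT.bary_of_ne hw hu huw,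
        hT.bary_of_ne hw hv hne.symm, sub_zero]
    rw [h1, mul_zero, zero_smul]

/-- All edges `u - v` with `u ≠ v` have the same normal component `1 / ‖∇λ_v‖` on this facet. The
norm in the coefficients compensates for it, and the sum becomes the expansion of `τ` in the
gradients. -/
theorem tnComponent_edgeTensor_self (hT : IsSimplex T) (hd : 1 ≤ d) {v : E d} (hv : v ∈ T)
    {c : E d → Poly d} {x τ : E d}
    (hc : ∀ u ∈ T, polyAt (c u) x = ‖baryGrad T v‖ * inner ℝ τ (u - v)) :
    tnComponent (matAt (edgeTensor T v c) x) (outerNormal T v) = tangential (outerNormal T v) τ := by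
  rw [tnComponent, edgeTensor_mulVec]
  congr 1
  conv_rhs => rw [← hT.sum_inner_sub_smul v τ]
  refine Finset.sum_congr rfl fun u hu => ?_
  congr 1
  by_cases huv : u = v
  · simp [huv]
  · have h1 : inner ℝ (u - v) (baryGrad T v) = -1 := by
      rw [real_inner_comm, ← bary_sub, hT.bary_of_ne hv hu huv, hT.bary_self hv, zero_sub]
    have h2 := norm_ne_zero_iff.2 (hT.baryGrad_ne_zero hd hv)
    rw [hc u hu, hT.outerNormal_eq hd hv, inner_neg_right, inner_smul_right, h1]
    field_simp

/-- A matrix field that is orthogonal to all `∇λᵤ ⊗ (u - v)` is zero. -/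
theorem eq_zero_of_frobPoly_dyad (hT : IsSimplex T) {A : Matrix (Fin d) (Fin d) (Poly d)}
    (h : ∀ u ∈ T, ∀ v ∈ T, frobPoly A (dyadPoly (baryGrad T u) (u - v)) = 0) : A = 0 := by
  obtain ⟨v₀, hv₀⟩ := hT.nonempty
  refine eq_zero_of_matAt_eq_zero isOpen_univ Set.univ_nonempty fun x _ => ?_
  -- For fixed `u`, the vector `Aᵀ ∇λ_u` is orthogonal to all edges at `u` and hence zero. The
  -- columns of `A` are then orthogonal to all gradients, hence zero too.
  have h1 (u : E d) (hu : u ∈ T) :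
      (WithLp.toLp 2 fun j => ∑ i, baryGrad T u i * polyAt (A i j) x : E d) = 0 := by
    set y : E d := WithLp.toLp 2 fun j => ∑ i, baryGrad T u i * polyAt (A i j) x with hy
    rw [← hT.sum_inner_sub_smul u y]
    refine Finset.sum_eq_zero fun v hv => ?_
    have h2 := congrArg (fun p => polyAt p x) (h u hu v hv)
    simp only [frobPoly, dyadPoly, Matrix.of_apply, polyAt_sum, polyAt_mul, polyAt_C,
      polyAt_zero] at h2
    have h3 : inner ℝ y (u - v) = 0 := by
      rw [← h2, inner_eq_sum, hy]
      simp only [Finset.sum_mul]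
      rw [Finset.sum_comm]
      exact Finset.sum_congr rfl fun i _ => Finset.sum_congr rfl fun j _ => by ring
    rw [← neg_sub, inner_neg_right, h3, neg_zero, zero_smul]
  ext i j
  have h2 : (WithLp.toLp 2 fun i => polyAt (A i j) x : E d) = 0 := by
    rw [← hT.sum_inner_smul_sub v₀ (WithLp.toLp 2 fun i => polyAt (A i j) x : E d)]
    refine Finset.sum_eq_zero fun u hu => ?_
    have h3 : inner ℝ (baryGrad T u) (WithLp.toLp 2 fun i => polyAt (A i j) x : E d) = 0 := by
      rw [inner_eq_sum]
      exact congrArg (fun y : E d => y j) (h1 u hu)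
    rw [h3, zero_smul]
  exact congrArg (fun y : E d => y i) h2

end IsSimplex

/-- The barycentric coordinate as a polynomial. -/
noncomputable def baryPoly (T : Finset (E d)) (v : E d) : Poly d :=
  MvPolynomial.C (bary T v 0) + ∑ i, baryGrad T v i • MvPolynomial.X i

theorem polyAt_baryPoly (T : Finset (E d)) (v x : E d) : polyAt (baryPoly T v) x = bary T v x := by
  rw [bary_eq, inner_eq_sum, baryPoly, add_comm]
  simp

theorem baryPoly_mem (T : Finset (E d)) (v : E d) :
    baryPoly T v ∈ MvPolynomial.restrictTotalDegree (Fin d) ℝ 1 := by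
  refine Submodule.add_mem _ ?_ (Submodule.sum_mem _ fun i _ => Submodule.smul_mem _ _ ?_)
  · rw [MvPolynomial.mem_restrictTotalDegree, MvPolynomial.totalDegree_C]
    exact zero_le_one
  · rw [MvPolynomial.mem_restrictTotalDegree, MvPolynomial.totalDegree_X]

theorem IsSimplex.baryPoly_ne_zero {T : Finset (E d)} (hT : IsSimplex T) {v : E d} (hv : v ∈ T) :
    baryPoly T v ≠ 0 := by
  intro h
  have h1 := polyAt_baryPoly T v v
  rw [h, polyAt_zero, hT.bary_self hv] at h1
  exact zero_ne_one h1

theorem tangential_neg_normal (N w : E d) : tangential (-N) w = tangential N w := by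
  simp [tangential]

theorem continuous_tangential (N : E d) : Continuous (tangential N) := by
  unfold tangential
  fun_prop

/-! ### Gradients, jumps and rigid motions detected by test stresses. -/

namespace Triangulation

variable {M : Triangulation d} {k : ℕ}

theorem tnComponent_zero (x N : E d) :
    tnComponent (matAt (0 : Matrix (Fin d) (Fin d) (Poly d)) x) N = 0 := by
  have h : matAt (0 : Matrix (Fin d) (Fin d) (Poly d)) x = 0 := by
    ext i j
    exact polyAt_zero x
  rw [tnComponent, h, Matrix.zero_mulVec]
  exact tangential_zero N

open Classical in
/-- If a skew-symmetric field represents the distributional gradient of a piecewise polynomial on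
all test stresses without tangential-normal trace, then it is the cellwise gradient. -/
theorem grad_eq_of_pairing (hd : 1 ≤ d) (hk : 1 ≤ k) {u : M.Vector} {ω : M.Tensor}
    (hu : ∀ T i, u T i ∈ MvPolynomial.restrictTotalDegree (Fin d) ℝ k)
    (hω : ω ∈ M.Strain (k - 1))
    (h : ∀ A ∈ M.Stress k, (∀ T : M.Cell, ∀ v ∈ T.1, ∀ x ∈ hull (facet T.1 v),
      tnComponent (matAt (A T) x) (outerNormal T.1 v) = 0) →
        M.pairing u A = M.intPoly fun T => frobPoly (ω T) (A T)) (T₀ : M.Cell) :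
    grad (u T₀) = ω T₀ := by
  have hT₀ := M.isSimplex T₀
  set G := grad (u T₀) - ω T₀ with hG
  have hGmem (i j : Fin d) : G i j ∈ MvPolynomial.restrictTotalDegree (Fin d) ℝ (k - 1) :=
    Submodule.sub_mem _ (pderiv_mem_restrictTotalDegree (hu T₀ i) j) (hω T₀ i j)
  refine sub_eq_zero.1 (hT₀.eq_zero_of_frobPoly_dyad fun a ha v hv => ?_)
  by_cases hav : a = v
  · have h0 : dyadPoly (baryGrad T₀.1 a) (a - v) = 0 := by
      ext1 i j
      simp [dyadPoly, hav]
    rw [h0]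
    simp [frobPoly]
  -- The test field is `λ_v q ∇λ_a ⊗ (a - v)`. Its degree is at most `k` because `G` has degree at
  -- most `k - 1`, and `λ_v` removes the trace on the facet opposite to `v`, the only one that could
  -- carry any.
  set q := frobPoly G (dyadPoly (baryGrad T₀.1 a) (a - v)) with hq
  set c : E d → Poly d := fun b => if b = a then baryPoly T₀.1 v * q else 0 with hc
  have hcmem (b : E d) : c b ∈ MvPolynomial.restrictTotalDegree (Fin d) ℝ k := by
    by_cases hb : b = a
    · have h1 := baryPoly_mem T₀.1 v
      have h2 := frobPoly_dyad_mem hGmem (baryGrad T₀.1 a) (a - v)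
      rw [← hq] at h2
      rw [MvPolynomial.mem_restrictTotalDegree] at h1 h2 ⊢
      rw [hc]
      simp only [if_pos hb]
      have := MvPolynomial.totalDegree_mul (baryPoly T₀.1 v) q
      omega
    · rw [hc]
      simp only [if_neg hb]
      exact Submodule.zero_mem _
  set A : M.Tensor := fun T => if T = T₀ then edgeTensor T₀.1 v c else 0 with hA
  have htn : ∀ T : M.Cell, ∀ w ∈ T.1, ∀ x ∈ hull (facet T.1 w),
      tnComponent (matAt (A T) x) (outerNormal T.1 w) = 0 := by
    intro T w hw x hx
    rw [hA]
    simp only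
    split_ifs with hT
    · subst hT
      by_cases hwv : w = v
      · subst hwv
        rw [tnComponent, edgeTensor_mulVec, Finset.sum_eq_zero, tangential_zero]
        intro b _
        have h0 : polyAt (c b) x = 0 := by
          rw [hc]
          simp only
          split_ifs
          · rw [polyAt_mul, polyAt_baryPoly, ((hT₀.mem_hull_facet_iff hv).1 hx).2, zero_mul]
          · exact polyAt_zero x
        rw [h0, zero_mul, zero_smul]
      · exact hT₀.tnComponent_edgeTensor_of_ne hd hv hw hwv c x
    · exact tnComponent_zero _ _
  have hAmem : A ∈ M.Stress k := by
    refine ⟨fun T i j => ?_, fun T T' _ w hw w' hw' hF x hx => ?_⟩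
    · rw [hA]
      simp only
      split_ifs
      · exact edgeTensor_mem (fun b _ => hcmem b) i j
      · exact Submodule.zero_mem _
    · rw [htn T w hw x hx, htn T' w' hw' x (hF ▸ hx), add_zero]
  have h1 := h A hAmem htn
  rw [pairing_eq_intPoly htn, ← sub_eq_zero, ← map_sub] at h1
  -- The tested difference is the integral of `λ_v q²` over `T₀`, with a non-negative weight that is
  -- not the zero polynomial.
  have h2 : ((fun T => frobPoly (A T) (grad (u T))) - fun T => frobPoly (ω T) (A T))
      = fun T => if T = T₀ then baryPoly T₀.1 v * (q * q) else 0 := by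
    funext T
    rw [Pi.sub_apply, frobPoly_comm (ω T), ← frobPoly_sub, frobPoly_comm, hA]
    simp only
    split_ifs with hT
    · subst hT
      rw [frobPoly_edgeTensor, Finset.sum_eq_single_of_mem a ha, ← hG, ← hq, hc]
      · simp only [if_true]
        ring
      · intro b _ hb
        rw [hc]
        simp only [if_neg hb, zero_mul]
    · simp [frobPoly]
  rw [h2] at h1
  have h3 := eq_zero_of_intPoly_eq_zero (fun T x hx => ?_) h1
  · have h4 := congrFun h3 T₀
    simp only [if_true] at h4
    exact mul_self_eq_zero.1 ((mul_eq_zero.1 h4).resolve_left (hT₀.baryPoly_ne_zero hv))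
  · split_ifs with hT
    · subst hT
      rw [polyAt_mul, polyAt_mul, polyAt_baryPoly]
      exact mul_nonneg (hT₀.mem_hull_iff.1 hx v hv) (mul_self_nonneg _)
    · rw [polyAt_zero]

theorem facet_notMem_boundaryFacets {T T' : M.Cell} (hne : T ≠ T') {v v' : E d}
    (hF : facet T.1 v = facet T'.1 v') : facet T.1 v ∉ M.boundaryFacets := by
  rintro ⟨T₁, -, w, -, -, huniq⟩
  have h1 := huniq T.1 T.2 fun u hu => (mem_facet.1 hu).2
  have h2 := huniq T'.1 T'.2 fun u hu => (mem_facet.1 (hF ▸ hu : u ∈ facet T'.1 v')).2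
  exact hne (Subtype.ext (h1.trans h2.symm))

open Classical in
/-- If the tangential jump terms of a piecewise polynomial vanish against all test stresses, then
its tangential component is continuous over interior facets. -/
theorem tangential_eq_of_jump_eq_zero (hd : 1 ≤ d) {u : M.Vector}
    (hu : ∀ T i, u T i ∈ MvPolynomial.restrictTotalDegree (Fin d) ℝ k)
    (h : ∀ A ∈ M.Stress k, M.TNTraceEq M.boundaryFacets A (fun _ _ => 0) →
      ∑ T : M.Cell, ∑ v ∈ T.1, ∫ x in hull (facet T.1 v),
        inner ℝ (tnComponent (matAt (A T) x) (outerNormal T.1 v))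
          (tangential (outerNormal T.1 v) (vecAt (u T) x)) ∂μHE[d - 1] = 0)
    {T T' : M.Cell} (hne : T ≠ T') {v v' : E d} (hv : v ∈ T.1) (hv' : v' ∈ T'.1)
    (hF : facet T.1 v = facet T'.1 v') {x : E d} (hx : x ∈ hull (facet T.1 v)) :
    tangential (outerNormal T.1 v) (vecAt (u T - u T') x) = 0 := by
  have hT := M.isSimplex T
  have hT' := M.isSimplex T'
  set τ := u T - u T' with hτ
  have hτmem (i : Fin d) : τ i ∈ MvPolynomial.restrictTotalDegree (Fin d) ℝ k :=
    Submodule.sub_mem _ (hu T i) (hu T' i)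
  -- The coefficients produce the trace `τ_t` on the common facet seen from `T` and `-τ_t` seen from
  -- `T'`; the opposite signs are what continuity means for outer normals.
  set c : E d → Poly d := fun b => ‖baryGrad T.1 v‖ • ∑ i, (b - v) i • τ i with hc
  set c' : E d → Poly d := fun b => (-‖baryGrad T'.1 v'‖) • ∑ i, (b - v') i • τ i with hc'
  have hcx (x b : E d) : polyAt (c b) x = ‖baryGrad T.1 v‖ * inner ℝ (vecAt τ x) (b - v) := by
    rw [hc, inner_eq_sum]
    simp [vecAt_apply, mul_comm]
  have hcx' (x b : E d) :
      polyAt (c' b) x = ‖baryGrad T'.1 v'‖ * inner ℝ (-vecAt τ x) (b - v') := by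
    rw [hc', inner_neg_left, inner_eq_sum]
    simp [vecAt_apply, mul_comm]
  have hcmem (b : E d) : c b ∈ MvPolynomial.restrictTotalDegree (Fin d) ℝ k :=
    Submodule.smul_mem _ _ (Submodule.sum_mem _ fun i _ => Submodule.smul_mem _ _ (hτmem i))
  have hcmem' (b : E d) : c' b ∈ MvPolynomial.restrictTotalDegree (Fin d) ℝ k :=
    Submodule.smul_mem _ _ (Submodule.sum_mem _ fun i _ => Submodule.smul_mem _ _ (hτmem i))
  set N := outerNormal T.1 v with hN
  have hN' : outerNormal T'.1 v' = -N := M.outerNormal_eq_neg hd hne hv hv' hF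
  set A : M.Tensor := fun S =>
    if S = T then edgeTensor T.1 v c else if S = T' then edgeTensor T'.1 v' c' else 0 with hA
  have hAT : A T = edgeTensor T.1 v c := by simp [hA]
  have hAT' : A T' = edgeTensor T'.1 v' c' := by simp [hA, hne.symm]
  have htn : ∀ y, tnComponent (matAt (A T) y) N = tangential N (vecAt τ y) := fun y => by
    rw [hAT]
    exact hT.tnComponent_edgeTensor_self hd hv fun b _ => hcx y b
  have htn' : ∀ y, tnComponent (matAt (A T') y) (outerNormal T'.1 v')
      = -tangential N (vecAt τ y) := fun y => by
    rw [hAT', hT'.tnComponent_edgeTensor_self hd hv' fun b _ => hcx' y b, hN',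
      tangential_neg_normal, ← zero_sub, tangential_sub, tangential_zero, zero_sub]
  have htn0 : ∀ S : M.Cell, ∀ w ∈ S.1, ¬(S = T ∧ w = v) → ¬(S = T' ∧ w = v') → ∀ y,
      tnComponent (matAt (A S) y) (outerNormal S.1 w) = 0 := by
    intro S w hw h1 h2 y
    by_cases hST : S = T
    · subst hST
      rw [hAT]
      exact hT.tnComponent_edgeTensor_of_ne hd hv hw (fun e => h1 ⟨rfl, e⟩) c y
    by_cases hST' : S = T'
    · subst hST'
      rw [hAT']
      exact hT'.tnComponent_edgeTensor_of_ne hd hv' hw (fun e => h2 ⟨rfl, e⟩) c' y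
    · have : A S = 0 := by simp [hA, hST, hST']
      rw [this]
      exact tnComponent_zero _ _
  have hfst : ∀ S : M.Cell, S ≠ T → ∀ w ∈ S.1, facet S.1 w = facet T.1 v → S = T' ∧ w = v' := by
    intro S hS w hw hSF
    obtain rfl := M.cell_eq_of_facet_eq hd hne (Ne.symm hS) hv hv' hw hF hSF.symm
    exact ⟨rfl, vertex_eq_of_facet_eq hw (hSF.trans hF)⟩
  have hsnd : ∀ S : M.Cell, S ≠ T' → ∀ w ∈ S.1, facet S.1 w = facet T'.1 v' → S = T ∧ w = v := by
    intro S hS w hw hSF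
    obtain rfl := M.cell_eq_of_facet_eq hd hne.symm (Ne.symm hS) hv' hv hw hF.symm hSF.symm
    exact ⟨rfl, vertex_eq_of_facet_eq hw (hSF.trans hF.symm)⟩
  have hAmem : A ∈ M.Stress k := by
    refine ⟨fun S i j => ?_, fun S S' hSS w hw w' hw' hSF y _ => ?_⟩
    · rw [hA]
      simp only
      split_ifs
      · exact edgeTensor_mem (fun b _ => hcmem b) i j
      · exact edgeTensor_mem (fun b _ => hcmem' b) i j
      · exact Submodule.zero_mem _
    · by_cases h1 : S = T ∧ w = v
      · obtain ⟨rfl, rfl⟩ := h1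
        obtain ⟨rfl, rfl⟩ := hfst S' hSS.symm w' hw' hSF.symm
        rw [htn, htn', add_neg_cancel]
      by_cases h2 : S = T' ∧ w = v'
      · obtain ⟨rfl, rfl⟩ := h2
        obtain ⟨rfl, rfl⟩ := hsnd S' hSS.symm w' hw' hSF.symm
        rw [htn, htn', neg_add_cancel]
      by_cases h3 : S' = T ∧ w' = v
      · obtain ⟨rfl, rfl⟩ := h3
        exact absurd (hfst S hSS w hw hSF) h2
      by_cases h4 : S' = T' ∧ w' = v'
      · obtain ⟨rfl, rfl⟩ := h4
        exact absurd (hsnd S hSS w hw hSF) h1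
      rw [htn0 S w hw h1 h2, htn0 S' w' hw' h3 h4, add_zero]
  have hAbd : M.TNTraceEq M.boundaryFacets A fun _ _ => 0 := by
    intro S w hw hSF y _
    refine htn0 S w hw ?_ ?_ y
    · rintro ⟨rfl, rfl⟩
      exact facet_notMem_boundaryFacets hne hF hSF
    · rintro ⟨rfl, rfl⟩
      exact facet_notMem_boundaryFacets hne.symm hF.symm hSF
  have hsum := h A hAmem hAbd
  have hcell : ∀ S : M.Cell, S ≠ T → S ≠ T' → ∑ w ∈ S.1, ∫ x in hull (facet S.1 w),
        inner ℝ (tnComponent (matAt (A S) x) (outerNormal S.1 w))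
          (tangential (outerNormal S.1 w) (vecAt (u S) x)) ∂μHE[d - 1] = 0 := by
    intro S h1 h2
    refine Finset.sum_eq_zero fun w hw => setIntegral_eq_zero_of_forall_eq_zero fun y _ => ?_
    rw [htn0 S w hw (fun e => h1 e.1) (fun e => h2 e.1), inner_zero_left]
  -- Only the two sides of the common facet survive, and together they form the integral of the
  -- squared norm of the tangential jump.
  rw [Finset.sum_eq_add_of_mem T T' (Finset.mem_univ _) (Finset.mem_univ _) hne
    (fun S _ hS => hcell S hS.1 hS.2), Finset.sum_eq_single_of_mem v hv,
    Finset.sum_eq_single_of_mem v' hv', ← hF] at hsum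
  rotate_left
  · intro w hw hwv
    refine setIntegral_eq_zero_of_forall_eq_zero fun y _ => ?_
    rw [htn0 T' w hw (fun e => hne e.1.symm) (fun e => hwv e.2), inner_zero_left]
  · intro w hw hwv
    refine setIntegral_eq_zero_of_forall_eq_zero fun y _ => ?_
    rw [htn0 T w hw (fun e => hwv e.2) (fun e => hne e.1), inner_zero_left]
  simp only [← hN, htn, htn'] at hsum
  simp only [hN', tangential_neg_normal, inner_neg_left] at hsum
  have hcτ : Continuous fun y => tangential N (vecAt τ y) :=
    (continuous_tangential N).comp (contDiff_vecAt τ).continuous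
  have hcu (S : M.Cell) : Continuous fun y => tangential N (vecAt (u S) y) :=
    (continuous_tangential N).comp (contDiff_vecAt (u S)).continuous
  have hi := hT.integrableOn_facet hd hv (hcτ.inner (𝕜 := ℝ) (hcu T))
  have hi' := hT.integrableOn_facet hd hv
    (f := fun y => -inner ℝ (tangential N (vecAt τ y)) (tangential N (vecAt (u T') y)))
    (hcτ.inner (hcu T')).neg
  rw [← integral_add hi hi'] at hsum
  have hpt (y : E d) : inner ℝ (tangential N (vecAt τ y)) (tangential N (vecAt (u T) y))
      + -inner ℝ (tangential N (vecAt τ y)) (tangential N (vecAt (u T') y))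
      = ‖tangential N (vecAt τ y)‖ ^ 2 := by
    rw [← sub_eq_add_neg, ← inner_sub_right, ← tangential_sub, ← vecAt_sub, ← hτ,
      real_inner_self_eq_norm_sq]
  simp only [hpt] at hsum
  have h0 := hT.eq_zero_of_setIntegral_facet hd hv (hcτ.norm.pow 2)
    (fun y => sq_nonneg ‖tangential N (vecAt τ y)‖) hsum x hx
  exact norm_eq_zero.1 (pow_eq_zero_iff two_ne_zero |>.1 h0)

/-- A piecewise rigid motion that is continuous over interior facets and tangential to the whole
boundary vanishes. -/
theorem eq_zero_of_rigid (hd : 1 ≤ d) {u : M.Vector} (hs : ∀ T, (grad (u T))ᵀ = -grad (u T))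
    (hc : ∀ T T' : M.Cell, T ≠ T' → ∀ v ∈ T.1, ∀ v' ∈ T'.1, facet T.1 v = facet T'.1 v' →
      ∀ x ∈ hull (facet T.1 v), vecAt (u T - u T') x = 0)
    (hb : M.NormalTraceEq M.boundaryFacets u fun _ _ => 0) : u = 0 := by
  funext T₀
  -- Rigid motions that agree on a facet are equal. The cells carrying the motion of `T₀` are thus
  -- closed under adjacency, which replaces connectedness of the mesh.
  have hadj : ∀ T T' : M.Cell, T ≠ T' → ∀ v ∈ T.1, ∀ v' ∈ T'.1, facet T.1 v = facet T'.1 v' →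
      T ∈ {T | u T = u T₀} → T' ∈ {T | u T = u T₀} := by
    intro T T' hne v hv v' hv' hF hT
    have h1 : (grad (u T - u T'))ᵀ = -grad (u T - u T') := by
      rw [grad_sub, Matrix.transpose_sub, hs, hs]
      abel
    have h2 := (M.isSimplex T).eq_zero_of_facet_of_grad_skew hd hv h1 (hc T T' hne v hv v' hv' hF)
    exact (sub_eq_zero.1 h2).symm.trans hT
  have hne : Set.Nonempty {T : M.Cell | u T = u T₀} := ⟨T₀, rfl⟩
  obtain ⟨A, hA, huA⟩ := exists_skew_of_grad_skew (hs T₀)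
  have hnormal : ∀ T ∈ {T : M.Cell | u T = u T₀}, ∀ v ∈ T.1, facet T.1 v ∈ M.boundaryFacets →
      ∀ x ∈ hull (facet T.1 v), inner ℝ (baryGrad T.1 v) (vecAt (u T₀) x) = 0 := by
    intro T hT v hv hF x hx
    have h1 := hb T v hv hF x hx
    rwa [(M.isSimplex T).inner_outerNormal_eq_zero_iff hd hv, hT] at h1
  -- Tangency to a boundary facet makes `A` annihilate the normal there, so by skew-symmetry each
  -- constant field `A y` is tangential to the boundary as well and vanishes. The remaining
  -- translation is removed in the same way.
  have hA0 : A = 0 := by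
    ext1 y
    refine eq_zero_of_tangential hd hne hadj fun T hT v hv hF => ?_
    rw [(M.isSimplex T).inner_outerNormal_eq_zero_iff hd hv, real_inner_comm, hA,
      (M.isSimplex T).skew_baryGrad_eq_zero hd hv hA, inner_zero_right, neg_zero]
    intro a ha b hb'
    rw [← huA, inner_sub_right, hnormal T hT v hv hF a (subset_hull ha),
      hnormal T hT v hv hF b (subset_hull hb'), sub_zero]
  have hconst (x y : E d) : vecAt (u T₀) x = vecAt (u T₀) y := by
    have := huA x y
    rw [hA0] at this
    exact sub_eq_zero.1 this
  refine eq_zero_of_vecAt_eq_zero fun x => ?_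
  refine eq_zero_of_tangential hd hne hadj fun T hT v hv hF => ?_
  obtain ⟨a, ha⟩ := (M.isSimplex T).facet_nonempty hd v
  rw [(M.isSimplex T).inner_outerNormal_eq_zero_iff hd hv, hconst x a]
  exact hnormal T hT v hv hF a (subset_hull ha)

/-! ### Uniqueness of the displacement and the rotation. -/

namespace GradientForce

variable {D : M.Data} {Ψ : E d → ℝ} {V : Submodule ℝ M.Vector} {P : M.Scalar}
  {C : Matrix (Fin d) (Fin d) ℝ →ₗ[ℝ] Matrix (Fin d) (Fin d) ℝ} {S : M.Fields}

/-- Once the strain is gone, compatibility says that the discrete distributional gradient of `u` is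
represented by the skew field `ω`. -/
theorem pairing_eq_rotation (H : GradientForce k D Ψ V) (hC : ∀ A, A ≠ 0 → 0 < frob (C A) A)
    (hP : M.IsL2Projection k Ψ P) (hS : M.IsSolution k C D V (M.QZeroMean k) S) {A : M.Tensor}
    (hA : A ∈ M.Stress k) (hA0 : M.TNTraceEq D.ΓNt A fun _ _ => 0) :
    M.pairing S.u A = M.intPoly fun T => frobPoly (S.ω T) (A T) := by
  have h := hS.eq_σ A hA hA0
  rw [loadStress_eq_zero H.tangential_zero] at h
  simp only [← polyAt_frobPoly, ← intPoly_apply] at h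
  have h0 : (fun T => frobPoly (S.ε T) (A T)) = 0 := by
    funext T
    simp [H.strain_eq_zero hC hP hS, frobPoly]
  rw [h0, map_zero, zero_sub] at h
  linarith

/-- The stress `(div u) I` is an admissible test because `div u ∈ Q_h^k`; skew fields do not see it,
and its pairing with `u` is `∫ (div u)²`. -/
theorem divergence_eq_zero (H : GradientForce k D Ψ V) (hC : ∀ A, A ≠ 0 → 0 < frob (C A) A)
    (hP : M.IsL2Projection k Ψ P) (hS : M.IsSolution k C D V (M.QZeroMean k) S) (T : M.Cell) :
    divergence (S.u T) = 0 := by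
  have hmem := (H.divergence_mem hS.mem_u (H.normalTrace_eq_zero hS)).1
  have h := H.pairing_eq_rotation hC hP hS (isotropic_mem_Stress H.dim_pos hmem)
    fun T v hv _ x _ => tnComponent_isotropic H.dim_pos _ hv x
  have h0 : (fun T => frobPoly (S.ω T) (isotropic (fun T => divergence (S.u T)) T)) = 0 := by
    funext T
    rw [isotropic, frobPoly_smul_one, trace_eq_zero_of_skew (hS.mem_ω.2 T), mul_zero]
    rfl
  rw [pairing_isotropic H.dim_pos, h0, map_zero] at h
  exact congrFun (eq_zero_of_intPoly_mul_self h) T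

/-- Being solenoidal, the Raviart–Thomas displacement has degree at most `k`, so that stresses of
order `k` can detect its gradient and its jumps. They show that it is a cellwise rigid motion with
continuous tangential part; its normal part is continuous by assumption and vanishes on Γ. -/
theorem eq_hydrostatic (H : GradientForce k D Ψ V) (hk : 1 ≤ k)
    (hC : ∀ A, A ≠ 0 → 0 < frob (C A) A) (hRT : (V : Set M.Vector) ⊆ M.RT k)
    (hP : M.IsL2Projection k Ψ P) (hS : M.IsSolution k C D V (M.QZeroMean k) S) :
    S = M.hydrostatic P := by
  have hd := H.dim_pos
  have hdeg : ∀ T i, S.u T i ∈ MvPolynomial.restrictTotalDegree (Fin d) ℝ k := by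
    intro T i
    obtain ⟨w, q, hw, hq, hu⟩ := (hRT hS.mem_u).2 T
    exact mem_restrictTotalDegree_of_divergence_eq_zero hk hw hq hu hd
      (H.divergence_eq_zero hC hP hS T) i
  have hgrad : ∀ T, grad (S.u T) = S.ω T :=
    grad_eq_of_pairing hd hk hdeg hS.mem_ω.1 fun A hA hA0 =>
      H.pairing_eq_rotation hC hP hS hA fun T v hv _ x hx => hA0 T v hv x hx
  have hskew : ∀ T, (grad (S.u T))ᵀ = -grad (S.u T) := fun T => by
    rw [hgrad]
    exact hS.mem_ω.2 T
  have hHDiv := H.subset_HDiv hS.mem_u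
  have hu : S.u = 0 := by
    refine eq_zero_of_rigid hd hskew (fun T T' hne v hv v' hv' hF x hx => ?_)
      (H.normal_boundary ▸ H.normalTrace_eq_zero hS)
    have ht := tangential_eq_of_jump_eq_zero (k := k) hd hdeg (fun A hA hA0 => ?_) hne hv hv' hF hx
    · have hn := hHDiv T T' hne v hv v' hv' hF x hx
      rw [M.outerNormal_eq_neg hd hne hv hv' hF, inner_neg_right, ← sub_eq_add_neg,
        ← inner_sub_left, ← vecAt_sub] at hn
      rw [tangential, real_inner_comm, hn, zero_smul, sub_zero] at ht
      exact ht
    -- A test vanishing on all of Γ is admissible for any choice of Γ_{N,t}. The cell terms cancel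
    -- because `Grad u = ω`, and only the jump terms remain.
    · have h := H.pairing_eq_rotation hC hP hS hA fun T v hv hF x hx => hA0 T v hv hF.1 x hx
      rw [pairing_eq_intPoly_sub] at h
      have h1 : (fun T => frobPoly (A T) (grad (S.u T))) = fun T => frobPoly (S.ω T) (A T) := by
        funext T
        rw [hgrad, frobPoly_comm]
      rw [h1, sub_eq_self] at h
      exact h
  have hω : S.ω = 0 := by
    funext T
    rw [← hgrad, hu]
    ext1 i j
    simp [grad]
  refine Fields.ext hu ?_ (H.strain_eq_zero hC hP hS) hω (H.pressure_eq hC hP hS)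
  rw [H.stress_eq_isotropic hC hP hS, H.pressure_eq hC hP hS]
  rfl

end GradientForce

end Triangulation

end MCS

/-! ### The pressure-robustness theorem. -/

theorem mainTheorem1 {d : ℕ} (hd : d = 2 ∨ d = 3) (M : MCS.Triangulation d)
    (k : ℕ) (hk : 1 ≤ k)
    -- the elasticity tensor, positive definite on matrices
    (C : Matrix (Fin d) (Fin d) ℝ →ₗ[ℝ] Matrix (Fin d) (Fin d) ℝ)
    (hC : ∀ A, A ≠ 0 → 0 < MCS.frob (C A) A)
    (D : M.Data)
    -- the normal displacement is prescribed as zero on the whole boundary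
    (hΓ : D.ΓDn = M.boundaryFacets)
    (hUn : ∀ F ∈ D.ΓDn, ∀ x ∈ MCS.hull F, D.Un F x = 0)
    -- clamped (tangential displacement zero) or symmetry (tangential traction zero) conditions
    (hUt : ∀ F ∈ D.ΓDt, ∀ x ∈ MCS.hull F, D.Ut F x = 0)
    (hTt : ∀ F ∈ D.ΓNt, ∀ x ∈ MCS.hull F, D.Tt F x = 0)
    -- the body force is the gradient of a potential with zero mean value
    (Ψ : MCS.E d → ℝ) (hΨ : MCS.HasWeakGradient M.domain Ψ D.B)
    (hmean : ∫ x in M.domain, Ψ x = 0)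
    -- the displacement space, with `div (V_h) = Q_h^k` under the boundary condition
    (V : Submodule ℝ M.Vector) (hV : (V : Set M.Vector) ⊆ M.HDiv)
    (hdiv : {q : M.Scalar | ∃ v ∈ V, M.NormalTraceEq D.ΓDn v (fun _ _ => 0) ∧
      q = fun T => MCS.divergence (v T)} = M.QZeroMean k) :
    (∃! P : M.Scalar, M.IsL2Projection k Ψ P) ∧
    ∀ P : M.Scalar, M.IsL2Projection k Ψ P →
      M.IsSolution k C D V (M.QZeroMean k) (M.hydrostatic P) ∧
      (∀ S : M.Fields, M.IsSolution k C D V (M.QZeroMean k) S →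
        S.ε = 0 ∧ S.p = P ∧ S.σ = fun T => P T • (1 : Matrix (Fin d) (Fin d) (MCS.Poly d))) ∧
      ((V : Set M.Vector) ⊆ M.RT k →
        ∀ S : M.Fields, M.IsSolution k C D V (M.QZeroMean k) S → S = M.hydrostatic P) := by
  have H : MCS.Triangulation.GradientForce k D Ψ V :=
    ⟨by omega, hΓ, hUn, hUt, hTt, hΨ, hmean, hV, hdiv⟩
  refine ⟨MCS.Triangulation.existsUnique_isL2Projection k
    (MCS.Triangulation.integrableOn_of_memLp hΨ.1), fun P hP =>
    ⟨H.isSolution_hydrostatic hP, fun S hS => ⟨H.strain_eq_zero hC hP hS, H.pressure_eq hC hP hS, ?_⟩,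
      fun hRT S hS => H.eq_hydrostatic hk hC hRT hP hS⟩⟩
  rw [H.stress_eq_isotropic hC hP hS, H.pressure_eq hC hP hS]
  rfl
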